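/- **Conventions.** A Gray-category $G$ has sets of $0$-, $1$-, $2$- and $3$-cells with sources and targets, an associative unital composition $g\#_0f$ of 1-cells, hom strict 2-categories (with composition $\#_1$ of 2-cells and, along 1-cells, of 3-cells, and composition $\#_2$ of 3-cells), whiskers $g\#_0\alpha$, $\alpha\#_0 f$, $g\#_0\Gamma$, $\Gamma\#_0 f$ of 2- and 3-cells by 1-cells that are strictly 2-functorial, associative and unital, and, for 2-cells $\alpha:f\to f'$ and $\beta:g\to g'$ with $g,f$ composable, an invertible 3-cell $\beta\otimes\alpha:(\beta\#_0f')\#_1(g\#_0\alpha)\to(g'\#_0\alpha)\#_1(\beta\#_0f)$ that is natural, functorial in both arguments and compatible with whiskers. Composites are written in the order of composition of functions. A (strict) Gray-functor preserves all this structure. *Path space.* Let $\mathbb H$ be a Gray-category. The Gray-category $\overrightarrow{\mathbb H}$ has * as 0-cells the 1-cells $f$ of $\mathbb H$; * as 1-cells $f\to f'$ the squares $g=(g_0,g_1,g_2)$ with a 2-cell $g_2:g_1\#_0f\to f'\#_0g_0$; * as 2-cells $g\to h$ (for $g,h:f\to f'$) the triples $\alpha=(\alpha_1:g_0\to h_0,\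 \alpha_2:g_1\to h_1,\ \alpha_3)$ with a 3-cell $\alpha_3:(f'\#_0\alpha_1)\#_1g_2\to h_2\#_1(\alpha_2\#_0f)$; * as 3-cells $\alpha\to\beta$ (for $\alpha,\beta:g\to h$) the pairs $\Gamma=(\Gamma_1:\alpha_1\to\beta_1,\Gamma_2:\alpha_2\to\beta_2)$ with $\beta_3\#_2((f'\#_0\Gamma_1)\#_1g_2)=(h_2\#_1(\Gamma_2\#_0f))\#_2\alpha_3$. Compositions of 1-, 2- and 3-cells are as follows. For $g:f\to f'$, $k:f'\to f''$, put $k\#_0g=(k_0\#_0g_0,\ k_1\#_0g_1,\ (k_2\#_0g_0)\#_1(k_1\#_0g_2))$. For $\alpha:g\to h$, $\beta:h\to h'$ (parallel $f\to f'$), $(\beta\#_1\alpha)_3=(\beta_3\#_1(\alpha_2\#_0f))\#_2((f'\#_0\beta_1)\#_1\alpha_3)$. For $\alpha:g\to h$ and $k:f'\to f''$, $(k\#_0\alpha)_3=((k_2\#_0h_0)\#_1(k_1\#_0\alpha_3))\#_2((k_2\otimes\alpha_1)^{-1}\#_1(k_1\#_0g_2))$. For $n:f\to f'$ and $\alpha:g\to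 h$ between squares $f'\to f''$, $(\alpha\#_0n)_3=((h_2\#_0n_0)\#_1(\alpha_2\otimes n_2))\#_2((\alpha_3\#_0n_0)\#_1(g_1\#_0n_2))$. All other components, all operations on 3-cells and the interchanger are componentwise; identities are $(1_x,1_y,1_f)$ for $f:x\to y$ and the triples and pairs of identities. The strict Gray-functors $d_0,d_1:\overrightarrow{\mathbb H}\to\mathbb H$ send $f:x\to y$ to $x$ and $y$ respectively, $g$ to $g_0,g_1$, $\alpha$ to $\alpha_1,\alpha_2$ and $\Gamma$ to $\Gamma_1,\Gamma_2$; the strict Gray-functor $i:\mathbb H\to\overrightarrow{\mathbb H}$ sends $x$ to $1_x$ and every higher cell to the constant one, with components equal to the cell itself and identities. Let $\overrightarrow{\mathbb H}\times_{\mathbb H}\overrightarrow{\mathbb H}$ be the (cellwise) pullback of pairs $(\hat c,c)$ of cells of equal dimension with $d_0\hat c=d_1c$, with projections $p_1,p_2$ to $\hat c$ and $c$, and let $T$ be the pullback of $p_2$ and $p_1$ (composable triples), with its projections $q_1,q_2$, $p_2q_1=p_1q_2$, to $\overrightarrow{\mathbb H}\times_{\mathbb H}\overrightarrow{\mathbb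 H}$. *Pseudo Gray-functors.* For a Gray-category $G$ let $Q^1G$ be the Gray-category with the same 0-cells; with 1-cells the composable strings $[f_1,\dots,f_n]$, $n\ge0$, of 1-cells of $G$, strings being identified when they differ by insertion of identity 1-cells (so 1-cells form the free category on the underlying reflexive graph); with 2-cells $(\alpha;u,v):u\to v$ the 2-cells $\alpha$ of $G$ from the composite of $u$ to the composite of $v$; and with 3-cells $(\alpha;u,v)\to(\beta;u,v)$ the 3-cells $\alpha\to\beta$ of $G$. The operations are those of $G$ together with concatenation of strings. $Q^1$ is a comonad on the category of Gray-categories and strict Gray-functors, with counit $e_G:Q^1G\to G$ composing strings and comultiplication $[f_1,\dots,f_n]\mapsto[[f_1],\dots,[f_n]]$. A *pseudo Gray-functor* $F:G\nrightarrow K$ is a strict Gray-functor $Q^1G\to K$, and $\mathrm{GrayCat}_{Q^1}$ is the co-Kleisli category of $Q^1$: Gray-categories and pseudo Gray-functors. A strict Gray-functor $F$ is regarded as the pseudo Gray-functor $F\circ e$. For composable 1-cells $h,g$ of $G$ let $\kappa_{h,g}=(1_{h\#_0g};[h,g],[h\#_0g])$. **Theorem.** Let $\mathbb H$ be a Gray-category.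 There is a pseudo Gray-functor $m:\overrightarrow{\mathbb H}\times_{\mathbb H}\overrightarrow{\mathbb H}\nrightarrow\overrightarrow{\mathbb H}$ such that the following hold. 1. ($m$ is horizontal pasting.) On 0-cells $m(\hat f,f)=\hat f\#_0f$. On 1-cells $(\hat g:\hat f\to\hat f',\ g:f\to f')$, $$m[(\hat g,g)]=\bigl(g_0,\ \hat g_1,\ (\hat f'\#_0g_2)\#_1(\hat g_2\#_0f)\bigr).$$ On 2-cells $(\hat\alpha:\hat g\to\hat h,\ \alpha:g\to h)$, $m((\hat\alpha,\alpha);[(\hat g,g)],[(\hat h,h)])$ is $$\Bigl(\alpha_1,\ \hat\alpha_2,\ \bigl((\hat f'\#_0h_2)\#_1(\hat\alpha_3\#_0f)\bigr)\#_2\bigl((\hat f'\#_0\alpha_3)\#_1(\hat g_2\#_0f)\bigr)\Bigr).$$ On 3-cells between 2-cells of this kind, $m(\hat\Gamma,\Gamma)=(\Gamma_1,\hat\Gamma_2)$. 2. (The 2-cocycle of $m$.) For composable 1-cells $(\hat g,g):(\hat f,f)\to(\hat f',f')$ and $(\hat h,h):(\hat f',f')\to(\hat f'',f'')$, the 2-cell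 $m^2_{(\hat h,h),(\hat g,g)}:=m(\kappa_{(\hat h,h),(\hat g,g)})$, from $m[(\hat h,h)]\#_0m[(\hat g,g)]$ to $m[(\hat h\#_0\hat g,\,h\#_0g)]$, is the triple consisting of the identity of $h_0\#_0g_0$, the identity of $\hat h_1\#_0\hat g_1$, and the 3-cell $$\bigl(\hat f''\#_0h_2\#_0g_0\bigr)\ \#_1\ \bigl(\hat h_2\otimes g_2\bigr)\ \#_1\ \bigl(\hat h_1\#_0\hat g_2\#_0f\bigr).$$ 3. With composition $m$, the diagram $$\overrightarrow{\mathbb H}\times_{\mathbb H}\overrightarrow{\mathbb H}\ \overset{m}{\nrightarrow}\ \overrightarrow{\mathbb H}\ \underset{d_0}{\overset{d_1}{\rightrightarrows}}\ \mathbb H,\qquad i:\mathbb H\to\overrightarrow{\mathbb H},$$ is an internal category in $\mathrm{GrayCat}_{Q^1}$, with source $d_0$, target $d_1$ and units $i$. That is, the pullback squares defining $\overrightarrow{\mathbb H}\times_{\mathbb H}\overrightarrow{\mathbb H}$ and $T$ are pullback squares also in $\mathrm{GrayCat}_{Q^1}$, and in $\mathrm{GrayCat}_{Q^1}$ one has $d_0i=1=d_1i$,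 $\ d_0m=d_0p_2$, $\ d_1m=d_1p_1$, $\ m\langle id_1,1\rangle=1=m\langle1,id_0\rangle$, and $\ m\langle mq_1,p_2q_2\rangle=m\langle p_1q_1,mq_2\rangle:T\nrightarrow\overrightarrow{\mathbb H}$, where $\langle a,b\rangle$ is the morphism into $\overrightarrow{\mathbb H}\times_{\mathbb H}\overrightarrow{\mathbb H}$ with $p_1\langle a,b\rangle=a$ and $p_2\langle a,b\rangle=b$. -/

import Mathlib

set_option linter.unusedSimpArgs false
set_option linter.unusedSectionVars false
set_option linter.unusedVariables false

universe u

/-- The cells and operations of a `Gray`-category: a reflexive 3-globular set with partially defined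
operations.  An operation is applied in the order of composition of functions and carries a proof
that its arguments are incident.

* `c0 g f` is the composite `g #₀ f` of 1-cells;
* `l2 g α`, `l3 g Γ` are the whiskers `g #₀ α`, `g #₀ Γ` of a 2-cell and of a 3-cell by a 1-cell, and
  `r2 α f`, `r3 Γ f` are the whiskers `α #₀ f`, `Γ #₀ f`;
* `c1 β α` is the composite `β #₁ α` of 2-cells, `h3 Δ Γ` the composite `Δ #₁ Γ` of 3-cells along a
  1-cell (the whisker `β #₁ Γ` is `h3 (i3 β) Γ`);
* `c2 Δ Γ` is the composite `Δ #₂ Γ` of 3-cells;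
* `tensor β α` is the interchanger `β ⊗ α : (β #₀ f') #₁ (g #₀ α) ⟶ (g' #₀ α) #₁ (β #₀ f)` of
  `β : g ⟶ g'` and `α : f ⟶ f'`, and `tinv β α` goes the other way. -/
structure GrayData where
  C0 : Type u
  C1 : Type u
  C2 : Type u
  C3 : Type u
  s0 : C1 → C0
  t0 : C1 → C0
  s1 : C2 → C1
  t1 : C2 → C1
  s2 : C3 → C2
  t2 : C3 → C2
  s0_t1 : ∀ α, s0 (t1 α) = s0 (s1 α)
  t0_t1 : ∀ α, t0 (t1 α) = t0 (s1 α)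
  s1_t2 : ∀ Γ, s1 (t2 Γ) = s1 (s2 Γ)
  t1_t2 : ∀ Γ, t1 (t2 Γ) = t1 (s2 Γ)
  i1 : C0 → C1
  i2 : C1 → C2
  i3 : C2 → C3
  s0_i1 : ∀ x, s0 (i1 x) = x
  t0_i1 : ∀ x, t0 (i1 x) = x
  s1_i2 : ∀ f, s1 (i2 f) = f
  t1_i2 : ∀ f, t1 (i2 f) = f
  s2_i3 : ∀ α, s2 (i3 α) = α
  t2_i3 : ∀ α, t2 (i3 α) = α
  c0 : (g f : C1) → s0 g = t0 f → C1
  l2 : (g : C1) → (α : C2) → s0 g = t0 (s1 α) → C2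
  r2 : (α : C2) → (f : C1) → s0 (s1 α) = t0 f → C2
  l3 : (g : C1) → (Γ : C3) → s0 g = t0 (s1 (s2 Γ)) → C3
  r3 : (Γ : C3) → (f : C1) → s0 (s1 (s2 Γ)) = t0 f → C3
  c1 : (β α : C2) → s1 β = t1 α → C2
  h3 : (Δ Γ : C3) → s1 (s2 Δ) = t1 (s2 Γ) → C3
  c2 : (Δ Γ : C3) → s2 Δ = t2 Γ → C3
  tensor : (β α : C2) → s0 (s1 β) = t0 (s1 α) → C3
  tinv : (β α : C2) → s0 (s1 β) = t0 (s1 α) → C3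
  s0_c0 : ∀ g f h, s0 (c0 g f h) = s0 f
  t0_c0 : ∀ g f h, t0 (c0 g f h) = t0 g
  s1_l2 : ∀ g α h, s1 (l2 g α h) = c0 g (s1 α) h
  t1_l2 : ∀ g α h, t1 (l2 g α h) = c0 g (t1 α) (h.trans (t0_t1 α).symm)
  s1_r2 : ∀ α f h, s1 (r2 α f h) = c0 (s1 α) f h
  t1_r2 : ∀ α f h, t1 (r2 α f h) = c0 (t1 α) f ((s0_t1 α).trans h)
  s2_l3 : ∀ g Γ h, s2 (l3 g Γ h) = l2 g (s2 Γ) h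
  t2_l3 : ∀ g Γ h, t2 (l3 g Γ h) = l2 g (t2 Γ) (by rw [s1_t2, h])
  s2_r3 : ∀ Γ f h, s2 (r3 Γ f h) = r2 (s2 Γ) f h
  t2_r3 : ∀ Γ f h, t2 (r3 Γ f h) = r2 (t2 Γ) f (by rw [s1_t2, h])
  s1_c1 : ∀ β α h, s1 (c1 β α h) = s1 α
  t1_c1 : ∀ β α h, t1 (c1 β α h) = t1 β
  s2_h3 : ∀ Δ Γ h, s2 (h3 Δ Γ h) = c1 (s2 Δ) (s2 Γ) h
  t2_h3 : ∀ Δ Γ h, t2 (h3 Δ Γ h) = c1 (t2 Δ) (t2 Γ) (by rw [s1_t2, t1_t2, h])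
  s2_c2 : ∀ Δ Γ h, s2 (c2 Δ Γ h) = s2 Γ
  t2_c2 : ∀ Δ Γ h, t2 (c2 Δ Γ h) = t2 Δ
  s2_tensor : ∀ β α h, s2 (tensor β α h) =
    c1 (r2 β (t1 α) (by rw [t0_t1, h])) (l2 (s1 β) α h) (by rw [s1_r2, t1_l2])
  t2_tensor : ∀ β α h, t2 (tensor β α h) =
    c1 (l2 (t1 β) α (by rw [s0_t1, h])) (r2 β (s1 α) h) (by rw [s1_l2, t1_r2])
  s2_tinv : ∀ β α h, s2 (tinv β α h) = t2 (tensor β α h)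
  t2_tinv : ∀ β α h, t2 (tinv β α h) = s2 (tensor β α h)

namespace GrayData

attribute [simp] s0_t1 t0_t1 s1_t2 t1_t2 s0_i1 t0_i1 s1_i2 t1_i2 s2_i3 t2_i3 s0_c0 t0_c0 s1_l2 t1_l2
  s1_r2 t1_r2 s2_l3 t2_l3 s2_r3 t2_r3 s1_c1 t1_c1 s2_h3 t2_h3 s2_c2 t2_c2 s2_tensor t2_tensor
  s2_tinv t2_tinv

end GrayData

/-- A `Gray`-category: every hom is a strict 2-category, whiskering by a 1-cell on either side is a
strict 2-functor, whiskering is associative and unital, and the interchanger is invertible, natural,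
functorial in both arguments and compatible with whiskers. -/
class GrayData.IsGray (G : GrayData.{u}) : Prop where
  c0_assoc : ∀ h g f hg gf, G.c0 (G.c0 h g hg) f (by simp [gf]) = G.c0 h (G.c0 g f gf) (by simp [hg])
  i1_c0 : ∀ x f h, G.c0 (G.i1 x) f h = f
  c0_i1 : ∀ f x h, G.c0 f (G.i1 x) h = f
  -- the hom 2-categories
  c1_assoc : ∀ γ β α hg hb, G.c1 (G.c1 γ β hg) α (by simp [hb]) = G.c1 γ (G.c1 β α hb) (by simp [hg])
  i2_c1 : ∀ f α h, G.c1 (G.i2 f) α h = α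
  c1_i2 : ∀ α f h, G.c1 α (G.i2 f) h = α
  c2_assoc : ∀ Θ Δ Γ hg hb, G.c2 (G.c2 Θ Δ hg) Γ (by simp [hb]) = G.c2 Θ (G.c2 Δ Γ hb) (by simp [hg])
  i3_c2 : ∀ α Γ h, G.c2 (G.i3 α) Γ h = Γ
  c2_i3 : ∀ Γ α h, G.c2 Γ (G.i3 α) h = Γ
  h3_assoc : ∀ Θ Δ Γ hg hb, G.h3 (G.h3 Θ Δ hg) Γ (by simp [hb]) = G.h3 Θ (G.h3 Δ Γ hb) (by simp [hg])
  i3_h3 : ∀ f Γ h, G.h3 (G.i3 (G.i2 f)) Γ h = Γ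
  h3_i3 : ∀ Γ f h, G.h3 Γ (G.i3 (G.i2 f)) h = Γ
  i3_c1 : ∀ β α h, G.i3 (G.c1 β α h) = G.h3 (G.i3 β) (G.i3 α) (by simp [h])
  h3_c2 : ∀ Δ' Δ Γ' Γ hd hg h, G.h3 (G.c2 Δ' Δ hd) (G.c2 Γ' Γ hg) (by simp [h]) =
    G.c2 (G.h3 Δ' Γ' (by rw [hd, hg]; simp [h])) (G.h3 Δ Γ h) (by simp [hd, hg])
  -- whiskering on the left
  l2_i2 : ∀ g f h, G.l2 g (G.i2 f) (by simp [h]) = G.i2 (G.c0 g f h)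
  l2_c1 : ∀ g β α hg h, G.l2 g (G.c1 β α h) (by simp [hg]) =
    G.c1 (G.l2 g β (by simp [h, hg])) (G.l2 g α hg) (by simp [h])
  l3_i3 : ∀ g α h, G.l3 g (G.i3 α) (by simp [h]) = G.i3 (G.l2 g α h)
  l3_c2 : ∀ g Δ Γ hg h, G.l3 g (G.c2 Δ Γ h) (by simp [hg]) =
    G.c2 (G.l3 g Δ (by simp [h, hg])) (G.l3 g Γ hg) (by simp [h])
  l3_h3 : ∀ g Δ Γ hg h, G.l3 g (G.h3 Δ Γ h) (by simp [hg]) =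
    G.h3 (G.l3 g Δ (by simp [h, hg])) (G.l3 g Γ hg) (by simp [h])
  i1_l2 : ∀ x α h, G.l2 (G.i1 x) α h = α
  i1_l3 : ∀ x Γ h, G.l3 (G.i1 x) Γ h = Γ
  c0_l2 : ∀ h g α hh hg, G.l2 (G.c0 h g hh) α (by simp [hg]) = G.l2 h (G.l2 g α hg) (by simp [hh])
  c0_l3 : ∀ h g Γ hh hg, G.l3 (G.c0 h g hh) Γ (by simp [hg]) = G.l3 h (G.l3 g Γ hg) (by simp [hh])
  -- whiskering on the right
  r2_i2 : ∀ g f h, G.r2 (G.i2 g) f (by simp [h]) = G.i2 (G.c0 g f h)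
  r2_c1 : ∀ β α f h hf, G.r2 (G.c1 β α h) f (by simp [hf]) =
    G.c1 (G.r2 β f (by simp [h, hf])) (G.r2 α f hf) (by simp [h])
  r3_i3 : ∀ α f h, G.r3 (G.i3 α) f (by simp [h]) = G.i3 (G.r2 α f h)
  r3_c2 : ∀ Δ Γ f h hf, G.r3 (G.c2 Δ Γ h) f (by simp [hf]) =
    G.c2 (G.r3 Δ f (by simp [h, hf])) (G.r3 Γ f hf) (by simp [h])
  r3_h3 : ∀ Δ Γ f h hf, G.r3 (G.h3 Δ Γ h) f (by simp [hf]) =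
    G.h3 (G.r3 Δ f (by simp [h, hf])) (G.r3 Γ f hf) (by simp [h])
  r2_i1 : ∀ α x h, G.r2 α (G.i1 x) h = α
  r3_i1 : ∀ Γ x h, G.r3 Γ (G.i1 x) h = Γ
  r2_c0 : ∀ α g f hg hf, G.r2 α (G.c0 g f hf) (by simp [hg]) = G.r2 (G.r2 α g hg) f (by simp [hf])
  r3_c0 : ∀ Γ g f hg hf, G.r3 Γ (G.c0 g f hf) (by simp [hg]) = G.r3 (G.r3 Γ g hg) f (by simp [hf])
  r2_l2 : ∀ g α f hg hf, G.r2 (G.l2 g α hg) f (by simp [hf]) = G.l2 g (G.r2 α f hf) (by simp [hg])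
  r3_l3 : ∀ g Γ f hg hf, G.r3 (G.l3 g Γ hg) f (by simp [hf]) = G.l3 g (G.r3 Γ f hf) (by simp [hg])
  -- the interchanger
  tinv_tensor : ∀ β α h, G.c2 (G.tinv β α h) (G.tensor β α h) (by simp) = G.i3 (G.s2 (G.tensor β α h))
  tensor_tinv : ∀ β α h, G.c2 (G.tensor β α h) (G.tinv β α h) (by simp) = G.i3 (G.t2 (G.tensor β α h))
  tensor_nat : ∀ Δ Γ h,
    G.c2 (G.tensor (G.t2 Δ) (G.t2 Γ) (by simp [h]))
        (G.h3 (G.r3 Δ (G.t1 (G.s2 Γ)) (by simp [h])) (G.l3 (G.s1 (G.s2 Δ)) Γ h) (by simp)) (by simp) =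
      G.c2 (G.h3 (G.l3 (G.t1 (G.s2 Δ)) Γ (by simp [h])) (G.r3 Δ (G.s1 (G.s2 Γ)) h) (by simp))
        (G.tensor (G.s2 Δ) (G.s2 Γ) h) (by simp)
  i2_tensor : ∀ g α h, G.tensor (G.i2 g) α (by simp [h]) = G.i3 (G.l2 g α h)
  tensor_i2 : ∀ β f h, G.tensor β (G.i2 f) (by simp [h]) = G.i3 (G.r2 β f h)
  c1_tensor : ∀ β' β α hb h, G.tensor (G.c1 β' β hb) α (by simp [h]) =
    G.c2 (G.h3 (G.tensor β' α (by simp [hb, h])) (G.i3 (G.r2 β (G.s1 α) h)) (by simp [hb]))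
      (G.h3 (G.i3 (G.r2 β' (G.t1 α) (by simp [hb, h]))) (G.tensor β α h) (by simp [hb])) (by simp [hb, ← c1_assoc])
  tensor_c1 : ∀ β α' α ha h, G.tensor β (G.c1 α' α ha) (by simp [h]) =
    G.c2 (G.h3 (G.i3 (G.l2 (G.t1 β) α' (by simp [ha, h]))) (G.tensor β α h) (by simp [ha]))
      (G.h3 (G.tensor β α' (by simp [ha, h])) (G.i3 (G.l2 (G.s1 β) α h)) (by simp [ha])) (by simp [ha, ← c1_assoc])
  l2_tensor : ∀ g β α hg h, G.tensor (G.l2 g β hg) α (by simp [h]) =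
    G.l3 g (G.tensor β α h) (by simp [hg])
  r2_tensor : ∀ β g α hg h, G.tensor (G.r2 β g hg) α (by simp [h]) =
    G.tensor β (G.l2 g α h) (by simp [hg])
  tensor_r2 : ∀ β α f h hf, G.tensor β (G.r2 α f hf) (by simp [h]) =
    G.r3 (G.tensor β α h) f (by simp [hf])

/-- A `Gray`-category. -/
structure GrayCat extends GrayData.{u} where
  isGray : toGrayData.IsGray

attribute [instance] GrayCat.isGray

attribute [simp] GrayData.IsGray.i1_c0 GrayData.IsGray.c0_i1 GrayData.IsGray.i2_c1
  GrayData.IsGray.c1_i2 GrayData.IsGray.i3_c2 GrayData.IsGray.c2_i3 GrayData.IsGray.i3_h3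
  GrayData.IsGray.h3_i3 GrayData.IsGray.i1_l2 GrayData.IsGray.i1_l3
  GrayData.IsGray.r2_i1 GrayData.IsGray.r3_i1
 

/-- A (strict) `Gray`-functor: a map of 3-globular sets preserving all operations. -/
@[ext]
structure GrayFunctor (G H : GrayCat.{u}) where
  map0 : G.C0 → H.C0
  map1 : G.C1 → H.C1
  map2 : G.C2 → H.C2
  map3 : G.C3 → H.C3
  s0_map : ∀ f, H.s0 (map1 f) = map0 (G.s0 f)
  t0_map : ∀ f, H.t0 (map1 f) = map0 (G.t0 f)
  s1_map : ∀ α, H.s1 (map2 α) = map1 (G.s1 α)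
  t1_map : ∀ α, H.t1 (map2 α) = map1 (G.t1 α)
  s2_map : ∀ Γ, H.s2 (map3 Γ) = map2 (G.s2 Γ)
  t2_map : ∀ Γ, H.t2 (map3 Γ) = map2 (G.t2 Γ)
  map_i1 : ∀ x, map1 (G.i1 x) = H.i1 (map0 x)
  map_i2 : ∀ f, map2 (G.i2 f) = H.i2 (map1 f)
  map_i3 : ∀ α, map3 (G.i3 α) = H.i3 (map2 α)
  map_c0 : ∀ g f h, map1 (G.c0 g f h) = H.c0 (map1 g) (map1 f) (by rw [s0_map, t0_map, h])
  map_l2 : ∀ g α h, map2 (G.l2 g α h) =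
    H.l2 (map1 g) (map2 α) (by rw [s0_map, s1_map, t0_map, h])
  map_r2 : ∀ α f h, map2 (G.r2 α f h) =
    H.r2 (map2 α) (map1 f) (by rw [s1_map, s0_map, t0_map, h])
  map_l3 : ∀ g Γ h, map3 (G.l3 g Γ h) =
    H.l3 (map1 g) (map3 Γ) (by rw [s0_map, s2_map, s1_map, t0_map, h])
  map_r3 : ∀ Γ f h, map3 (G.r3 Γ f h) =
    H.r3 (map3 Γ) (map1 f) (by rw [s2_map, s1_map, s0_map, t0_map, h])
  map_c1 : ∀ β α h, map2 (G.c1 β α h) = H.c1 (map2 β) (map2 α) (by rw [s1_map, t1_map, h])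
  map_h3 : ∀ Δ Γ h, map3 (G.h3 Δ Γ h) =
    H.h3 (map3 Δ) (map3 Γ) (by rw [s2_map, s2_map, s1_map, t1_map, h])
  map_c2 : ∀ Δ Γ h, map3 (G.c2 Δ Γ h) = H.c2 (map3 Δ) (map3 Γ) (by rw [s2_map, t2_map, h])
  map_tensor : ∀ β α h, map3 (G.tensor β α h) =
    H.tensor (map2 β) (map2 α) (by rw [s1_map, s1_map, s0_map, t0_map, h])

namespace GrayFunctor

attribute [simp] s0_map t0_map s1_map t1_map s2_map t2_map map_i1 map_i2 map_i3 map_c0 map_l2 map_r2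
  map_l3 map_r3 map_c1 map_h3 map_c2 map_tensor

/-- The identity `Gray`-functor. -/
@[simps]
def id (G : GrayCat.{u}) : GrayFunctor G G where
  map0 x := x
  map1 f := f
  map2 α := α
  map3 Γ := Γ
  s0_map _ := rfl
  t0_map _ := rfl
  s1_map _ := rfl
  t1_map _ := rfl
  s2_map _ := rfl
  t2_map _ := rfl
  map_i1 _ := rfl
  map_i2 _ := rfl
  map_i3 _ := rfl
  map_c0 _ _ _ := rfl
  map_l2 _ _ _ := rfl
  map_r2 _ _ _ := rfl
  map_l3 _ _ _ := rfl
  map_r3 _ _ _ := rfl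
  map_c1 _ _ _ := rfl
  map_h3 _ _ _ := rfl
  map_c2 _ _ _ := rfl
  map_tensor _ _ _ := rfl

/-- The composite `Gray`-functor `F`, then `K`. -/
@[simps]
def comp {G H L : GrayCat.{u}} (F : GrayFunctor G H) (K : GrayFunctor H L) : GrayFunctor G L where
  map0 x := K.map0 (F.map0 x)
  map1 f := K.map1 (F.map1 f)
  map2 α := K.map2 (F.map2 α)
  map3 Γ := K.map3 (F.map3 Γ)
  s0_map _ := by simp
  t0_map _ := by simp
  s1_map _ := by simp
  t1_map _ := by simp
  s2_map _ := by simp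
  t2_map _ := by simp
  map_i1 _ := by simp
  map_i2 _ := by simp
  map_i3 _ := by simp
  map_c0 _ _ _ := by simp
  map_l2 _ _ _ := by simp
  map_r2 _ _ _ := by simp
  map_l3 _ _ _ := by simp
  map_r3 _ _ _ := by simp
  map_c1 _ _ _ := by simp
  map_h3 _ _ _ := by simp
  map_c2 _ _ _ := by simp
  map_tensor _ _ _ := by simp

/-- The inverse of an interchanger is preserved. -/
theorem map_tinv {G H : GrayCat.{u}} (F : GrayFunctor G H) (β α : G.C2)
    (h : G.s0 (G.s1 β) = G.t0 (G.s1 α)) :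
    F.map3 (G.tinv β α h) = H.tinv (F.map2 β) (F.map2 α) (by simp [h]) := by
  have h1 := congrArg F.map3 (GrayData.IsGray.tensor_tinv β α h)
  simp only [map_c2, map_tensor, map_i3] at h1
  have h2 := GrayData.IsGray.tinv_tensor (F.map2 β) (F.map2 α) (by simp [h])
  calc F.map3 (G.tinv β α h)
      = H.c2 (H.i3 _) (F.map3 (G.tinv β α h)) (by rw [GrayData.s2_i3]) :=
        (GrayData.IsGray.i3_c2 _ _ _).symm
    _ = H.c2 (H.c2 (H.tinv (F.map2 β) (F.map2 α) (by simp [h]))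
          (H.tensor (F.map2 β) (F.map2 α) (by simp [h])) (by simp))
          (F.map3 (G.tinv β α h)) (by simp [h]) := by
        congr 1
        rw [h2]; simp [h]
    _ = H.c2 (H.tinv (F.map2 β) (F.map2 α) (by simp [h])) (H.i3 (F.map2 (G.t2 (G.tensor β α h))))
          (by simp) := by
        rw [GrayData.IsGray.c2_assoc _ _ _ (by simp) (by simp [h])]
        congr 1
    _ = H.tinv (F.map2 β) (F.map2 α) (by simp [h]) := GrayData.IsGray.c2_i3 _ _ _

end GrayFunctor

/-- The category of `Gray`-categories and `Gray`-functors. -/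
instance : CategoryTheory.Category GrayCat.{u} where
  Hom G H := GrayFunctor G H
  id G := GrayFunctor.id G
  comp F K := F.comp K

namespace GrayCat

/-- The cells and operations of the pullback of two `Gray`-functors, formed in each dimension. -/
def pbData {A B C : GrayCat.{u}} (F : GrayFunctor A C) (K : GrayFunctor B C) : GrayData.{u} where
  C0 := {p : A.C0 × B.C0 // F.map0 p.1 = K.map0 p.2}
  C1 := {p : A.C1 × B.C1 // F.map1 p.1 = K.map1 p.2}
  C2 := {p : A.C2 × B.C2 // F.map2 p.1 = K.map2 p.2}
  C3 := {p : A.C3 × B.C3 // F.map3 p.1 = K.map3 p.2}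
  s0 f := ⟨(A.s0 f.1.1, B.s0 f.1.2), by simp only [← F.s0_map, ← K.s0_map, f.2]⟩
  t0 f := ⟨(A.t0 f.1.1, B.t0 f.1.2), by simp only [← F.t0_map, ← K.t0_map, f.2]⟩
  s1 f := ⟨(A.s1 f.1.1, B.s1 f.1.2), by simp only [← F.s1_map, ← K.s1_map, f.2]⟩
  t1 f := ⟨(A.t1 f.1.1, B.t1 f.1.2), by simp only [← F.t1_map, ← K.t1_map, f.2]⟩
  s2 f := ⟨(A.s2 f.1.1, B.s2 f.1.2), by simp only [← F.s2_map, ← K.s2_map, f.2]⟩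
  t2 f := ⟨(A.t2 f.1.1, B.t2 f.1.2), by simp only [← F.t2_map, ← K.t2_map, f.2]⟩
  s0_t1 _ := by simp
  t0_t1 _ := by simp
  s1_t2 _ := by simp
  t1_t2 _ := by simp
  i1 x := ⟨(A.i1 x.1.1, B.i1 x.1.2), by simp [x.2]⟩
  i2 x := ⟨(A.i2 x.1.1, B.i2 x.1.2), by simp [x.2]⟩
  i3 x := ⟨(A.i3 x.1.1, B.i3 x.1.2), by simp [x.2]⟩
  s0_i1 _ := by simp
  t0_i1 _ := by simp
  s1_i2 _ := by simp
  t1_i2 _ := by simp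
  s2_i3 _ := by simp
  t2_i3 _ := by simp
  c0 g f h := ⟨(A.c0 g.1.1 f.1.1 (congrArg (·.1.1) h), B.c0 g.1.2 f.1.2 (congrArg (·.1.2) h)),
    by simp [g.2, f.2]⟩
  l2 g f h := ⟨(A.l2 g.1.1 f.1.1 (congrArg (·.1.1) h), B.l2 g.1.2 f.1.2 (congrArg (·.1.2) h)),
    by simp [g.2, f.2]⟩
  r2 g f h := ⟨(A.r2 g.1.1 f.1.1 (congrArg (·.1.1) h), B.r2 g.1.2 f.1.2 (congrArg (·.1.2) h)),
    by simp [g.2, f.2]⟩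
  l3 g f h := ⟨(A.l3 g.1.1 f.1.1 (congrArg (·.1.1) h), B.l3 g.1.2 f.1.2 (congrArg (·.1.2) h)),
    by simp [g.2, f.2]⟩
  r3 g f h := ⟨(A.r3 g.1.1 f.1.1 (congrArg (·.1.1) h), B.r3 g.1.2 f.1.2 (congrArg (·.1.2) h)),
    by simp [g.2, f.2]⟩
  c1 g f h := ⟨(A.c1 g.1.1 f.1.1 (congrArg (·.1.1) h), B.c1 g.1.2 f.1.2 (congrArg (·.1.2) h)),
    by simp [g.2, f.2]⟩
  h3 g f h := ⟨(A.h3 g.1.1 f.1.1 (congrArg (·.1.1) h), B.h3 g.1.2 f.1.2 (congrArg (·.1.2) h)),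
    by simp [g.2, f.2]⟩
  c2 g f h := ⟨(A.c2 g.1.1 f.1.1 (congrArg (·.1.1) h), B.c2 g.1.2 f.1.2 (congrArg (·.1.2) h)),
    by simp [g.2, f.2]⟩
  tensor g f h := ⟨(A.tensor g.1.1 f.1.1 (congrArg (·.1.1) h),
    B.tensor g.1.2 f.1.2 (congrArg (·.1.2) h)), by simp [g.2, f.2]⟩
  tinv g f h := ⟨(A.tinv g.1.1 f.1.1 (congrArg (·.1.1) h),
    B.tinv g.1.2 f.1.2 (congrArg (·.1.2) h)), by simp [g.2, f.2, GrayFunctor.map_tinv]⟩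
  s0_c0 _ _ _ := by simp
  t0_c0 _ _ _ := by simp
  s1_l2 _ _ _ := by simp
  t1_l2 _ _ _ := by simp
  s1_r2 _ _ _ := by simp
  t1_r2 _ _ _ := by simp
  s2_l3 _ _ _ := by simp
  t2_l3 _ _ _ := by simp
  s2_r3 _ _ _ := by simp
  t2_r3 _ _ _ := by simp
  s1_c1 _ _ _ := by simp
  t1_c1 _ _ _ := by simp
  s2_h3 _ _ _ := by simp
  t2_h3 _ _ _ := by simp
  s2_c2 _ _ _ := by simp
  t2_c2 _ _ _ := by simp
  s2_tensor _ _ _ := by simp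
  t2_tensor _ _ _ := by simp
  s2_tinv _ _ _ := by simp
  t2_tinv _ _ _ := by simp

open GrayData.IsGray in
instance {A B C : GrayCat.{u}} (F : GrayFunctor A C) (K : GrayFunctor B C) :
    (pbData F K).IsGray where
  c0_assoc _ _ _ _ _ := Subtype.ext (Prod.ext (c0_assoc _ _ _ _ _) (c0_assoc _ _ _ _ _))
  i1_c0 _ _ _ := Subtype.ext (Prod.ext (i1_c0 _ _ _) (i1_c0 _ _ _))
  c0_i1 _ _ _ := Subtype.ext (Prod.ext (c0_i1 _ _ _) (c0_i1 _ _ _))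
  c1_assoc _ _ _ _ _ := Subtype.ext (Prod.ext (c1_assoc _ _ _ _ _) (c1_assoc _ _ _ _ _))
  i2_c1 _ _ _ := Subtype.ext (Prod.ext (i2_c1 _ _ _) (i2_c1 _ _ _))
  c1_i2 _ _ _ := Subtype.ext (Prod.ext (c1_i2 _ _ _) (c1_i2 _ _ _))
  c2_assoc _ _ _ _ _ := Subtype.ext (Prod.ext (c2_assoc _ _ _ _ _) (c2_assoc _ _ _ _ _))
  i3_c2 _ _ _ := Subtype.ext (Prod.ext (i3_c2 _ _ _) (i3_c2 _ _ _))
  c2_i3 _ _ _ := Subtype.ext (Prod.ext (c2_i3 _ _ _) (c2_i3 _ _ _))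
  h3_assoc _ _ _ _ _ := Subtype.ext (Prod.ext (h3_assoc _ _ _ _ _) (h3_assoc _ _ _ _ _))
  i3_h3 _ _ _ := Subtype.ext (Prod.ext (i3_h3 _ _ _) (i3_h3 _ _ _))
  h3_i3 _ _ _ := Subtype.ext (Prod.ext (h3_i3 _ _ _) (h3_i3 _ _ _))
  i3_c1 _ _ _ := Subtype.ext (Prod.ext (i3_c1 _ _ _) (i3_c1 _ _ _))
  h3_c2 _ _ _ _ hd hg h := Subtype.ext (Prod.ext
    (h3_c2 _ _ _ _ (congrArg (·.1.1) hd) (congrArg (·.1.1) hg) (congrArg (·.1.1) h))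
    (h3_c2 _ _ _ _ (congrArg (·.1.2) hd) (congrArg (·.1.2) hg) (congrArg (·.1.2) h)))
  l2_i2 _ _ h := Subtype.ext (Prod.ext
    (l2_i2 _ _ (congrArg (·.1.1) h)) (l2_i2 _ _ (congrArg (·.1.2) h)))
  l2_c1 _ _ _ hg h := Subtype.ext (Prod.ext
    (l2_c1 _ _ _ (congrArg (·.1.1) hg) (congrArg (·.1.1) h))
    (l2_c1 _ _ _ (congrArg (·.1.2) hg) (congrArg (·.1.2) h)))
  l3_i3 _ _ h := Subtype.ext (Prod.ext
    (l3_i3 _ _ (congrArg (·.1.1) h)) (l3_i3 _ _ (congrArg (·.1.2) h)))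
  l3_c2 _ _ _ hg h := Subtype.ext (Prod.ext
    (l3_c2 _ _ _ (congrArg (·.1.1) hg) (congrArg (·.1.1) h))
    (l3_c2 _ _ _ (congrArg (·.1.2) hg) (congrArg (·.1.2) h)))
  l3_h3 _ _ _ hg h := Subtype.ext (Prod.ext
    (l3_h3 _ _ _ (congrArg (·.1.1) hg) (congrArg (·.1.1) h))
    (l3_h3 _ _ _ (congrArg (·.1.2) hg) (congrArg (·.1.2) h)))
  i1_l2 _ _ _ := Subtype.ext (Prod.ext (i1_l2 _ _ _) (i1_l2 _ _ _))
  i1_l3 _ _ _ := Subtype.ext (Prod.ext (i1_l3 _ _ _) (i1_l3 _ _ _))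
  c0_l2 _ _ _ hg h := Subtype.ext (Prod.ext
    (c0_l2 _ _ _ (congrArg (·.1.1) hg) (congrArg (·.1.1) h))
    (c0_l2 _ _ _ (congrArg (·.1.2) hg) (congrArg (·.1.2) h)))
  c0_l3 _ _ _ hg h := Subtype.ext (Prod.ext
    (c0_l3 _ _ _ (congrArg (·.1.1) hg) (congrArg (·.1.1) h))
    (c0_l3 _ _ _ (congrArg (·.1.2) hg) (congrArg (·.1.2) h)))
  r2_i2 _ _ h := Subtype.ext (Prod.ext
    (r2_i2 _ _ (congrArg (·.1.1) h)) (r2_i2 _ _ (congrArg (·.1.2) h)))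
  r2_c1 _ _ _ hg h := Subtype.ext (Prod.ext
    (r2_c1 _ _ _ (congrArg (·.1.1) hg) (congrArg (·.1.1) h))
    (r2_c1 _ _ _ (congrArg (·.1.2) hg) (congrArg (·.1.2) h)))
  r3_i3 _ _ h := Subtype.ext (Prod.ext
    (r3_i3 _ _ (congrArg (·.1.1) h)) (r3_i3 _ _ (congrArg (·.1.2) h)))
  r3_c2 _ _ _ hg h := Subtype.ext (Prod.ext
    (r3_c2 _ _ _ (congrArg (·.1.1) hg) (congrArg (·.1.1) h))
    (r3_c2 _ _ _ (congrArg (·.1.2) hg) (congrArg (·.1.2) h)))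
  r3_h3 _ _ _ hg h := Subtype.ext (Prod.ext
    (r3_h3 _ _ _ (congrArg (·.1.1) hg) (congrArg (·.1.1) h))
    (r3_h3 _ _ _ (congrArg (·.1.2) hg) (congrArg (·.1.2) h)))
  r2_i1 _ _ _ := Subtype.ext (Prod.ext (r2_i1 _ _ _) (r2_i1 _ _ _))
  r3_i1 _ _ _ := Subtype.ext (Prod.ext (r3_i1 _ _ _) (r3_i1 _ _ _))
  r2_c0 _ _ _ hg h := Subtype.ext (Prod.ext
    (r2_c0 _ _ _ (congrArg (·.1.1) hg) (congrArg (·.1.1) h))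
    (r2_c0 _ _ _ (congrArg (·.1.2) hg) (congrArg (·.1.2) h)))
  r3_c0 _ _ _ hg h := Subtype.ext (Prod.ext
    (r3_c0 _ _ _ (congrArg (·.1.1) hg) (congrArg (·.1.1) h))
    (r3_c0 _ _ _ (congrArg (·.1.2) hg) (congrArg (·.1.2) h)))
  r2_l2 _ _ _ hg h := Subtype.ext (Prod.ext
    (r2_l2 _ _ _ (congrArg (·.1.1) hg) (congrArg (·.1.1) h))
    (r2_l2 _ _ _ (congrArg (·.1.2) hg) (congrArg (·.1.2) h)))
  r3_l3 _ _ _ hg h := Subtype.ext (Prod.ext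
    (r3_l3 _ _ _ (congrArg (·.1.1) hg) (congrArg (·.1.1) h))
    (r3_l3 _ _ _ (congrArg (·.1.2) hg) (congrArg (·.1.2) h)))
  tinv_tensor _ _ h := Subtype.ext (Prod.ext
    (tinv_tensor _ _ (congrArg (·.1.1) h)) (tinv_tensor _ _ (congrArg (·.1.2) h)))
  tensor_tinv _ _ h := Subtype.ext (Prod.ext
    (tensor_tinv _ _ (congrArg (·.1.1) h)) (tensor_tinv _ _ (congrArg (·.1.2) h)))
  tensor_nat _ _ h := Subtype.ext (Prod.ext
    (tensor_nat _ _ (congrArg (·.1.1) h)) (tensor_nat _ _ (congrArg (·.1.2) h)))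
  i2_tensor _ _ h := Subtype.ext (Prod.ext
    (i2_tensor _ _ (congrArg (·.1.1) h)) (i2_tensor _ _ (congrArg (·.1.2) h)))
  tensor_i2 _ _ h := Subtype.ext (Prod.ext
    (tensor_i2 _ _ (congrArg (·.1.1) h)) (tensor_i2 _ _ (congrArg (·.1.2) h)))
  c1_tensor _ _ _ hg h := Subtype.ext (Prod.ext
    (c1_tensor _ _ _ (congrArg (·.1.1) hg) (congrArg (·.1.1) h))
    (c1_tensor _ _ _ (congrArg (·.1.2) hg) (congrArg (·.1.2) h)))
  tensor_c1 _ _ _ hg h := Subtype.ext (Prod.ext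
    (tensor_c1 _ _ _ (congrArg (·.1.1) hg) (congrArg (·.1.1) h))
    (tensor_c1 _ _ _ (congrArg (·.1.2) hg) (congrArg (·.1.2) h)))
  l2_tensor _ _ _ hg h := Subtype.ext (Prod.ext
    (l2_tensor _ _ _ (congrArg (·.1.1) hg) (congrArg (·.1.1) h))
    (l2_tensor _ _ _ (congrArg (·.1.2) hg) (congrArg (·.1.2) h)))
  r2_tensor _ _ _ hg h := Subtype.ext (Prod.ext
    (r2_tensor _ _ _ (congrArg (·.1.1) hg) (congrArg (·.1.1) h))
    (r2_tensor _ _ _ (congrArg (·.1.2) hg) (congrArg (·.1.2) h)))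
  tensor_r2 _ _ _ hg h := Subtype.ext (Prod.ext
    (tensor_r2 _ _ _ (congrArg (·.1.1) hg) (congrArg (·.1.1) h))
    (tensor_r2 _ _ _ (congrArg (·.1.2) hg) (congrArg (·.1.2) h)))

/-- The pullback of two `Gray`-functors. -/
def pb {A B C : GrayCat.{u}} (F : GrayFunctor A C) (K : GrayFunctor B C) : GrayCat.{u} where
  toGrayData := pbData F K
  isGray := inferInstance

/-- The first projection from a pullback. -/
def pbFst {A B C : GrayCat.{u}} (F : GrayFunctor A C) (K : GrayFunctor B C) :
    GrayFunctor (pb F K) A where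
  map0 x := x.1.1
  map1 x := x.1.1
  map2 x := x.1.1
  map3 x := x.1.1
  s0_map _ := rfl
  t0_map _ := rfl
  s1_map _ := rfl
  t1_map _ := rfl
  s2_map _ := rfl
  t2_map _ := rfl
  map_i1 _ := rfl
  map_i2 _ := rfl
  map_i3 _ := rfl
  map_c0 _ _ _ := rfl
  map_l2 _ _ _ := rfl
  map_r2 _ _ _ := rfl
  map_l3 _ _ _ := rfl
  map_r3 _ _ _ := rfl
  map_c1 _ _ _ := rfl
  map_h3 _ _ _ := rfl
  map_c2 _ _ _ := rfl
  map_tensor _ _ _ := rfl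

/-- The second projection from a pullback. -/
def pbSnd {A B C : GrayCat.{u}} (F : GrayFunctor A C) (K : GrayFunctor B C) :
    GrayFunctor (pb F K) B where
  map0 x := x.1.2
  map1 x := x.1.2
  map2 x := x.1.2
  map3 x := x.1.2
  s0_map _ := rfl
  t0_map _ := rfl
  s1_map _ := rfl
  t1_map _ := rfl
  s2_map _ := rfl
  t2_map _ := rfl
  map_i1 _ := rfl
  map_i2 _ := rfl
  map_i3 _ := rfl
  map_c0 _ _ _ := rfl
  map_l2 _ _ _ := rfl
  map_r2 _ _ _ := rfl
  map_l3 _ _ _ := rfl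
  map_r3 _ _ _ := rfl
  map_c1 _ _ _ := rfl
  map_h3 _ _ _ := rfl
  map_c2 _ _ _ := rfl
  map_tensor _ _ _ := rfl

end GrayCat

namespace GrayData.IsGray

variable {G : GrayData.{u}} [G.IsGray]

theorem c0_assoc' (h g f : G.C1) (hg) (p) : G.c0 (G.c0 h g hg) f p =
    G.c0 h (G.c0 g f (by simpa using p)) (by simpa using hg) := c0_assoc h g f hg (by simpa using p)

theorem c1_assoc' (γ β α : G.C2) (hg) (p) : G.c1 (G.c1 γ β hg) α p =
    G.c1 γ (G.c1 β α (by simpa using p)) (by simpa using hg) := c1_assoc γ β α hg (by simpa using p)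

theorem c2_assoc' (γ β α : G.C3) (hg) (p) : G.c2 (G.c2 γ β hg) α p =
    G.c2 γ (G.c2 β α (by simpa using p)) (by simpa using hg) := c2_assoc γ β α hg (by simpa using p)

theorem h3_assoc' (γ β α : G.C3) (hg) (p) : G.h3 (G.h3 γ β hg) α p =
    G.h3 γ (G.h3 β α (by simpa using p)) (by simpa using hg) := h3_assoc γ β α hg (by simpa using p)

theorem l2_c1' (g : G.C1) (β α : G.C2) (h) (p) : G.l2 g (G.c1 β α h) p =
    G.c1 (G.l2 g β (by simpa [← G.t0_t1 α, ← h] using p)) (G.l2 g α (by simpa using p)) (by simp [h]) :=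
  l2_c1 g β α (by simpa using p) h

theorem r2_c1' (g : G.C1) (β α : G.C2) (h) (p) : G.r2 (G.c1 β α h) g p =
    G.c1 (G.r2 β g (by simpa [← G.s0_t1 α, ← h] using p)) (G.r2 α g (by simpa using p)) (by simp [h]) :=
  r2_c1 β α g h (by simpa using p)

theorem l3_c2' (g : G.C1) (β α : G.C3) (h) (p) : G.l3 g (G.c2 β α h) p =
    G.c2 (G.l3 g β (by simpa [h] using p)) (G.l3 g α (by simpa using p)) (by simp [h]) :=
  l3_c2 g β α (by simpa using p) h

theorem r3_c2' (g : G.C1) (β α : G.C3) (h) (p) : G.r3 (G.c2 β α h) g p =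
    G.c2 (G.r3 β g (by simpa [h] using p)) (G.r3 α g (by simpa using p)) (by simp [h]) :=
  r3_c2 β α g h (by simpa using p)

theorem l3_h3' (g : G.C1) (β α : G.C3) (h) (p) : G.l3 g (G.h3 β α h) p =
    G.h3 (G.l3 g β (by simpa [h] using p)) (G.l3 g α (by simpa using p)) (by simp [h]) :=
  l3_h3 g β α (by simpa using p) h

theorem r3_h3' (g : G.C1) (β α : G.C3) (h) (p) : G.r3 (G.h3 β α h) g p =
    G.h3 (G.r3 β g (by simpa [h] using p)) (G.r3 α g (by simpa using p)) (by simp [h]) :=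
  r3_h3 β α g h (by simpa using p)

theorem c0_l2' (h g : G.C1) (α : G.C2) (hh) (p) : G.l2 (G.c0 h g hh) α p =
    G.l2 h (G.l2 g α (by simpa using p)) (by simpa using hh) := c0_l2 h g α hh (by simpa using p)

theorem c0_l3' (h g : G.C1) (α : G.C3) (hh) (p) : G.l3 (G.c0 h g hh) α p =
    G.l3 h (G.l3 g α (by simpa using p)) (by simpa using hh) := c0_l3 h g α hh (by simpa using p)

theorem r2_c0' (h g : G.C1) (α : G.C2) (hh) (p) : G.r2 α (G.c0 h g hh) p =
    G.r2 (G.r2 α h (by simpa using p)) g (by simpa using hh) := r2_c0 α h g (by simpa using p) hh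

theorem r3_c0' (h g : G.C1) (α : G.C3) (hh) (p) : G.r3 α (G.c0 h g hh) p =
    G.r3 (G.r3 α h (by simpa using p)) g (by simpa using hh) := r3_c0 α h g (by simpa using p) hh

theorem r2_l2' (g : G.C1) (α : G.C2) (f) (h) (p) : G.r2 (G.l2 g α h) f p =
    G.l2 g (G.r2 α f (by simpa using p)) (by simpa using h) := r2_l2 g α f h (by simpa using p)

theorem r3_l3' (g : G.C1) (α : G.C3) (f) (h) (p) : G.r3 (G.l3 g α h) f p =
    G.l3 g (G.r3 α f (by simpa using p)) (by simpa using h) := r3_l3 g α f h (by simpa using p)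

theorem l2_tensor' (g : G.C1) (β α : G.C2) (h) (p) : G.tensor (G.l2 g β h) α p =
    G.l3 g (G.tensor β α (by simpa using p)) (by simpa using h) := l2_tensor g β α h (by simpa using p)

theorem r2_tensor' (g : G.C1) (β α : G.C2) (h) (p) : G.tensor (G.r2 β g h) α p =
    G.tensor β (G.l2 g α (by simpa using p)) (by simpa using h) := r2_tensor β g α h (by simpa using p)

theorem tensor_r2' (g : G.C1) (β α : G.C2) (h) (p) : G.tensor β (G.r2 α g h) p =
    G.r3 (G.tensor β α (by simpa using p)) g (by simpa using h) :=
  tensor_r2 β α g (by simpa using p) h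

@[simp]
theorem l2_i2' (g f : G.C1) (p) : G.l2 g (G.i2 f) p = G.i2 (G.c0 g f (by simpa using p)) :=
  l2_i2 g f (by simpa using p)

@[simp]
theorem r2_i2' (g f : G.C1) (p) : G.r2 (G.i2 g) f p = G.i2 (G.c0 g f (by simpa using p)) :=
  r2_i2 g f (by simpa using p)

@[simp]
theorem l3_i3' (g : G.C1) (α : G.C2) (p) : G.l3 g (G.i3 α) p = G.i3 (G.l2 g α (by simpa using p)) :=
  l3_i3 g α (by simpa using p)

@[simp]
theorem r3_i3' (g : G.C1) (α : G.C2) (p) : G.r3 (G.i3 α) g p = G.i3 (G.r2 α g (by simpa using p)) :=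
  r3_i3 α g (by simpa using p)

@[simp]
theorem i2_tensor' (g : G.C1) (α : G.C2) (p) : G.tensor (G.i2 g) α p =
    G.i3 (G.l2 g α (by simpa using p)) := i2_tensor g α (by simpa using p)

@[simp]
theorem tensor_i2' (g : G.C1) (α : G.C2) (p) : G.tensor α (G.i2 g) p =
    G.i3 (G.r2 α g (by simpa using p)) := tensor_i2 α g (by simpa using p)

theorem i3_h3_c2 (β : G.C2) (Δ Γ : G.C3) (h) (p) : G.h3 (G.i3 β) (G.c2 Δ Γ h) p =
    G.c2 (G.h3 (G.i3 β) Δ (by simpa [h] using p)) (G.h3 (G.i3 β) Γ (by simpa using p))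
      (by simp [h]) := by
  rw [← h3_c2 (G.i3 β) (G.i3 β) Δ Γ (by simp) h (by simpa using p)]; simp

theorem h3_i3_c2 (β : G.C2) (Δ Γ : G.C3) (h) (p) : G.h3 (G.c2 Δ Γ h) (G.i3 β) p =
    G.c2 (G.h3 Δ (G.i3 β) (by simpa [h] using p)) (G.h3 Γ (G.i3 β) (by simpa using p))
      (by simp [h]) := by
  rw [← h3_c2 Δ Γ (G.i3 β) (G.i3 β) h (by simp) (by simpa using p)]; simp

/-- The interchange law, `Δ` first. -/
theorem h3_eq (Δ Γ : G.C3) (h) : G.h3 Δ Γ h =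
    G.c2 (G.h3 (G.i3 (G.t2 Δ)) Γ (by simp [h])) (G.h3 Δ (G.i3 (G.s2 Γ)) (by simp [h])) (by simp) := by
  rw [← h3_c2 _ _ _ _ (by simp) (by simp) (by simp [h])]; simp

/-- The interchange law, `Γ` first. -/
theorem h3_eq' (Δ Γ : G.C3) (h) : G.h3 Δ Γ h =
    G.c2 (G.h3 Δ (G.i3 (G.t2 Γ)) (by simp [h])) (G.h3 (G.i3 (G.s2 Δ)) Γ (by simp [h])) (by simp) := by
  rw [← h3_c2 _ _ _ _ (by simp) (by simp) (by simp [h])]; simp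

end GrayData.IsGray

namespace GrayData.IsGray

variable {G : GrayData.{u}} [G.IsGray]

theorem c2_congr {A B C D : G.C3} (h : A = C) (h' : B = D) (p) :
    G.c2 A B p = G.c2 C D (by rw [← h, ← h', p]) := by subst h; subst h'; rfl

theorem h3_congr {A B C D : G.C3} (h : A = C) (h' : B = D) (p) :
    G.h3 A B p = G.h3 C D (by rw [← h, ← h', p]) := by subst h; subst h'; rfl

theorem l3_congr {A C : G.C3} (h : A = C) (g) (p) :
    G.l3 g A p = G.l3 g C (by rw [← h, p]) := by subst h; rfl

theorem r3_congr {A C : G.C3} (h : A = C) (g) (p) :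
    G.r3 A g p = G.r3 C g (by rw [← h, p]) := by subst h; rfl

theorem c2_re {A B C D : G.C3} {p q} (h : G.c2 A B p = G.c2 C D q) (X : G.C3) (hx : G.s2 B = G.t2 X)
    (p') : G.c2 A (G.c2 B X hx) p' = G.c2 C (G.c2 D X
      (by simpa [hx] using (congrArg G.s2 h).symm)) (by simpa using q) := by
  have h1 := c2_assoc A B X p hx
  have h2 := c2_assoc C D X q (by simpa [hx] using (congrArg G.s2 h).symm)
  rw [← h1, ← h2]
  exact c2_congr h rfl _

/-- Juxtaposition of commuting squares of 3-cells. -/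
theorem c2_h3 {A B C D A' B' C' D' : G.C3} {p q p' q'} (h : G.c2 A B p = G.c2 C D q)
    (h' : G.c2 A' B' p' = G.c2 C' D' q') (w w' w'') :
    G.c2 (G.h3 A A' w) (G.h3 B B' w') w'' =
      G.c2 (G.h3 C C' (by
          have e1 := congrArg (fun X => G.s1 (G.s2 X)) h
          have e2 := congrArg (fun X => G.t1 (G.s2 X)) h'
          simp only [s2_c2] at e1 e2
          rw [q, q', s1_t2, t1_t2, ← e1, ← e2, w']))
        (G.h3 D D' (by
          have e1 := congrArg (fun X => G.s1 (G.s2 X)) h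
          have e2 := congrArg (fun X => G.t1 (G.s2 X)) h'
          simp only [s2_c2] at e1 e2
          rw [← e1, ← e2, w'])) (by simp [q, q']) := by
  rw [← h3_c2 _ _ _ _ p p' w']
  have e1 := congrArg (fun X => G.s1 (G.s2 X)) h
  have e2 := congrArg (fun X => G.t1 (G.s2 X)) h'
  simp only [s2_c2] at e1 e2
  rw [← h3_c2 _ _ _ _ q q' (by rw [← e1, ← e2, w'])]
  exact h3_congr h h' _

theorem c2_l3 {A B C D : G.C3} {p q} (h : G.c2 A B p = G.c2 C D q) (g : G.C1) (w w' w'') :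
    G.c2 (G.l3 g A w) (G.l3 g B w') w'' =
      G.c2 (G.l3 g C (by
          have e1 := congrArg (fun X => G.t0 (G.s1 (G.s2 X))) h
          simp only [s2_c2] at e1
          rw [q, s1_t2, ← e1, w']))
        (G.l3 g D (by
          have e1 := congrArg (fun X => G.t0 (G.s1 (G.s2 X))) h
          simp only [s2_c2] at e1
          rw [← e1, w'])) (by simp [q]) := by
  have e1 := congrArg (fun X => G.t0 (G.s1 (G.s2 X))) h
  simp only [s2_c2] at e1
  rw [← l3_c2 _ _ _ w' p, ← l3_c2 _ _ _ (by rw [← e1, w']) q]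
  exact l3_congr h _ _

theorem c2_r3 {A B C D : G.C3} {p q} (h : G.c2 A B p = G.c2 C D q) (g : G.C1) (w w' w'') :
    G.c2 (G.r3 A g w) (G.r3 B g w') w'' =
      G.c2 (G.r3 C g (by
          have e1 := congrArg (fun X => G.s0 (G.s1 (G.s2 X))) h
          simp only [s2_c2] at e1
          rw [q, s1_t2, ← e1, w']))
        (G.r3 D g (by
          have e1 := congrArg (fun X => G.s0 (G.s1 (G.s2 X))) h
          simp only [s2_c2] at e1
          rw [← e1, w'])) (by simp [q]) := by
  have e1 := congrArg (fun X => G.s0 (G.s1 (G.s2 X))) h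
  simp only [s2_c2] at e1
  rw [← r3_c2 _ _ _ p w', ← r3_c2 _ _ _ q (by rw [← e1, w'])]
  exact r3_congr h _ _

theorem i3_swap (Γ : G.C3) (p q) : G.c2 (G.i3 (G.t2 Γ)) Γ p = G.c2 Γ (G.i3 (G.s2 Γ)) q := by simp

end GrayData.IsGray

/-! #### The inverse interchanger -/

namespace GrayData.IsGray

variable {G : GrayData.{u}} [G.IsGray]

theorem c2_inv_sq {T T' S S' X Y : G.C3} {p q a b} (ht : G.c2 T' T a = G.i3 (G.s2 T))
    (hs : G.c2 S S' b = G.i3 (G.s2 S')) (h : G.c2 T X p = G.c2 Y S q) (w : G.s2 T' = G.t2 Y)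
    (w' : G.s2 X = G.t2 S') : G.c2 T' Y w = G.c2 X S' w' := by
  have e1 : G.c2 T' (G.c2 T (G.c2 X S' w') (by simp [p])) (by simp [a]) = G.c2 X S' w' := by
    rw [← c2_assoc _ _ _ a (by simp [p])]
    exact (c2_congr ht rfl _).trans (i3_c2 _ _ _)
  have e2 : G.c2 Y (G.c2 S S' b) (by simp [q]) = Y := by
    exact (c2_congr rfl hs _).trans (c2_i3 _ _ _)
  rw [← e1]
  refine c2_congr rfl ?_ _
  rw [← c2_assoc _ _ _ p w']
  refine Eq.trans e2.symm ?_
  rw [← c2_assoc _ _ _ q b]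
  exact (c2_congr h rfl _).symm

theorem inv_unique {T T' S : G.C3} {a b} (ht : G.c2 T' T a = G.i3 (G.s2 T))
    (hs : G.c2 T S b = G.i3 (G.t2 T)) : T' = S := by
  have h1 : G.s2 S = G.t2 T := by simpa using congrArg G.s2 hs
  have h2 := c2_inv_sq (X := S) (Y := G.i3 (G.t2 T)) (S := G.i3 (G.t2 T)) (S' := G.i3 (G.t2 T))
    (p := b) (q := by simp) (b := by simp) ht (by simp) (by simp [hs]) (by simp [a]) (by simp [h1])
  simpa using h2

theorem tinv_nat (Δ Γ : G.C3) (h) (p q r s t u v w) :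
    G.c2 (G.tinv (G.t2 Δ) (G.t2 Γ) p) (G.h3 (G.l3 (G.t1 (G.s2 Δ)) Γ q) (G.r3 Δ (G.s1 (G.s2 Γ)) h) r) s =
      G.c2 (G.h3 (G.r3 Δ (G.t1 (G.s2 Γ)) t) (G.l3 (G.s1 (G.s2 Δ)) Γ h) u)
        (G.tinv (G.s2 Δ) (G.s2 Γ) v) w :=
  c2_inv_sq (tinv_tensor _ _ _) ((tensor_tinv _ _ _).trans (by simp)) (tensor_nat Δ Γ h) _ _

@[simp]
theorem i2_tinv (g : G.C1) (α : G.C2) (h) : G.tinv (G.i2 g) α h = G.i3 (G.l2 g α (by simpa using h)) :=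
  inv_unique (T := G.tensor (G.i2 g) α h) (b := by simp) (tinv_tensor _ _ _)
    (by simp [i2_tensor g α (by simpa using h)])

@[simp]
theorem tinv_i2 (g : G.C1) (α : G.C2) (h) : G.tinv α (G.i2 g) h = G.i3 (G.r2 α g (by simpa using h)) :=
  inv_unique (T := G.tensor α (G.i2 g) h) (b := by simp) (tinv_tensor _ _ _)
    (by simp [tensor_i2 α g (by simpa using h)])

theorem l2_tinv (g : G.C1) (β α : G.C2) (h) (p) : G.tinv (G.l2 g β h) α p =
    G.l3 g (G.tinv β α (by simpa using p)) (by simpa using h) :=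
  inv_unique (T := G.tensor (G.l2 g β h) α p) (b := by simp [r2_l2', c0_l2', l2_c1']) (tinv_tensor _ _ _) (by
    simp only [l2_tensor']
    rw [← l3_c2 _ _ _ (by simpa using h) (by simp)]
    exact (l3_congr (tensor_tinv _ _ _) _ _).trans (by simp))

theorem r2_tinv (g : G.C1) (β α : G.C2) (h) (p) : G.tinv (G.r2 β g h) α p =
    G.tinv β (G.l2 g α (by simpa using p)) (by simpa using h) :=
  inv_unique (T := G.tensor (G.r2 β g h) α p) (b := by simp [c0_l2', r2_c0']) (tinv_tensor _ _ _) (by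
    simp only [r2_tensor']
    exact (tensor_tinv _ _ _).trans (by simp))

theorem tinv_r2 (g : G.C1) (β α : G.C2) (h) (p) : G.tinv β (G.r2 α g h) p =
    G.r3 (G.tinv β α (by simpa using p)) g (by simpa using h) :=
  inv_unique (T := G.tensor β (G.r2 α g h) p) (b := by simp [r2_l2', r2_c0', r2_c1']) (tinv_tensor _ _ _) (by
    simp only [tensor_r2']
    rw [← r3_c2 _ _ _ (by simp) (by simpa using h)]
    exact (r3_congr (tensor_tinv _ _ _) _ _).trans (by simp))

end GrayData.IsGray

namespace GrayData.IsGray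

variable {G : GrayData.{u}} [G.IsGray]

theorem i3_h3_inv {A B : G.C3} {p} (h : G.c2 A B p = G.i3 (G.t2 A)) (β : G.C2) (w w' w'') :
    G.c2 (G.h3 (G.i3 β) A w) (G.h3 (G.i3 β) B w') w'' = G.i3 (G.t2 (G.h3 (G.i3 β) A w)) := by
  have e := i3_h3_c2 β A B p (by simpa [p] using w)
  rw [← e]
  refine (h3_congr rfl h _).trans ?_
  simp [i3_c1]

theorem h3_i3_inv {A B : G.C3} {p} (h : G.c2 A B p = G.i3 (G.t2 A)) (β : G.C2) (w w' w'') :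
    G.c2 (G.h3 A (G.i3 β) w) (G.h3 B (G.i3 β) w') w'' = G.i3 (G.t2 (G.h3 A (G.i3 β) w)) := by
  have e := h3_i3_c2 β A B p (by simpa [p] using w)
  rw [← e]
  refine (h3_congr h rfl _).trans ?_
  simp [i3_c1]

theorem c2_inv {A B A' B' : G.C3} {a b p q} (ha : G.c2 A A' a = G.i3 (G.t2 A))
    (hb : G.c2 B B' b = G.i3 (G.t2 B)) (w) :
    G.c2 (G.c2 A B p) (G.c2 B' A' q) w = G.i3 (G.t2 (G.c2 A B p)) := by
  have h1 : G.s2 B' = G.t2 A' := q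
  rw [c2_assoc A B _ p (by simpa using w)]
  have h2 : G.c2 B (G.c2 B' A' q) (by simpa using w) = A' := by
    rw [← c2_assoc _ _ _ b q]
    exact (c2_congr hb rfl _).trans (i3_c2 _ _ _)
  exact (c2_congr rfl h2 _).trans (by simp [ha])

theorem tinv_c1 (β α' α : G.C2) (ha) (h) : G.tinv β (G.c1 α' α ha) h =
    G.c2 (G.h3 (G.tinv β α' (by simpa [← G.t0_t1 α, ← ha] using h))
        (G.i3 (G.l2 (G.s1 β) α (by simpa using h))) (by simp [ha]))
      (G.h3 (G.i3 (G.l2 (G.t1 β) α' (by simpa [← G.t0_t1 α, ← ha] using h)))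
        (G.tinv β α (by simpa using h)) (by simp [ha])) (by simp [ha, c1_assoc']) := by
  refine inv_unique (T := G.tensor β (G.c1 α' α ha) h) (b := ?_) (tinv_tensor _ _ _) ?_
  · simp [l2_c1', c1_assoc']
  · have e := tensor_c1 β α' α ha (by simpa using h)
    rw [c2_congr e rfl]
    · refine (c2_inv (a := ?_) (b := ?_) ?_ ?_ _).trans ?_
      · simp
      · simp
      · exact i3_h3_inv (p := by simp) ((tensor_tinv _ _ _)) _ _ _ _
      · exact h3_i3_inv (p := by simp) ((tensor_tinv _ _ _)) _ _ _ _
      · rw [e]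

theorem c1_tinv (β' β α : G.C2) (hb) (h) : G.tinv (G.c1 β' β hb) α h =
    G.c2 (G.h3 (G.i3 (G.r2 β' (G.t1 α) (by simpa [← G.s0_t1 β, ← hb] using h)))
          (G.tinv β α (by simpa using h)) (by simp [hb]))
      (G.h3 (G.tinv β' α (by simpa [← G.s0_t1 β, ← hb] using h))
        (G.i3 (G.r2 β (G.s1 α) (by simpa using h))) (by simp [hb])) (by simp [hb, c1_assoc']) := by
  refine inv_unique (T := G.tensor (G.c1 β' β hb) α h) (b := ?_) (tinv_tensor _ _ _) ?_
  · simp [r2_c1', c1_assoc']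
  · have e := c1_tensor β' β α hb (by simpa using h)
    rw [c2_congr e rfl]
    · refine (c2_inv (a := ?_) (b := ?_) ?_ ?_ _).trans ?_
      · simp
      · simp
      · exact h3_i3_inv (p := by simp) ((tensor_tinv _ _ _)) _ _ _ _
      · exact i3_h3_inv (p := by simp) ((tensor_tinv _ _ _)) _ _ _ _
      · rw [e]

theorem tensor_c1' (β α' α : G.C2) (ha) (h) : G.tensor β (G.c1 α' α ha) h =
    G.c2 (G.h3 (G.i3 (G.l2 (G.t1 β) α' (by simpa [← G.t0_t1 α, ← ha] using h)))
        (G.tensor β α (by simpa using h)) (by simp [ha]))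
      (G.h3 (G.tensor β α' (by simpa [← G.t0_t1 α, ← ha] using h))
        (G.i3 (G.l2 (G.s1 β) α (by simpa using h))) (by simp [ha])) (by simp [ha, c1_assoc']) :=
  tensor_c1 β α' α ha (by simpa using h)

theorem c1_tensor' (β' β α : G.C2) (hb) (h) : G.tensor (G.c1 β' β hb) α h =
    G.c2 (G.h3 (G.tensor β' α (by simpa [← G.s0_t1 β, ← hb] using h))
        (G.i3 (G.r2 β (G.s1 α) (by simpa using h))) (by simp [hb]))
      (G.h3 (G.i3 (G.r2 β' (G.t1 α) (by simpa [← G.s0_t1 β, ← hb] using h)))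
          (G.tensor β α (by simpa using h)) (by simp [hb])) (by simp [hb, c1_assoc']) :=
  c1_tensor β' β α hb (by simpa using h)

end GrayData.IsGray

namespace GrayData.IsGray

variable {G : GrayData.{u}} [G.IsGray]

theorem swap (Δ Γ : G.C3) (h : G.s1 (G.s2 Δ) = G.t1 (G.s2 Γ)) (p q r s t u) :
    G.c2 (G.h3 (G.i3 (G.t2 Δ)) Γ p) (G.h3 Δ (G.i3 (G.s2 Γ)) q) r =
      G.c2 (G.h3 Δ (G.i3 (G.t2 Γ)) s) (G.h3 (G.i3 (G.s2 Δ)) Γ t) u :=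
  (h3_eq Δ Γ h).symm.trans (h3_eq' Δ Γ h)

theorem h3_i3_i3 (β α : G.C2) (p) : G.h3 (G.i3 β) (G.i3 α) p = G.i3 (G.c1 β α (by simpa using p)) :=
  (i3_c1 β α _).symm

theorem c2_re3 {A B C D E F : G.C3} {p q p' q'} (h : G.c2 A (G.c2 B C p) q = G.c2 D (G.c2 E F p') q')
    (X : G.C3) (hx : G.s2 C = G.t2 X) (a b) :
    G.c2 A (G.c2 B (G.c2 C X hx) a) b = G.c2 D (G.c2 E (G.c2 F X
      (by simpa [hx] using (congrArg G.s2 h).symm)) (by simpa using p')) (by simpa using q') := by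
  have h1 : G.s2 F = G.t2 X := by simpa [hx] using (congrArg G.s2 h).symm
  have := c2_re h X (by simpa using hx) (by simpa using b)
  simpa only [c2_assoc'] using this

end GrayData.IsGray

/-! ### The path space -/

/-- A 1-cell of the path space, from `top` to `bot`: a square `sq : r #₀ top ⟶ bot #₀ l`. -/
@[ext]
structure Path1 (H : GrayCat.{u}) where
  top : H.C1
  bot : H.C1
  l : H.C1
  r : H.C1
  sq : H.C2
  s0_l : H.s0 l = H.s0 top
  t0_l : H.t0 l = H.s0 bot
  s0_r : H.s0 r = H.t0 top
  t0_r : H.t0 r = H.t0 bot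
  s1_sq : H.s1 sq = H.c0 r top s0_r
  t1_sq : H.t1 sq = H.c0 bot l t0_l.symm

/-- A 2-cell of the path space between two parallel squares: 2-cells `a0 : src.l ⟶ tgt.l` and
`a1 : src.r ⟶ tgt.r` together with a 3-cell
`a3 : (bot #₀ a0) #₁ src.sq ⟶ tgt.sq #₁ (a1 #₀ top)`. -/
@[ext]
structure Path2 (H : GrayCat.{u}) where
  src : Path1 H
  tgt : Path1 H
  a0 : H.C2
  a1 : H.C2
  a3 : H.C3
  top_tgt : tgt.top = src.top
  bot_tgt : tgt.bot = src.bot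
  s1_a0 : H.s1 a0 = src.l
  t1_a0 : H.t1 a0 = tgt.l
  s1_a1 : H.s1 a1 = src.r
  t1_a1 : H.t1 a1 = tgt.r
  s2_a3 : H.s2 a3 = H.c1 (H.l2 src.bot a0 (by rw [s1_a0, src.t0_l])) src.sq
    (by simp only [H.s1_l2, s1_a0, src.t1_sq])
  t2_a3 : H.t2 a3 = H.c1 tgt.sq (H.r2 a1 src.top (by rw [s1_a1, src.s0_r]))
    (by simp only [H.t1_r2, t1_a1, tgt.s1_sq, top_tgt])

/-- A 3-cell of the path space between two parallel 2-cells: 3-cells `G0 : src.a0 ⟶ tgt.a0` and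
`G1 : src.a1 ⟶ tgt.a1` which are compatible with `src.a3` and `tgt.a3`. -/
@[ext]
structure Path3 (H : GrayCat.{u}) where
  src : Path2 H
  tgt : Path2 H
  G0 : H.C3
  G1 : H.C3
  src_tgt : tgt.src = src.src
  tgt_tgt : tgt.tgt = src.tgt
  s2_G0 : H.s2 G0 = src.a0
  t2_G0 : H.t2 G0 = tgt.a0
  s2_G1 : H.s2 G1 = src.a1
  t2_G1 : H.t2 G1 = tgt.a1
  cond : H.c2 tgt.a3
      (H.h3 (H.l3 src.src.bot G0 (by rw [s2_G0, src.s1_a0, src.src.t0_l])) (H.i3 src.src.sq)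
        (by simp only [H.s2_l3, H.s1_l2, s2_G0, src.s1_a0, H.s2_i3, src.src.t1_sq]))
      (by simp only [tgt.s2_a3, H.t2_h3, H.t2_l3, t2_G0, H.t2_i3, src_tgt]) =
    H.c2 (H.h3 (H.i3 src.tgt.sq) (H.r3 G1 src.src.top (by rw [s2_G1, src.s1_a1, src.src.s0_r]))
        (by simp only [H.s2_r3, H.t1_r2, s2_G1, src.t1_a1, H.s2_i3, src.tgt.s1_sq, src.top_tgt]))
      src.a3 (by simp only [src.t2_a3, H.s2_h3, H.s2_r3, s2_G1, H.s2_i3])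

attribute [simp] Path1.s0_l Path1.t0_l Path1.s0_r Path1.t0_r Path1.s1_sq Path1.t1_sq
  Path2.top_tgt Path2.bot_tgt Path2.s1_a0 Path2.t1_a0 Path2.s1_a1 Path2.t1_a1 Path2.s2_a3
  Path2.t2_a3 Path3.src_tgt Path3.tgt_tgt Path3.s2_G0 Path3.t2_G0 Path3.s2_G1 Path3.t2_G1

namespace GrayCat

open GrayData GrayData.IsGray

variable {H : GrayCat.{u}}

/-- Vertical pasting of squares. -/
@[simps]
def pathC0 (h g : Path1 H) (p : h.top = g.bot) : Path1 H where
  top := g.top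
  bot := h.bot
  l := H.c0 h.l g.l (by simp [p])
  r := H.c0 h.r g.r (by simp [p])
  sq := H.c1 (H.r2 h.sq g.l (by simp [p])) (H.l2 h.r g.sq (by simp [p])) (by simp [p, c0_assoc'])
  s0_l := by simp
  t0_l := by simp
  s0_r := by simp
  t0_r := by simp
  s1_sq := by simp [c0_assoc']
  t1_sq := by simp [c0_assoc']

/-- Identity squares. -/
@[simps]
def pathI1 (f : H.C1) : Path1 H where
  top := f
  bot := f
  l := H.i1 (H.s0 f)
  r := H.i1 (H.t0 f)
  sq := H.i2 f
  s0_l := by simp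
  t0_l := by simp
  s0_r := by simp
  t0_r := by simp
  s1_sq := by simp
  t1_sq := by simp

/-- The identity 2-cell of a square. -/
@[simps]
def pathI2 (g : Path1 H) : Path2 H where
  src := g
  tgt := g
  a0 := H.i2 g.l
  a1 := H.i2 g.r
  a3 := H.i3 g.sq
  top_tgt := rfl
  bot_tgt := rfl
  s1_a0 := by simp
  t1_a0 := by simp
  s1_a1 := by simp
  t1_a1 := by simp
  s2_a3 := by simp
  t2_a3 := by simp

/-- Composition of 2-cells of the path space. -/
@[simps]
def pathC1 (β α : Path2 H) (p : β.src = α.tgt) : Path2 H where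
  src := α.src
  tgt := β.tgt
  a0 := H.c1 β.a0 α.a0 (by simp [p])
  a1 := H.c1 β.a1 α.a1 (by simp [p])
  a3 := H.c2
    (H.h3 β.a3 (H.i3 (H.r2 α.a1 α.src.top (by simp))) (by simp [p]))
    (H.h3 (H.i3 (H.l2 α.src.bot β.a0 (by simp [p]))) α.a3 (by simp [p]))
    (by simp [p, c1_assoc'])
  top_tgt := by simp [p]
  bot_tgt := by simp [p]
  s1_a0 := by simp
  t1_a0 := by simp
  s1_a1 := by simp
  t1_a1 := by simp
  s2_a3 := by simp [l2_c1', c1_assoc']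
  t2_a3 := by simp [p, r2_c1', c1_assoc']

/-- The left whisker of a 2-cell by a square. -/
@[simps]
def pathL2 (k : Path1 H) (α : Path2 H) (p : k.top = α.src.bot) : Path2 H where
  src := pathC0 k α.src p
  tgt := pathC0 k α.tgt (by simp [p])
  a0 := H.l2 k.l α.a0 (by simp [p])
  a1 := H.l2 k.r α.a1 (by simp [p])
  a3 := H.c2
    (H.h3 (H.i3 (H.r2 k.sq α.tgt.l (by simp [p]))) (H.l3 k.r α.a3 (by simp [p]))
      (by simp [p, c0_assoc']))
    (H.h3 (H.tinv k.sq α.a0 (by simp [p])) (H.i3 (H.l2 k.r α.src.sq (by simp [p])))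
      (by simp [p, c0_assoc']))
    (by simp [p, c0_l2', l2_c1', c1_assoc'])
  top_tgt := by simp
  bot_tgt := by simp
  s1_a0 := by simp
  t1_a0 := by simp
  s1_a1 := by simp
  t1_a1 := by simp
  s2_a3 := by simp [p, c0_l2', l2_c1', c1_assoc']
  t2_a3 := by simp [p, c0_l2', r2_l2', l2_c1', c1_assoc']

/-- The right whisker of a 2-cell by a square. -/
@[simps]
def pathR2 (β : Path2 H) (n : Path1 H) (p : β.src.top = n.bot) : Path2 H where
  src := pathC0 β.src n p
  tgt := pathC0 β.tgt n (by simp [p])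
  a0 := H.r2 β.a0 n.l (by simp [p])
  a1 := H.r2 β.a1 n.r (by simp [p])
  a3 := H.c2
    (H.h3 (H.i3 (H.r2 β.tgt.sq n.l (by simp [p]))) (H.tensor β.a1 n.sq (by simp [p]))
      (by simp [p, c0_assoc', r2_c0']))
    (H.h3 (H.r3 β.a3 n.l (by simp [p])) (H.i3 (H.l2 β.src.r n.sq (by simp [p])))
      (by simp [p, c0_assoc']))
    (by simp [p, r2_c0', r2_c1', c1_assoc'])
  top_tgt := by simp
  bot_tgt := by simp
  s1_a0 := by simp
  t1_a0 := by simp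
  s1_a1 := by simp
  t1_a1 := by simp
  s2_a3 := by simp [r2_l2', r2_c1', c1_assoc']
  t2_a3 := by simp [p, r2_c0', c1_assoc']

end GrayCat

namespace GrayCat

open GrayData GrayData.IsGray

variable {H : GrayCat.{u}}

/-- The identity 3-cell of a 2-cell of the path space. -/
@[simps]
def pathI3 (α : Path2 H) : Path3 H where
  src := α
  tgt := α
  G0 := H.i3 α.a0
  G1 := H.i3 α.a1
  src_tgt := rfl
  tgt_tgt := rfl
  s2_G0 := by simp
  t2_G0 := by simp
  s2_G1 := by simp
  t2_G1 := by simp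
  cond := by simp [← i3_c1]

/-- Composition along a 2-cell of 3-cells of the path space. -/
@[simps]
def pathC2 (Δ Γ : Path3 H) (p : Δ.src = Γ.tgt) : Path3 H where
  src := Γ.src
  tgt := Δ.tgt
  G0 := H.c2 Δ.G0 Γ.G0 (by simp [p])
  G1 := H.c2 Δ.G1 Γ.G1 (by simp [p])
  src_tgt := by simp [p]
  tgt_tgt := by simp [p]
  s2_G0 := by simp
  t2_G0 := by simp
  s2_G1 := by simp
  t2_G1 := by simp
  cond := by
    have h1 := Γ.cond
    have h2 := Δ.cond
    simp only [p, Path3.src_tgt, Path3.tgt_tgt] at h2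
    simp only [l3_c2', r3_c2', h3_i3_c2, i3_h3_c2, c2_assoc']
    exact (c2_re h2 _ _ _).trans (c2_congr rfl h1 _)

/-- Composition along a square of 3-cells of the path space. -/
@[simps]
def pathH3 (Δ Γ : Path3 H) (p : Δ.src.src = Γ.src.tgt) : Path3 H where
  src := pathC1 Δ.src Γ.src p
  tgt := pathC1 Δ.tgt Γ.tgt (by simp [p])
  G0 := H.h3 Δ.G0 Γ.G0 (by simp [p])
  G1 := H.h3 Δ.G1 Γ.G1 (by simp [p])
  src_tgt := by simp
  tgt_tgt := by simp
  s2_G0 := by simp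
  t2_G0 := by simp
  s2_G1 := by simp
  t2_G1 := by simp
  cond := by
    have h1 := Γ.cond
    have h2 := Δ.cond
    simp only [p] at h2
    simp [p, l3_h3', r3_h3', h3_assoc', c2_assoc']
    have e1 := c2_h3 (i3_swap (H.l3 Γ.src.src.bot Δ.G0 (by simp [p])) (by simp) (by simp)) h1
      (by simp [p]) (by simp [p]) (by simp [p])
    have e2 := c2_h3 h2 (i3_swap (H.r3 Γ.G1 Γ.src.src.top (by simp)) (by simp) (by simp))
      (by simp [p]) (by simp [p]) (by simp [p])
    simp [h3_assoc'] at e1 e2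
    exact (c2_congr rfl e1 _).trans (c2_re e2 _ _ _)

end GrayCat

namespace GrayCat

open GrayData GrayData.IsGray

variable {H : GrayCat.{u}}

/-- The left whisker of a 3-cell by a square. -/
@[simps]
def pathL3 (k : Path1 H) (Γ : Path3 H) (p : k.top = Γ.src.src.bot) : Path3 H where
  src := pathL2 k Γ.src p
  tgt := pathL2 k Γ.tgt (by simp [p])
  G0 := H.l3 k.l Γ.G0 (by simp [p])
  G1 := H.l3 k.r Γ.G1 (by simp [p])
  src_tgt := by simp
  tgt_tgt := by simp
  s2_G0 := by simp
  t2_G0 := by simp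
  s2_G1 := by simp
  t2_G1 := by simp
  cond := by
    have e1 := c2_h3
      (tinv_nat (H.i3 k.sq) Γ.G0 (by simp [p]) (by simp [p]) (by simp [p]) (by simp [p])
        (by simp [p]) (by simp [p]) (by simp [p]) (by simp [p]) (by simp [p]))
      (rfl : H.c2 (H.i3 (H.l2 k.r Γ.src.src.sq (by simp [p]))) (H.i3 (H.l2 k.r Γ.src.src.sq
        (by simp [p]))) (by simp) = _)
      (by simp [p, c0_assoc']) (by simp [p, c0_assoc']) (by simp [p, c0_assoc'])
    have e2 := c2_h3
      (rfl : H.c2 (H.i3 (H.r2 k.sq Γ.src.tgt.l (by simp [p]))) (H.i3 (H.r2 k.sq Γ.src.tgt.l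
        (by simp [p]))) (by simp) = _)
      (c2_l3 Γ.cond k.r (by simp [p]) (by simp [p]) (by simp [p]))
      (by simp [p, c0_assoc']) (by simp [p, c0_assoc']) (by simp [p, c0_assoc'])
    simp [p, h3_assoc', c0_l3', c0_l2', l3_h3', r3_l3'] at e1 e2
    simp [p, h3_assoc', c2_assoc', i3_c1, c0_l3', l3_h3', r3_l3']
    exact (c2_congr rfl e1 _).trans (c2_re e2 _ _ _)

/-- The right whisker of a 3-cell by a square. -/
@[simps]
def pathR3 (Γ : Path3 H) (n : Path1 H) (p : Γ.src.src.top = n.bot) : Path3 H where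
  src := pathR2 Γ.src n p
  tgt := pathR2 Γ.tgt n (by simp [p])
  G0 := H.r3 Γ.G0 n.l (by simp [p])
  G1 := H.r3 Γ.G1 n.r (by simp [p])
  src_tgt := by simp
  tgt_tgt := by simp
  s2_G0 := by simp
  t2_G0 := by simp
  s2_G1 := by simp
  t2_G1 := by simp
  cond := by
    have e1 := c2_h3
      (c2_r3 Γ.cond n.l (by simp [p]) (by simp [p]) (by simp [p]))
      (rfl : H.c2 (H.i3 (H.l2 Γ.src.src.r n.sq (by simp [p]))) (H.i3 (H.l2 Γ.src.src.r n.sq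
        (by simp [p]))) (by simp) = _)
      (by simp [p, c0_assoc']) (by simp [p, c0_assoc']) (by simp [p, c0_assoc'])
    have e2 := c2_h3
      (rfl : H.c2 (H.i3 (H.r2 Γ.src.tgt.sq n.l (by simp [p]))) (H.i3 (H.r2 Γ.src.tgt.sq n.l
        (by simp [p]))) (by simp) = _)
      (tensor_nat Γ.G1 (H.i3 n.sq) (by simp [p]))
      (by simp [p, c0_assoc']) (by simp [p, c0_assoc']) (by simp [p, c0_assoc'])
    simp [p, h3_assoc', r3_c0', r2_c0', r3_h3', r3_l3'] at e1 e2
    simp [p, h3_assoc', c2_assoc', i3_c1, r3_c0', r3_h3', r3_l3']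
    exact (c2_congr rfl e1 _).trans (c2_re e2 _ _ _)

end GrayCat

namespace GrayCat

open GrayData GrayData.IsGray

variable {H : GrayCat.{u}}

theorem pathTensor_aux (β α : Path2 H) (p : β.src.top = α.src.bot) :
    H.c2 (H.h3 (H.tinv β.tgt.sq α.a0 (by simp [p]))
        (H.i3 (H.r2 (H.r2 β.a1 α.src.bot (by simp [p])) α.src.l (by simp))) (by simp [p, c0_assoc']))
      (H.c2 (H.h3 (H.i3 (H.l2 β.src.bot (H.l2 β.tgt.l α.a0 (by simp [p])) (by simp)))
          (H.r3 β.a3 α.src.l (by simp [p])) (by simp [p, c0_assoc']))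
        (H.h3 (H.l3 β.src.bot (H.tensor β.a0 α.a0 (by simp [p])) (by simp))
          (H.i3 (H.r2 β.src.sq α.src.l (by simp [p]))) (by simp [p, c0_assoc']))
        (by simp [p, r2_c1', r2_l2', c1_assoc', l2_c1'])) (by simp [p, r2_c1', c1_assoc', c0_l2']) =
    H.c2 (H.h3 (H.i3 (H.r2 β.tgt.sq α.tgt.l (by simp [p])))
        (H.tensor β.a1 (H.l2 α.src.bot α.a0 (by simp)) (by simp [p])) (by simp [p, c0_assoc']))
      (H.c2 (H.h3 (H.r3 β.a3 α.tgt.l (by simp [p]))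
          (H.i3 (H.l2 β.src.r (H.l2 α.src.bot α.a0 (by simp)) (by simp [p]))) (by simp [p, c0_assoc']))
        (H.h3 (H.i3 (H.l2 β.src.bot (H.r2 β.a0 α.tgt.l (by simp [p])) (by simp)))
          (H.tinv β.src.sq α.a0 (by simp [p])) (by simp [p, c0_assoc']))
        (by simp [p, r2_c1', r2_l2', c1_assoc', c0_l2']))
      (by simp [p, r2_c1', c1_assoc', r2_c0']) := by
  have eA := tensor_nat β.a3 (H.i3 α.a0) (by simp [p])
  simp only [Path2.t2_a3, Path2.s2_a3, c1_tensor', tensor_c1', l2_tensor', r2_tensor', tensor_r2'] at eA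
  simp [p, c2_assoc', tensor_r2', r2_l2', r2_c1', l2_c1', r2_c0', c0_l2'] at eA
  have e := c2_inv_sq (T' := H.h3 (H.tinv β.tgt.sq α.a0 (by simp [p]))
        (H.i3 (H.r2 (H.r2 β.a1 α.src.bot (by simp [p])) α.src.l (by simp))) (by simp [p, c0_assoc']))
      (S' := H.h3 (H.i3 (H.l2 β.src.bot (H.r2 β.a0 α.tgt.l (by simp [p])) (by simp)))
          (H.tinv β.src.sq α.a0 (by simp [p])) (by simp [p, c0_assoc']))
      (a := by simp [p]) (b := by simp [p]) ?_ ?_ ((eA.trans (c2_assoc' _ _ _ ?_ ?_).symm)) ?_ ?_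
  · exact e.trans (c2_assoc' _ _ _ _ _)
  · refine (h3_i3_inv (p := by simp) ((tinv_tensor _ _ _).trans (by simp)) _ _ _ _).trans ?_
    simp [p, r2_c1', c1_assoc', c0_l2']
  · refine (i3_h3_inv (p := by simp) ((tensor_tinv _ _ _)) _ _ _ _).trans ?_
    simp [p, r2_c1', c1_assoc', c0_l2']
  all_goals simp [p, l2_c1', r2_c1', r2_l2', c1_assoc', c0_l2']

/-- The interchanger of two 2-cells of the path space. -/
@[simps]
def pathTensor (β α : Path2 H) (p : β.src.top = α.src.bot) : Path3 H where
  src := pathC1 (pathR2 β α.tgt (by simp [p])) (pathL2 β.src α p) (by simp)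
  tgt := pathC1 (pathL2 β.tgt α (by simp [p])) (pathR2 β α.src p) (by simp)
  G0 := H.tensor β.a0 α.a0 (by simp [p])
  G1 := H.tensor β.a1 α.a1 (by simp [p])
  src_tgt := by simp
  tgt_tgt := by simp
  s2_G0 := by simp
  t2_G0 := by simp
  s2_G1 := by simp
  t2_G1 := by simp
  cond := by
    have eA := h3_congr (pathTensor_aux β α p)
      (rfl : H.i3 (H.l2 β.src.r α.src.sq (by simp [p])) = _) (by simp [p, c0_assoc'])
    have eB := tensor_nat (H.i3 β.a1) α.a3 (by simp [p])
    simp only [Path2.t2_a3, Path2.s2_a3, tensor_c1', tensor_r2'] at eB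
    have eC := h3_congr (rfl : H.i3 (H.r2 β.tgt.sq α.tgt.l (by simp [p])) = _) eB
      (by simp [p, c0_assoc'])
    have s1 := swap (H.tinv β.tgt.sq α.a0 (by simp [p])) (H.tensor β.a1 α.src.sq (by simp [p]))
      (by simp [p, c0_assoc']) (by simp [p, c0_assoc']) (by simp [p, c0_assoc']) (by simp [p])
      (by simp [p, c0_assoc']) (by simp [p, c0_assoc']) (by simp [p])
    have s2 := swap (H.r3 β.a3 α.tgt.l (by simp [p])) (H.l3 β.src.r α.a3 (by simp [p]))
      (by simp [p, c0_assoc']) (by simp [p, c0_assoc']) (by simp [p, c0_assoc']) (by simp [p])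
      (by simp [p, c0_assoc']) (by simp [p, c0_assoc']) (by simp [p])
    simp [p, h3_assoc', c2_assoc', i3_c1, l2_c1', r2_c1', l3_h3', r3_l3', r2_l2', r2_c0', c0_l2', h3_i3_c2, i3_h3_c2] at eA eC s1 s2 ⊢
    exact (c2_congr rfl ((c2_re s1.symm _ _ _).trans (c2_congr rfl eA _)) _).trans
      ((c2_congr rfl (c2_congr rfl (c2_re s2.symm _ _ _) _) _).trans (c2_re3 eC _ _ _ _)).symm

end GrayCat

namespace GrayCat

open GrayData GrayData.IsGray

variable {H : GrayCat.{u}}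

/-- The inverse of a 3-cell with invertible components. -/
@[simps]
def pathInv (Γ : Path3 H) (G0 G1 : H.C3) (p0 : H.s2 G0 = H.t2 Γ.G0) (p1 : H.s2 Γ.G1 = H.t2 G1)
    (q0 : H.s2 Γ.G0 = H.t2 G0) (q1 : H.s2 G1 = H.t2 Γ.G1)
    (e0 : H.c2 Γ.G0 G0 q0 = H.i3 (H.t2 Γ.G0))
    (e1 : H.c2 G1 Γ.G1 q1 = H.i3 (H.s2 Γ.G1)) : Path3 H where
  src := Γ.tgt
  tgt := Γ.src
  G0 := G0
  G1 := G1
  src_tgt := by simp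
  tgt_tgt := by simp
  s2_G0 := by simp [p0]
  t2_G0 := by simp [← q0]
  s2_G1 := by simp [q1]
  t2_G1 := by simp [← p1]
  cond := by
    have e2 : H.c2 (H.r3 G1 Γ.src.src.top (by simp [q1])) (H.r3 Γ.G1 Γ.src.src.top (by simp))
        (by simp [q1]) = H.i3 (H.t2 (H.r3 G1 Γ.src.src.top (by simp [q1]))) := by
      rw [← r3_c2 _ _ _ q1 (by simp)]
      exact (r3_congr e1 _ _).trans (by simp [← p1])
    have e3 : H.c2 (H.l3 Γ.src.src.bot Γ.G0 (by simp)) (H.l3 Γ.src.src.bot G0 (by simp [p0]))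
        (by simp [← q0]) = H.i3 (H.t2 (H.l3 Γ.src.src.bot Γ.G0 (by simp))) := by
      rw [← l3_c2 _ _ _ (by simp [p0]) q0]
      exact (l3_congr e0 _ _).trans (by simp)
    have e := c2_inv_sq
      (T' := H.h3 (H.i3 Γ.src.tgt.sq) (H.r3 G1 Γ.src.src.top (by simp [q1])) (by simp [q1]))
      (S' := H.h3 (H.l3 Γ.src.src.bot G0 (by simp [p0])) (H.i3 Γ.src.src.sq) (by simp [p0]))
      (a := by simp [q1]) (b := by simp [← q0])
      ((i3_h3_inv e2 _ (by simp [q1]) (by simp) (by simp [q1])).trans (by simp [← p1]))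
      ((h3_i3_inv e3 _ (by simp) (by simp [p0]) (by simp [← q0])).trans (by simp [p0]))
      Γ.cond.symm (by simp [q1]) (by simp [← q0])
    simpa using e.symm

/-- The inverse interchanger. -/
@[simps]
def pathTinv (β α : Path2 H) (p : β.src.top = α.src.bot) : Path3 H where
  src := pathC1 (pathL2 β.tgt α (by simp [p])) (pathR2 β α.src p) (by simp)
  tgt := pathC1 (pathR2 β α.tgt (by simp [p])) (pathL2 β.src α p) (by simp)
  G0 := H.tinv β.a0 α.a0 (by simp [p])
  G1 := H.tinv β.a1 α.a1 (by simp [p])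
  src_tgt := by simp
  tgt_tgt := by simp
  s2_G0 := by simp
  t2_G0 := by simp
  s2_G1 := by simp
  t2_G1 := by simp
  cond := (pathInv (pathTensor β α p) (H.tinv β.a0 α.a0 (by simp [p]))
    (H.tinv β.a1 α.a1 (by simp [p])) (by simp) (by simp) (by simp) (by simp)
    (tensor_tinv _ _ _) (tinv_tensor _ _ _)).cond

/-- The cells and operations of the path space. -/
def pathData (H : GrayCat.{u}) : GrayData.{u} where
  C0 := H.C1
  C1 := Path1 H
  C2 := Path2 H
  C3 := Path3 H
  s0 := Path1.top
  t0 := Path1.bot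
  s1 := Path2.src
  t1 := Path2.tgt
  s2 := Path3.src
  t2 := Path3.tgt
  s0_t1 α := α.top_tgt
  t0_t1 α := α.bot_tgt
  s1_t2 Γ := Γ.src_tgt
  t1_t2 Γ := Γ.tgt_tgt
  i1 := pathI1
  i2 := pathI2
  i3 := pathI3
  s0_i1 _ := rfl
  t0_i1 _ := rfl
  s1_i2 _ := rfl
  t1_i2 _ := rfl
  s2_i3 _ := rfl
  t2_i3 _ := rfl
  c0 := pathC0
  l2 := pathL2
  r2 := pathR2
  l3 := pathL3
  r3 := pathR3
  c1 := pathC1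
  h3 := pathH3
  c2 := pathC2
  tensor := pathTensor
  tinv := pathTinv
  s0_c0 _ _ _ := rfl
  t0_c0 _ _ _ := rfl
  s1_l2 _ _ _ := rfl
  t1_l2 _ _ _ := rfl
  s1_r2 _ _ _ := rfl
  t1_r2 _ _ _ := rfl
  s2_l3 _ _ _ := rfl
  t2_l3 _ _ _ := rfl
  s2_r3 _ _ _ := rfl
  t2_r3 _ _ _ := rfl
  s1_c1 _ _ _ := rfl
  t1_c1 _ _ _ := rfl
  s2_h3 _ _ _ := rfl
  t2_h3 _ _ _ := rfl
  s2_c2 _ _ _ := rfl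
  t2_c2 _ _ _ := rfl
  s2_tensor _ _ _ := rfl
  t2_tensor _ _ _ := rfl
  s2_tinv _ _ _ := rfl
  t2_tinv _ _ _ := rfl

end GrayCat

namespace GrayCat

open GrayData GrayData.IsGray

variable {H : GrayCat.{u}}

theorem pathC0_assoc (h g f : Path1 H) (hg) (p) : pathC0 (pathC0 h g hg) f p =
    pathC0 h (pathC0 g f (by simpa using p)) (by simpa using hg) := by
  simp at p
  ext <;> simp [hg, p, c0_assoc', r2_c1', l2_c1', c1_assoc', r2_c0', c0_l2', r2_l2']

theorem pathI1_C0 (x) (f : Path1 H) (p) : pathC0 (pathI1 x) f p = f := by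
  simp at p
  subst p
  ext <;> simp

theorem pathC0_I1 (x) (f : Path1 H) (p) : pathC0 f (pathI1 x) p = f := by
  simp at p
  subst p
  ext <;> simp

theorem pathC1_assoc (γ β α : Path2 H) (hg) (p) : pathC1 (pathC1 γ β hg) α p =
    pathC1 γ (pathC1 β α (by simpa using p)) (by simpa using hg) := by
  simp at p
  ext <;> simp [hg, p, c1_assoc', r2_c1', l2_c1', h3_i3_c2, i3_h3_c2, c2_assoc', h3_assoc', i3_c1]

theorem pathI2_C1 (f) (α : Path2 H) (p) : pathC1 (pathI2 f) α p = α := by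
  simp at p
  subst p
  ext <;> simp [← i3_c1]

theorem pathC1_I2 (f) (α : Path2 H) (p) : pathC1 α (pathI2 f) p = α := by
  simp at p
  subst p
  ext <;> simp [← i3_c1]

theorem pathL2_I2 (g f : Path1 H) (p) : pathL2 g (pathI2 f) p = pathI2 (pathC0 g f (by simpa using p)) := by
  simp at p
  ext <;> simp [p, h3_i3_i3]

theorem pathR2_I2 (g f : Path1 H) (p) : pathR2 (pathI2 g) f p = pathI2 (pathC0 g f (by simpa using p)) := by
  simp at p
  ext <;> simp [p, h3_i3_i3]

theorem pathI1_L2 (x) (α : Path2 H) (p) : pathL2 (pathI1 x) α p = α := by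
  simp at p
  subst p
  ext <;> simp [pathI1_C0, ← i3_c1]

theorem pathR2_I1 (x) (α : Path2 H) (p) : pathR2 α (pathI1 x) p = α := by
  simp at p
  subst p
  ext <;> simp [pathC0_I1, ← i3_c1]

theorem pathL2_C1 (g : Path1 H) (β α : Path2 H) (h) (p) : pathL2 g (pathC1 β α h) p =
    pathC1 (pathL2 g β (by simpa [h] using p)) (pathL2 g α (by simpa using p)) (by simp [h]) := by
  simp at p
  ext
  all_goals try simp [h, p, l2_c1']
  have s1 := swap (H.tinv g.sq β.a0 (by simp [h, p])) (H.l3 g.r α.a3 (by simp [p]))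
    (by simp [h, p, c0_assoc']) (by simp [h, p, c0_assoc']) (by simp [p, h, c0_assoc']) (by simp [h, p])
    (by simp [h, p, c0_assoc']) (by simp [h, p, c0_assoc']) (by simp [h, p])
  simp [h, p, c1_assoc', r2_c1', l2_c1', h3_i3_c2, i3_h3_c2, c2_assoc', h3_assoc', i3_c1,
    tinv_c1, l3_c2', l3_h3', r2_l2', r2_c0', c0_l2'] at s1 ⊢
  exact c2_congr rfl (c2_re s1 _ _ _) _

theorem pathR2_C1 (g : Path1 H) (β α : Path2 H) (h) (p) : pathR2 (pathC1 β α h) g p =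
    pathC1 (pathR2 β g (by simpa [h] using p)) (pathR2 α g (by simpa using p)) (by simp [h]) := by
  simp at p
  ext
  all_goals try simp [h, p, r2_c1']
  have s1 := swap (H.r3 β.a3 g.l (by simp [h, p])) (H.tensor α.a1 g.sq (by simp [p]))
    (by simp [h, p, c0_assoc']) (by simp [h, p, c0_assoc']) (by simp [p, h, c0_assoc']) (by simp [h, p])
    (by simp [h, p, c0_assoc']) (by simp [h, p, c0_assoc']) (by simp [h, p])
  simp [h, p, c1_assoc', r2_c1', l2_c1', h3_i3_c2, i3_h3_c2, c2_assoc', h3_assoc', i3_c1,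
    c1_tensor', r3_c2', r3_h3', r2_l2', r2_c0', c0_l2'] at s1 ⊢
  exact c2_congr rfl (c2_re s1 _ _ _) _

theorem pathC0_L2 (h g : Path1 H) (α : Path2 H) (hh) (p) : pathL2 (pathC0 h g hh) α p =
    pathL2 h (pathL2 g α (by simpa using p)) (by simpa using hh) := by
  simp at p
  ext
  all_goals try simp [hh, p, c0_l2', c0_assoc', r2_c1', l2_c1', c1_assoc', r2_c0', r2_l2']
  simp [hh, p, c1_assoc', r2_c1', l2_c1', h3_i3_c2, i3_h3_c2, c2_assoc', h3_assoc', i3_c1,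
    c1_tinv, l2_tinv, r2_tinv, l3_c2', l3_h3', r2_l2', r2_c0', c0_l2', c0_l3']

theorem pathR2_C0 (h g : Path1 H) (α : Path2 H) (hh) (p) : pathR2 α (pathC0 h g hh) p =
    pathR2 (pathR2 α h (by simpa using p)) g (by simpa using hh) := by
  simp at p
  ext
  all_goals try simp [hh, p, c0_l2', c0_assoc', r2_c1', l2_c1', c1_assoc', r2_c0', r2_l2']
  simp [hh, p, c1_assoc', r2_c1', l2_c1', h3_i3_c2, i3_h3_c2, c2_assoc', h3_assoc', i3_c1,
    tensor_c1', r2_tensor', tensor_r2', r3_c2', r3_h3', r2_l2', r2_c0', c0_l2', r3_c0']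

theorem pathR2_L2 (g : Path1 H) (α : Path2 H) (f) (h) (p) : pathR2 (pathL2 g α h) f p =
    pathL2 g (pathR2 α f (by simpa using p)) (by simpa using h) := by
  simp at p
  ext
  all_goals try simp [h, p, c0_l2', c0_assoc', r2_c1', l2_c1', c1_assoc', r2_c0', r2_l2']
  simp [h, p, c1_assoc', r2_c1', l2_c1', h3_i3_c2, i3_h3_c2, c2_assoc', h3_assoc', i3_c1,
    l2_tensor', tinv_r2, r3_c2', r3_h3', l3_c2', l3_h3', r2_l2', r3_l3', r2_c0', c0_l2', r3_c0']

end GrayCat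

namespace GrayCat

open GrayData GrayData.IsGray

variable {H : GrayCat.{u}}

theorem pathTensor_nat (Δ Γ : Path3 H) (h) :
    pathC2 (pathTensor Δ.tgt Γ.tgt (by simp [h])) (pathH3 (pathR3 Δ Γ.src.tgt (by simp [h]))
      (pathL3 Δ.src.src Γ h) (by simp)) (by simp) =
    pathC2 (pathH3 (pathL3 Δ.src.tgt Γ (by simp [h])) (pathR3 Δ Γ.src.src h) (by simp))
      (pathTensor Δ.src Γ.src h) (by simp) := by
  refine Path3.ext ?_ ?_ ?_ ?_
  · simp
  · simp
  · simpa using tensor_nat Δ.G0 Γ.G0 (by simp [h])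
  · simpa using tensor_nat Δ.G1 Γ.G1 (by simp [h])

theorem pathH3_C2 (Δ' Δ Γ' Γ : Path3 H) (hd hg) (h : Δ.src.src = Γ.src.tgt) :
    pathH3 (pathC2 Δ' Δ hd) (pathC2 Γ' Γ hg) (by simp [h]) =
    pathC2 (pathH3 Δ' Γ' (by rw [hd, hg]; simp [h])) (pathH3 Δ Γ h) (by simp [hd, hg]) :=
  Path3.ext rfl rfl (h3_c2 _ _ _ _ (by simp [hd]) (by simp [hg]) (by simp [h]))
    (h3_c2 _ _ _ _ (by simp [hd]) (by simp [hg]) (by simp [h]))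

theorem pathTensor_tinv (β α : Path2 H) (h : β.src.top = α.src.bot) :
    pathC2 (pathTensor β α h) (pathTinv β α h) (by simp) = pathI3 (pathTensor β α h).tgt :=
  Path3.ext rfl rfl ((tensor_tinv _ _ _).trans (by simp [h]))
    ((tensor_tinv _ _ _).trans (by simp [h]))

theorem pathTinv_tensor (β α : Path2 H) (h : β.src.top = α.src.bot) :
    pathC2 (pathTinv β α h) (pathTensor β α h) (by simp) = pathI3 (pathTensor β α h).src :=
  Path3.ext rfl rfl ((tinv_tensor _ _ _).trans (by simp [h]))
    ((tinv_tensor _ _ _).trans (by simp [h]))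

theorem pathH3_assoc (Θ Δ Γ : Path3 H) (hg) (hb : Δ.src.src = Γ.src.tgt) :
    pathH3 (pathH3 Θ Δ hg) Γ (by simp [hb]) = pathH3 Θ (pathH3 Δ Γ hb) (by simp [hg]) :=
  Path3.ext (by simp [pathC1_assoc]) (by simp [pathC1_assoc]) (by simp [h3_assoc'])
    (by simp [h3_assoc'])

theorem pathI3_H3 (f : Path1 H) (Γ : Path3 H) (h) : pathH3 (pathI3 (pathI2 f)) Γ h = Γ :=
  Path3.ext (by simp [pathI2_C1]) (by simp [pathI2_C1]) (by simp) (by simp)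

theorem pathH3_I3 (Γ : Path3 H) (f : Path1 H) (h) : pathH3 Γ (pathI3 (pathI2 f)) h = Γ :=
  Path3.ext (by simp [pathC1_I2]) (by simp [pathC1_I2]) (by simp) (by simp)

theorem pathL3_H3 (g : Path1 H) (Δ Γ : Path3 H) (hg : g.top = Γ.src.src.bot) (h) :
    pathL3 g (pathH3 Δ Γ h) (by simp [hg]) =
      pathH3 (pathL3 g Δ (by simp [h, hg])) (pathL3 g Γ hg) (by simp [h]) :=
  Path3.ext (by simp [pathL2_C1]) (by simp [pathL2_C1]) (by simp [l3_h3']) (by simp [l3_h3'])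

theorem pathR3_H3 (Δ Γ : Path3 H) (f : Path1 H) (h) (hf : Γ.src.src.top = f.bot) :
    pathR3 (pathH3 Δ Γ h) f (by simp [hf]) =
      pathH3 (pathR3 Δ f (by simp [h, hf])) (pathR3 Γ f hf) (by simp [h]) :=
  Path3.ext (by simp [pathR2_C1]) (by simp [pathR2_C1]) (by simp [r3_h3']) (by simp [r3_h3'])

theorem pathC0_L3 (h g : Path1 H) (Γ : Path3 H) (hh) (hg : g.top = Γ.src.src.bot) :
    pathL3 (pathC0 h g hh) Γ (by simp [hg]) = pathL3 h (pathL3 g Γ hg) (by simp [hh]) :=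
  Path3.ext (by simp [pathC0_L2]) (by simp [pathC0_L2]) (by simp [c0_l3']) (by simp [c0_l3'])

theorem pathR3_C0 (Γ : Path3 H) (g f : Path1 H) (hg : Γ.src.src.top = g.bot) (hf) :
    pathR3 Γ (pathC0 g f hf) (by simp [hg]) = pathR3 (pathR3 Γ g hg) f (by simp [hf]) :=
  Path3.ext (by simp [pathR2_C0]) (by simp [pathR2_C0]) (by simp [r3_c0']) (by simp [r3_c0'])

theorem pathI2_tensor (g : Path1 H) (α : Path2 H) (h : g.top = α.src.bot) :
    pathTensor (pathI2 g) α (by simp [h]) = pathI3 (pathL2 g α h) := by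
  refine Path3.ext ?_ ?_ (by simp) (by simp)
  · simp [pathR2_I2, pathI2_C1]
  · simp [pathR2_I2, pathC1_I2]

theorem pathTensor_I2 (β : Path2 H) (f : Path1 H) (h : β.src.top = f.bot) :
    pathTensor β (pathI2 f) (by simp [h]) = pathI3 (pathR2 β f h) := by
  refine Path3.ext ?_ ?_ (by simp) (by simp)
  · simp [pathL2_I2, pathC1_I2]
  · simp [pathL2_I2, pathI2_C1]

theorem pathC1_tensor (β' β α : Path2 H) (hb) (h : β.src.top = α.src.bot) :
    pathTensor (pathC1 β' β hb) α (by simp [h]) =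
    pathC2 (pathH3 (pathTensor β' α (by simp [hb, h])) (pathI3 (pathR2 β α.src h)) (by simp [hb]))
      (pathH3 (pathI3 (pathR2 β' α.tgt (by simp [hb, h]))) (pathTensor β α h) (by simp [hb]))
      (by simp [hb, ← pathC1_assoc]) := by
  refine Path3.ext ?_ ?_ ?_ ?_
  · simp [pathR2_C1, pathC1_assoc]
  · simp [pathR2_C1, pathC1_assoc]
  · simp [c1_tensor']
  · simp [c1_tensor']

theorem pathTensor_C1 (β α' α : Path2 H) (ha) (h : β.src.top = α.src.bot) :
    pathTensor β (pathC1 α' α ha) (by simp [h]) =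
    pathC2 (pathH3 (pathI3 (pathL2 β.tgt α' (by simp [ha, h]))) (pathTensor β α h) (by simp [ha]))
      (pathH3 (pathTensor β α' (by simp [ha, h])) (pathI3 (pathL2 β.src α h)) (by simp [ha]))
      (by simp [ha, ← pathC1_assoc]) := by
  refine Path3.ext ?_ ?_ ?_ ?_
  · simp [pathL2_C1, pathC1_assoc]
  · simp [pathL2_C1, pathC1_assoc]
  · simp [tensor_c1']
  · simp [tensor_c1']

theorem pathL2_tensor (g : Path1 H) (β α : Path2 H) (hg : g.top = β.src.bot)
    (h : β.src.top = α.src.bot) : pathTensor (pathL2 g β hg) α (by simp [h]) =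
    pathL3 g (pathTensor β α h) (by simp [hg]) := by
  refine Path3.ext ?_ ?_ ?_ ?_
  · simp [pathL2_C1, pathR2_L2, pathC0_L2]
  · simp [pathL2_C1, pathR2_L2, pathC0_L2]
  · simp [l2_tensor']
  · simp [l2_tensor']

theorem pathR2_tensor (β : Path2 H) (g : Path1 H) (α : Path2 H) (hg : β.src.top = g.bot)
    (h : g.top = α.src.bot) : pathTensor (pathR2 β g hg) α (by simp [h]) =
    pathTensor β (pathL2 g α h) (by simp [hg]) := by
  refine Path3.ext ?_ ?_ ?_ ?_
  · simp [pathR2_C0, pathC0_L2]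
  · simp [pathR2_C0, pathC0_L2]
  · simp [r2_tensor']
  · simp [r2_tensor']

theorem pathTensor_R2 (β α : Path2 H) (f : Path1 H) (h : β.src.top = α.src.bot)
    (hf : α.src.top = f.bot) : pathTensor β (pathR2 α f hf) (by simp [h]) =
    pathR3 (pathTensor β α h) f (by simp [hf]) := by
  refine Path3.ext ?_ ?_ ?_ ?_
  · simp [pathR2_C0, pathR2_C1, pathR2_L2]
  · simp [pathR2_C0, pathR2_C1, pathR2_L2]
  · simp [tensor_r2']
  · simp [tensor_r2']

end GrayCat

namespace GrayCat

open GrayData GrayData.IsGray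

instance (H : GrayCat.{u}) : (pathData H).IsGray where
  c0_assoc h g f hg gf := pathC0_assoc h g f hg gf
  i1_c0 x f h := pathI1_C0 x f h
  c0_i1 f x h := pathC0_I1 x f h
  c1_assoc h g f hg gf := pathC1_assoc h g f hg gf
  i2_c1 f α h := pathI2_C1 f α h
  c1_i2 α f h := pathC1_I2 f α h
  l2_i2 _ _ _ := pathL2_I2 _ _ _
  l2_c1 g β α hg h := pathL2_C1 g β α h hg
  i1_l2 _ _ _ := pathI1_L2 _ _ _
  c0_l2 h g α hh hg := pathC0_L2 h g α hh hg
  r2_i2 _ _ _ := pathR2_I2 _ _ _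
  r2_c1 β α f h hf := pathR2_C1 f β α h hf
  r2_i1 _ _ _ := pathR2_I1 _ _ _
  r2_c0 α g f hg hf := pathR2_C0 g f α hf hg
  r2_l2 _ _ _ _ _ := pathR2_L2 _ _ _ _ _
  c2_assoc _ _ _ _ _ := Path3.ext rfl rfl (c2_assoc' _ _ _ _ _) (c2_assoc' _ _ _ _ _)
  i3_c2 _ _ h := Path3.ext rfl h (i3_c2 _ _ _) (i3_c2 _ _ _)
  c2_i3 _ _ h := Path3.ext h.symm rfl (c2_i3 _ _ _) (c2_i3 _ _ _)
  h3_assoc Θ Δ Γ hg hb := pathH3_assoc Θ Δ Γ hg hb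
  i3_h3 f Γ h := pathI3_H3 f Γ h
  h3_i3 Γ f h := pathH3_I3 Γ f h
  i3_c1 _ _ _ := Path3.ext rfl rfl (i3_c1 _ _ _) (i3_c1 _ _ _)
  h3_c2 Δ' Δ Γ' Γ hd hg h := pathH3_C2 Δ' Δ Γ' Γ hd hg h
  l3_i3 _ _ _ := Path3.ext rfl rfl (l3_i3' _ _ _) (l3_i3' _ _ _)
  l3_c2 _ _ _ _ _ := Path3.ext rfl rfl (l3_c2' _ _ _ _ _) (l3_c2' _ _ _ _ _)
  l3_h3 g Δ Γ hg h := pathL3_H3 g Δ Γ hg h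
  i1_l3 _ _ _ := Path3.ext (pathI1_L2 _ _ _) (pathI1_L2 _ _ _) (i1_l3 _ _ _) (i1_l3 _ _ _)
  c0_l3 h g Γ hh hg := pathC0_L3 h g Γ hh hg
  r3_i3 _ _ _ := Path3.ext rfl rfl (r3_i3' _ _ _) (r3_i3' _ _ _)
  r3_c2 _ _ _ _ _ := Path3.ext rfl rfl (r3_c2' _ _ _ _ _) (r3_c2' _ _ _ _ _)
  r3_h3 Δ Γ f h hf := pathR3_H3 Δ Γ f h hf
  r3_i1 _ _ _ := Path3.ext (pathR2_I1 _ _ _) (pathR2_I1 _ _ _) (r3_i1 _ _ _) (r3_i1 _ _ _)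
  r3_c0 Γ g f hg hf := pathR3_C0 Γ g f hg hf
  r3_l3 _ _ _ _ _ := Path3.ext (pathR2_L2 _ _ _ _ _) (pathR2_L2 _ _ _ _ _)
    (r3_l3' _ _ _ _ _) (r3_l3' _ _ _ _ _)
  tinv_tensor β α h := pathTinv_tensor β α h
  tensor_tinv β α h := pathTensor_tinv β α h
  tensor_nat Δ Γ h := pathTensor_nat Δ Γ h
  i2_tensor g α h := pathI2_tensor g α h
  tensor_i2 β f h := pathTensor_I2 β f h
  c1_tensor β' β α hb h := pathC1_tensor β' β α hb h
  tensor_c1 β α' α ha h := pathTensor_C1 β α' α ha h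
  l2_tensor g β α hg h := pathL2_tensor g β α hg h
  r2_tensor β g α hg h := pathR2_tensor β g α hg h
  tensor_r2 β α f h hf := pathTensor_R2 β α f h hf

end GrayCat

namespace GrayCat

/-- The path space of a `Gray`-category. -/
def path (H : GrayCat.{u}) : GrayCat.{u} where
  toGrayData := pathData H
  isGray := inferInstance

/-- The projection from the path space to the left side of a square. -/
def pathD0 (H : GrayCat.{u}) : GrayFunctor (path H) H where
  map0 f := H.s0 f
  map1 g := g.l
  map2 α := α.a0
  map3 Γ := Γ.G0
  s0_map g := g.s0_l
  t0_map g := g.t0_l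
  s1_map α := α.s1_a0
  t1_map α := α.t1_a0
  s2_map Γ := Γ.s2_G0
  t2_map Γ := Γ.t2_G0
  map_i1 _ := rfl
  map_i2 _ := rfl
  map_i3 _ := rfl
  map_c0 _ _ _ := rfl
  map_l2 _ _ _ := rfl
  map_r2 _ _ _ := rfl
  map_l3 _ _ _ := rfl
  map_r3 _ _ _ := rfl
  map_c1 _ _ _ := rfl
  map_h3 _ _ _ := rfl
  map_c2 _ _ _ := rfl
  map_tensor _ _ _ := rfl

/-- The projection from the path space to the right side of a square. -/
def pathD1 (H : GrayCat.{u}) : GrayFunctor (path H) H where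
  map0 f := H.t0 f
  map1 g := g.r
  map2 α := α.a1
  map3 Γ := Γ.G1
  s0_map g := g.s0_r
  t0_map g := g.t0_r
  s1_map α := α.s1_a1
  t1_map α := α.t1_a1
  s2_map Γ := Γ.s2_G1
  t2_map Γ := Γ.t2_G1
  map_i1 _ := rfl
  map_i2 _ := rfl
  map_i3 _ := rfl
  map_c0 _ _ _ := rfl
  map_l2 _ _ _ := rfl
  map_r2 _ _ _ := rfl
  map_l3 _ _ _ := rfl
  map_r3 _ _ _ := rfl
  map_c1 _ _ _ := rfl
  map_h3 _ _ _ := rfl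
  map_c2 _ _ _ := rfl
  map_tensor _ _ _ := rfl

open GrayData GrayData.IsGray

variable {H : GrayCat.{u}}

/-- The constant square on a 1-cell. -/
@[simps]
def pathUnit1 (f : H.C1) : Path1 H where
  top := H.i1 (H.s0 f)
  bot := H.i1 (H.t0 f)
  l := f
  r := f
  sq := H.i2 f
  s0_l := by simp
  t0_l := by simp
  s0_r := by simp
  t0_r := by simp
  s1_sq := by simp
  t1_sq := by simp

/-- The constant 2-cell of the path space on a 2-cell. -/
@[simps]
def pathUnit2 (α : H.C2) : Path2 H where
  src := pathUnit1 (H.s1 α)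
  tgt := pathUnit1 (H.t1 α)
  a0 := α
  a1 := α
  a3 := H.i3 α
  top_tgt := by simp
  bot_tgt := by simp
  s1_a0 := rfl
  t1_a0 := rfl
  s1_a1 := rfl
  t1_a1 := rfl
  s2_a3 := by simp
  t2_a3 := by simp

/-- The constant 3-cell of the path space on a 3-cell. -/
@[simps]
def pathUnit3 (Γ : H.C3) : Path3 H where
  src := pathUnit2 (H.s2 Γ)
  tgt := pathUnit2 (H.t2 Γ)
  G0 := Γ
  G1 := Γ
  src_tgt := by simp
  tgt_tgt := by simp
  s2_G0 := rfl
  t2_G0 := rfl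
  s2_G1 := rfl
  t2_G1 := rfl
  cond := by simp

theorem pathUnit_i1 (x : H.C0) : pathUnit1 (H.i1 x) = pathI1 (H.i1 x) := by
  ext <;> simp

theorem pathUnit_i2 (f : H.C1) : pathUnit2 (H.i2 f) = pathI2 (pathUnit1 f) := by
  ext <;> simp

theorem pathUnit_i3 (α : H.C2) : pathUnit3 (H.i3 α) = pathI3 (pathUnit2 α) := by
  ext <;> simp

theorem pathUnit_c0 (g f : H.C1) (h) :
    pathUnit1 (H.c0 g f h) = pathC0 (pathUnit1 g) (pathUnit1 f) (by simp [h]) := by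
  ext <;> simp [h]

theorem pathUnit_l2 (g : H.C1) (α : H.C2) (h) :
    pathUnit2 (H.l2 g α h) = pathL2 (pathUnit1 g) (pathUnit2 α) (by simp [h]) := by
  ext <;> simp [h]

theorem pathUnit_r2 (α : H.C2) (f : H.C1) (h) :
    pathUnit2 (H.r2 α f h) = pathR2 (pathUnit2 α) (pathUnit1 f) (by simp [h]) := by
  ext <;> simp [h]

theorem pathUnit_c1 (β α : H.C2) (h) :
    pathUnit2 (H.c1 β α h) = pathC1 (pathUnit2 β) (pathUnit2 α) (by simp [h]) := by
  ext <;> simp [h, ← i3_c1]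

theorem pathUnit_l3 (g : H.C1) (Γ : H.C3) (h) :
    pathUnit3 (H.l3 g Γ h) = pathL3 (pathUnit1 g) (pathUnit3 Γ) (by simp [h]) :=
  Path3.ext (by simp [pathUnit_l2]) (by simp [pathUnit_l2]) rfl rfl

theorem pathUnit_r3 (Γ : H.C3) (f : H.C1) (h) :
    pathUnit3 (H.r3 Γ f h) = pathR3 (pathUnit3 Γ) (pathUnit1 f) (by simp [h]) :=
  Path3.ext (by simp [pathUnit_r2]) (by simp [pathUnit_r2]) rfl rfl

theorem pathUnit_h3 (Δ Γ : H.C3) (h) :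
    pathUnit3 (H.h3 Δ Γ h) = pathH3 (pathUnit3 Δ) (pathUnit3 Γ) (by simp [h]) :=
  Path3.ext (by simp [pathUnit_c1]) (by simp [pathUnit_c1]) rfl rfl

theorem pathUnit_c2 (Δ Γ : H.C3) (h) :
    pathUnit3 (H.c2 Δ Γ h) = pathC2 (pathUnit3 Δ) (pathUnit3 Γ) (by simp [h]) :=
  Path3.ext (by simp) (by simp) rfl rfl

theorem pathUnit_tensor (β α : H.C2) (h) :
    pathUnit3 (H.tensor β α h) = pathTensor (pathUnit2 β) (pathUnit2 α) (by simp [h]) :=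
  Path3.ext (by simp [pathUnit_c1, pathUnit_l2, pathUnit_r2])
    (by simp [pathUnit_c1, pathUnit_l2, pathUnit_r2]) rfl rfl

/-- The inclusion of the constant paths. -/
def pathUnit (H : GrayCat.{u}) : GrayFunctor H (path H) where
  map0 x := H.i1 x
  map1 f := pathUnit1 f
  map2 α := pathUnit2 α
  map3 Γ := pathUnit3 Γ
  s0_map _ := rfl
  t0_map _ := rfl
  s1_map _ := rfl
  t1_map _ := rfl
  s2_map _ := rfl
  t2_map _ := rfl
  map_i1 := pathUnit_i1
  map_i2 := pathUnit_i2
  map_i3 := pathUnit_i3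
  map_c0 := pathUnit_c0
  map_l2 := pathUnit_l2
  map_r2 := pathUnit_r2
  map_l3 := pathUnit_l3
  map_r3 := pathUnit_r3
  map_c1 := pathUnit_c1
  map_h3 := pathUnit_h3
  map_c2 := pathUnit_c2
  map_tensor := pathUnit_tensor

end GrayCat

/-! ### The comonad `Q¹` -/

namespace GrayCat

/-- The list of 1-cells `[f₁, …, fₙ]` is a composable string from `s` to `t`; it stands for the
formal composite `f₁ #₀ … #₀ fₙ`. -/
def IsString (G : GrayCat.{u}) : G.C0 → List G.C1 → G.C0 → Prop
  | t, [], s => t = s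
  | t, f :: l, s => G.t0 f = t ∧ IsString G (G.s0 f) l s

/-- A 1-cell is an identity. -/
def IsUnit (G : GrayCat.{u}) (f : G.C1) : Prop := ∃ x, f = G.i1 x

/-- The morphisms of the free category on the underlying reflexive graph: composable strings of
1-cells which are not identities. -/
@[ext]
structure Str (G : GrayCat.{u}) where
  src : G.C0
  tgt : G.C0
  l : List G.C1
  isString : G.IsString tgt l src
  ne : ∀ f ∈ l, ¬ G.IsUnit f

section

variable {G H K : GrayCat.{u}}

theorem IsString.append : ∀ {l l' : List G.C1} {t s r : G.C0}, G.IsString t l s →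
    G.IsString s l' r → G.IsString t (l ++ l') r
  | [], _, _, _, _, h, h' => by simp only [IsString] at h; subst h; simpa using h'
  | _ :: _, _, _, _, _, h, h' => ⟨h.1, h.2.append h'⟩

/-- The value of a composable string. -/
def ev : (l : List G.C1) → {t s : G.C0} → G.IsString t l s → {f : G.C1 // G.s0 f = s ∧ G.t0 f = t}
  | [], _, s, h => ⟨G.i1 s, by simp, by simp only [IsString] at h; simp [h]⟩
  | f :: l, _, _, h => ⟨G.c0 f (ev l h.2).1 (ev l h.2).2.2.symm, by simp [(ev l h.2).2.1], by simp [h.1]⟩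

theorem ev_append : ∀ {l l' : List G.C1} {t s r : G.C0} (h : G.IsString t l s)
    (h' : G.IsString s l' r), (ev (l ++ l') (h.append h')).1 =
      G.c0 (ev l h).1 (ev l' h').1 ((ev l h).2.1.trans (ev l' h').2.2.symm)
  | [], l', t, s, r, h, h' => by
      have : t = s := h
      subst this
      simp [ev]
  | f :: l, l', t, s, r, h, h' => by
      simp only [List.cons_append, ev, GrayData.IsGray.c0_assoc']
      congr 1
      exact ev_append h.2 h'

open Classical in
/-- Remove the identities from a string. -/
noncomputable def red (l : List G.C1) : List G.C1 := l.filter fun f => ¬ G.IsUnit f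

theorem red_cons_unit {f : G.C1} (h : G.IsUnit f) (l : List G.C1) : red (f :: l) = red l := by
  simp [red, h]

theorem red_cons_ne {f : G.C1} (h : ¬ G.IsUnit f) (l : List G.C1) : red (f :: l) = f :: red l := by
  simp [red, h]

theorem red_append (l l' : List G.C1) : red (l ++ l') = red l ++ red l' := by
  simp [red]

theorem red_eq {l : List G.C1} (h : ∀ f ∈ l, ¬ G.IsUnit f) : red l = l := by
  simpa [red] using h

theorem red_ne (l : List G.C1) : ∀ f ∈ red l, ¬ G.IsUnit f := by
  simp [red]

theorem IsString.red : ∀ {l : List G.C1} {t s : G.C0}, G.IsString t l s → G.IsString t (red l) s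
  | [], _, _, h => h
  | f :: l, t, s, h => by
      by_cases hf : G.IsUnit f
      · rw [red_cons_unit hf]
        obtain ⟨x, rfl⟩ := hf
        have h1 : t = x := by simpa using h.1.symm
        subst h1
        have h2 := h.2
        simp only [G.s0_i1] at h2
        exact h2.red
      · rw [red_cons_ne hf]
        exact ⟨h.1, h.2.red⟩

theorem ev_congr {l l' : List G.C1} (e : l = l') {t t' s s' : G.C0} (ht : t = t') (hs : s = s')
    (h : G.IsString t l s) (h' : G.IsString t' l' s') : (ev l h).1 = (ev l' h').1 := by
  subst e; subst ht; subst hs; rfl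

theorem ev_red : ∀ {l : List G.C1} {t s : G.C0} (h : G.IsString t l s),
    (ev (red l) h.red).1 = (ev l h).1
  | [], _, _, _ => rfl
  | f :: l, t, s, h => by
      by_cases hf : G.IsUnit f
      · obtain ⟨x, rfl⟩ := id hf
        have h1 : t = x := by simpa using h.1.symm
        subst h1
        have h2 := h.2
        simp only [G.s0_i1] at h2
        rw [ev_congr (red_cons_unit hf l) rfl rfl _ h2.red, ev_red h2]
        simp only [ev, GrayData.IsGray.i1_c0]
        exact ev_congr rfl (G.s0_i1 _).symm rfl _ _
      · rw [ev_congr (red_cons_ne hf l) rfl rfl _ ⟨h.1, h.2.red⟩]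
        simp only [ev]
        congr 1
        exact ev_red h.2

theorem IsString.map (F : GrayFunctor G H) : ∀ {l : List G.C1} {t s : G.C0}, G.IsString t l s →
    H.IsString (F.map0 t) (l.map F.map1) (F.map0 s)
  | [], _, _, h => congrArg F.map0 h
  | _ :: _, _, _, h => ⟨by rw [F.t0_map, h.1], by rw [F.s0_map]; exact h.2.map F⟩

theorem ev_map (F : GrayFunctor G H) : ∀ {l : List G.C1} {t s : G.C0} (h : G.IsString t l s),
    (ev (l.map F.map1) (h.map F)).1 = F.map1 (ev l h).1
  | [], _, _, _ => by simp [ev]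
  | f :: l, _, _, h => by
      simp only [List.map_cons, ev, F.map_c0]
      congr 1
      rw [← ev_map F h.2]
      exact ev_congr rfl (F.s0_map f) rfl _ _

theorem _root_.GrayFunctor.isUnit (F : GrayFunctor G H) {f : G.C1} (h : G.IsUnit f) :
    H.IsUnit (F.map1 f) := by
  obtain ⟨x, rfl⟩ := h; exact ⟨_, F.map_i1 x⟩

theorem red_map_red (F : GrayFunctor G H) : ∀ l : List G.C1,
    red ((red l).map F.map1) = red (l.map F.map1)
  | [] => rfl
  | f :: l => by
      by_cases hf : G.IsUnit f
      · rw [red_cons_unit hf, List.map_cons, red_cons_unit (F.isUnit hf), red_map_red F l]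
      · rw [red_cons_ne hf, List.map_cons, List.map_cons]
        by_cases hf' : H.IsUnit (F.map1 f)
        · rw [red_cons_unit hf', red_cons_unit hf', red_map_red F l]
        · rw [red_cons_ne hf', red_cons_ne hf', red_map_red F l]

namespace Str

/-- The value of a string. -/
def val (f : Str G) : G.C1 := (ev f.l f.isString).1

@[simp] theorem s0_val (f : Str G) : G.s0 f.val = f.src := (ev f.l f.isString).2.1

@[simp] theorem t0_val (f : Str G) : G.t0 f.val = f.tgt := (ev f.l f.isString).2.2

/-- The empty string. -/
@[simps]
def one (x : G.C0) : Str G where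
  src := x
  tgt := x
  l := []
  isString := rfl
  ne := by simp

@[simp] theorem val_one (x : G.C0) : (one x).val = G.i1 x := rfl

/-- Concatenation of strings. -/
@[simps]
def mul (g f : Str G) (h : g.src = f.tgt) : Str G where
  src := f.src
  tgt := g.tgt
  l := g.l ++ f.l
  isString := g.isString.append (h ▸ f.isString)
  ne k hk := (List.mem_append.1 hk).elim (g.ne k) (f.ne k)

@[simp] theorem val_mul (g f : Str G) (h : g.src = f.tgt) :
    (g.mul f h).val = G.c0 g.val f.val (by simp [h]) := by
  obtain ⟨a, b, l, hl, _⟩ := f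
  dsimp at h
  subst h
  exact ev_append g.isString hl

theorem mul_assoc (h g f : Str G) (hg) (p) :
    (h.mul g hg).mul f p = h.mul (g.mul f (by simpa using p)) (by simpa using hg) := by
  ext1 <;> simp

@[simp] theorem one_mul (x : G.C0) (f : Str G) (h) : (one x).mul f h = f := by
  simp at h; subst h; ext1 <;> simp

@[simp] theorem mul_one (x : G.C0) (f : Str G) (h) : f.mul (one x) h = f := by
  simp at h; subst h; ext1 <;> simp

/-- The string consisting of one 1-cell; it is empty for an identity. -/
@[simps]
noncomputable def single (f : G.C1) : Str G where
  src := G.s0 f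
  tgt := G.t0 f
  l := red [f]
  isString := IsString.red ⟨rfl, rfl⟩
  ne := red_ne _

@[simp] theorem val_single (f : G.C1) : (single f).val = f := by
  refine (ev_red (l := [f]) ⟨rfl, rfl⟩).trans ?_
  simp [ev]

/-- The image of a string under a `Gray`-functor. -/
@[simps]
noncomputable def map (F : GrayFunctor G H) (f : Str G) : Str H where
  src := F.map0 f.src
  tgt := F.map0 f.tgt
  l := red (f.l.map F.map1)
  isString := (f.isString.map F).red
  ne := red_ne _

@[simp] theorem val_map (F : GrayFunctor G H) (f : Str G) : (f.map F).val = F.map1 f.val :=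
  (ev_red (f.isString.map F)).trans (ev_map F f.isString)

@[simp] theorem map_one (F : GrayFunctor G H) (x : G.C0) : (one x).map F = one (F.map0 x) := by
  ext1 <;> rfl

@[simp] theorem map_mul (F : GrayFunctor G H) (g f : Str G) (h : g.src = f.tgt) :
    (g.mul f h).map F = (g.map F).mul (f.map F) (by simp [h]) := by
  ext1 <;> simp [red_append]

theorem map_id (f : Str G) : f.map (GrayFunctor.id G) = f := by
  ext1
  · rfl
  · rfl
  · have e : f.l.map (GrayFunctor.id G).map1 = f.l := List.map_id f.l
    simpa only [map_l, e] using red_eq f.ne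

theorem map_comp (F : GrayFunctor G H) (L : GrayFunctor H K) (f : Str G) :
    f.map (F.comp L) = (f.map F).map L := by
  ext1
  · rfl
  · rfl
  · simp only [map_l, red_map_red, List.map_map]; rfl

end Str

end

end GrayCat

/-- A 2-cell of `Q¹ G`: a 2-cell of `G` between the values of two strings. -/
@[ext]
structure Q2 (G : GrayCat.{u}) where
  cell : G.C2
  src : GrayCat.Str G
  tgt : GrayCat.Str G
  s1_cell : G.s1 cell = src.val
  t1_cell : G.t1 cell = tgt.val

/-- A 3-cell of `Q¹ G`: a 3-cell of `G` between parallel 2-cells of `Q¹ G`. -/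
@[ext]
structure Q3 (G : GrayCat.{u}) where
  cell : G.C3
  src : GrayCat.Str G
  tgt : GrayCat.Str G
  s1_s2 : G.s1 (G.s2 cell) = src.val
  t1_s2 : G.t1 (G.s2 cell) = tgt.val

attribute [simp] Q2.s1_cell Q2.t1_cell Q3.s1_s2 Q3.t1_s2

namespace GrayCat

section

variable {G H : GrayCat.{u}}

@[simp] theorem _root_.Q2.tgt_src (α : Q2 G) : α.tgt.src = α.src.src := by
  rw [← Str.s0_val, ← Str.s0_val, ← α.s1_cell, ← α.t1_cell, G.s0_t1]

@[simp] theorem _root_.Q2.tgt_tgt (α : Q2 G) : α.tgt.tgt = α.src.tgt := by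
  rw [← Str.t0_val, ← Str.t0_val, ← α.s1_cell, ← α.t1_cell, G.t0_t1]

@[simp] theorem _root_.Q3.tgt_src (Γ : Q3 G) : Γ.tgt.src = Γ.src.src := by
  rw [← Str.s0_val, ← Str.s0_val, ← Γ.s1_s2, ← Γ.t1_s2, G.s0_t1]

@[simp] theorem _root_.Q3.tgt_tgt (Γ : Q3 G) : Γ.tgt.tgt = Γ.src.tgt := by
  rw [← Str.t0_val, ← Str.t0_val, ← Γ.s1_s2, ← Γ.t1_s2, G.t0_t1]

/-- The source of a 3-cell of `Q¹ G`. -/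
@[simps]
def _root_.Q3.source (Γ : Q3 G) : Q2 G where
  cell := G.s2 Γ.cell
  src := Γ.src
  tgt := Γ.tgt
  s1_cell := by simp
  t1_cell := by simp

/-- The target of a 3-cell of `Q¹ G`. -/
@[simps]
def _root_.Q3.target (Γ : Q3 G) : Q2 G where
  cell := G.t2 Γ.cell
  src := Γ.src
  tgt := Γ.tgt
  s1_cell := by simp
  t1_cell := by simp

namespace Q1

/-- Identity 2-cells of `Q¹ G`. -/
@[simps] def i2 (f : Str G) : Q2 G := ⟨G.i2 f.val, f, f, by simp, by simp⟩

/-- Identity 3-cells of `Q¹ G`. -/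
@[simps] def i3 (α : Q2 G) : Q3 G := ⟨G.i3 α.cell, α.src, α.tgt, by simp, by simp⟩

/-- Left whiskers of 2-cells of `Q¹ G`. -/
@[simps] def l2 (g : Str G) (α : Q2 G) (h : g.src = α.src.tgt) : Q2 G :=
  ⟨G.l2 g.val α.cell (by simp [h]), g.mul α.src h, g.mul α.tgt (by simp [h]), by simp, by simp⟩

/-- Right whiskers of 2-cells of `Q¹ G`. -/
@[simps] def r2 (α : Q2 G) (f : Str G) (h : α.src.src = f.tgt) : Q2 G :=
  ⟨G.r2 α.cell f.val (by simp [h]), α.src.mul f h, α.tgt.mul f (by simp [h]), by simp, by simp⟩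

/-- Left whiskers of 3-cells of `Q¹ G`. -/
@[simps] def l3 (g : Str G) (Γ : Q3 G) (h : g.src = Γ.src.tgt) : Q3 G :=
  ⟨G.l3 g.val Γ.cell (by simp [h]), g.mul Γ.src h, g.mul Γ.tgt (by simp [h]), by simp, by simp⟩

/-- Right whiskers of 3-cells of `Q¹ G`. -/
@[simps] def r3 (Γ : Q3 G) (f : Str G) (h : Γ.src.src = f.tgt) : Q3 G :=
  ⟨G.r3 Γ.cell f.val (by simp [h]), Γ.src.mul f h, Γ.tgt.mul f (by simp [h]), by simp, by simp⟩

/-- Composition of 2-cells of `Q¹ G`. -/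
@[simps] def c1 (β α : Q2 G) (h : β.src = α.tgt) : Q2 G :=
  ⟨G.c1 β.cell α.cell (by simp [h]), α.src, β.tgt, by simp, by simp⟩

/-- Composition along a 1-cell of 3-cells of `Q¹ G`. -/
@[simps] def h3 (Δ Γ : Q3 G) (h : Δ.src = Γ.tgt) : Q3 G :=
  ⟨G.h3 Δ.cell Γ.cell (by simp [h]), Γ.src, Δ.tgt, by simp, by simp⟩

/-- Composition along a 2-cell of 3-cells of `Q¹ G`. -/
@[simps] def c2 (Δ Γ : Q3 G) (h : Δ.source = Γ.target) : Q3 G :=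
  ⟨G.c2 Δ.cell Γ.cell (by simpa using congrArg Q2.cell h), Γ.src, Γ.tgt, by simp, by simp⟩

/-- Interchangers of `Q¹ G`. -/
@[simps] def tensor (β α : Q2 G) (h : β.src.src = α.src.tgt) : Q3 G :=
  ⟨G.tensor β.cell α.cell (by simp [h]), β.src.mul α.src h, β.tgt.mul α.tgt (by simp [h]),
    by simp, by simp⟩

/-- Inverse interchangers of `Q¹ G`. -/
@[simps] def tinv (β α : Q2 G) (h : β.src.src = α.src.tgt) : Q3 G :=
  ⟨G.tinv β.cell α.cell (by simp [h]), β.src.mul α.src h, β.tgt.mul α.tgt (by simp [h]),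
    by simp, by simp⟩

end Q1

/-- The cells and operations of `Q¹ G`. -/
def q1Data (G : GrayCat.{u}) : GrayData.{u} where
  C0 := G.C0
  C1 := Str G
  C2 := Q2 G
  C3 := Q3 G
  s0 := Str.src
  t0 := Str.tgt
  s1 := Q2.src
  t1 := Q2.tgt
  s2 := Q3.source
  t2 := Q3.target
  s0_t1 α := α.tgt_src
  t0_t1 α := α.tgt_tgt
  s1_t2 _ := rfl
  t1_t2 _ := rfl
  i1 := Str.one
  i2 := Q1.i2
  i3 := Q1.i3
  s0_i1 _ := rfl
  t0_i1 _ := rfl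
  s1_i2 _ := rfl
  t1_i2 _ := rfl
  s2_i3 _ := by ext1 <;> simp
  t2_i3 _ := by ext1 <;> simp
  c0 := Str.mul
  l2 := Q1.l2
  r2 := Q1.r2
  l3 := Q1.l3
  r3 := Q1.r3
  c1 := Q1.c1
  h3 := Q1.h3
  c2 := Q1.c2
  tensor := Q1.tensor
  tinv := Q1.tinv
  s0_c0 _ _ _ := rfl
  t0_c0 _ _ _ := rfl
  s1_l2 _ _ _ := rfl
  t1_l2 _ _ _ := rfl
  s1_r2 _ _ _ := rfl
  t1_r2 _ _ _ := rfl
  s2_l3 _ _ _ := Q2.ext (G.s2_l3 _ _ _) rfl rfl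
  t2_l3 _ _ _ := Q2.ext (G.t2_l3 _ _ _) rfl rfl
  s2_r3 _ _ _ := Q2.ext (G.s2_r3 _ _ _) rfl rfl
  t2_r3 _ _ _ := Q2.ext (G.t2_r3 _ _ _) rfl rfl
  s1_c1 _ _ _ := rfl
  t1_c1 _ _ _ := rfl
  s2_h3 _ _ _ := Q2.ext (G.s2_h3 _ _ _) rfl rfl
  t2_h3 _ _ _ := Q2.ext (G.t2_h3 _ _ _) rfl rfl
  s2_c2 _ _ _ := by ext1 <;> simp
  t2_c2 Δ Γ h := Q2.ext (G.t2_c2 _ _ _) (congrArg Q2.src h.symm : Γ.src = Δ.src)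
    (congrArg Q2.tgt h.symm : Γ.tgt = Δ.tgt)
  s2_tensor _ _ _ := by ext1 <;> simp
  t2_tensor _ _ _ := by ext1 <;> simp
  s2_tinv _ _ _ := by ext1 <;> simp
  t2_tinv _ _ _ := by ext1 <;> simp

open GrayData GrayData.IsGray

namespace Q1

theorem l2_i2 (g f : Str G) (h : g.src = f.tgt) : l2 g (i2 f) (by simp [h]) = i2 (g.mul f h) := by
  ext1 <;> simp

theorem r2_i2 (g f : Str G) (h : g.src = f.tgt) : r2 (i2 g) f (by simp [h]) = i2 (g.mul f h) := by
  ext1 <;> simp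

theorem i1_l2 (x : G.C0) (α : Q2 G) (h) : l2 (Str.one x) α h = α := by ext1 <;> simp

theorem i1_l3 (x : G.C0) (Γ : Q3 G) (h) : l3 (Str.one x) Γ h = Γ := by ext1 <;> simp

theorem r2_i1 (α : Q2 G) (x : G.C0) (h) : r2 α (Str.one x) h = α := by ext1 <;> simp

theorem r3_i1 (Γ : Q3 G) (x : G.C0) (h) : r3 Γ (Str.one x) h = Γ := by ext1 <;> simp

theorem c0_l2 (h g : Str G) (α : Q2 G) (hh) (hg : g.src = α.src.tgt) :
    l2 (h.mul g hh) α (by simp [hg]) = l2 h (l2 g α hg) (by simp [hh]) := by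
  ext1 <;> simp [c0_l2', Str.mul_assoc]

theorem c0_l3 (h g : Str G) (Γ : Q3 G) (hh) (hg : g.src = Γ.src.tgt) :
    l3 (h.mul g hh) Γ (by simp [hg]) = l3 h (l3 g Γ hg) (by simp [hh]) := by
  ext1 <;> simp [c0_l3', Str.mul_assoc]

theorem r2_c0 (α : Q2 G) (g f : Str G) (hg : α.src.src = g.tgt) (hf) :
    r2 α (g.mul f hf) (by simp [hg]) = r2 (r2 α g hg) f (by simp [hf]) := by
  ext1 <;> simp [r2_c0', Str.mul_assoc]

theorem r3_c0 (Γ : Q3 G) (g f : Str G) (hg : Γ.src.src = g.tgt) (hf) :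
    r3 Γ (g.mul f hf) (by simp [hg]) = r3 (r3 Γ g hg) f (by simp [hf]) := by
  ext1 <;> simp [r3_c0', Str.mul_assoc]

theorem r2_l2 (g : Str G) (α : Q2 G) (f : Str G) (hg) (hf : α.src.src = f.tgt) :
    r2 (l2 g α hg) f (by simp [hf]) = l2 g (r2 α f hf) (by simp [hg]) := by
  ext1 <;> simp [r2_l2', Str.mul_assoc]

theorem r3_l3 (g : Str G) (Γ : Q3 G) (f : Str G) (hg) (hf : Γ.src.src = f.tgt) :
    r3 (l3 g Γ hg) f (by simp [hf]) = l3 g (r3 Γ f hf) (by simp [hg]) := by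
  ext1 <;> simp [r3_l3', Str.mul_assoc]

theorem tensor_nat (Δ Γ : Q3 G) (h : Δ.src.src = Γ.src.tgt) :
    c2 (tensor Δ.target Γ.target (by simp [h]))
        (h3 (r3 Δ Γ.tgt (by simp [h])) (l3 Δ.src Γ h) (by simp)) (by ext1 <;> simp) =
      c2 (h3 (l3 Δ.tgt Γ (by simp [h])) (r3 Δ Γ.src h) (by simp))
        (tensor Δ.source Γ.source (by simp [h])) (by ext1 <;> simp) := by
  ext1
  · simpa using GrayData.IsGray.tensor_nat Δ.cell Γ.cell (by simp [h])
  · simp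
  · simp

theorem i2_tensor (g : Str G) (α : Q2 G) (h : g.src = α.src.tgt) :
    tensor (i2 g) α (by simp [h]) = i3 (l2 g α h) := by ext1 <;> simp

theorem tensor_i2 (β : Q2 G) (f : Str G) (h : β.src.src = f.tgt) :
    tensor β (i2 f) (by simp [h]) = i3 (r2 β f h) := by ext1 <;> simp

theorem c1_tensor (β' β α : Q2 G) (hb) (h : β.src.src = α.src.tgt) :
    tensor (c1 β' β hb) α (by simp [h]) =
    c2 (h3 (tensor β' α (by simp [hb, h])) (i3 (r2 β α.src h)) (by simp [hb]))
      (h3 (i3 (r2 β' α.tgt (by simp [hb, h]))) (tensor β α h) (by simp [hb]))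
      (by ext1 <;> simp [hb, c1_assoc']) := by
  ext1 <;> simp [c1_tensor']

theorem tensor_c1 (β α' α : Q2 G) (ha) (h : β.src.src = α.src.tgt) :
    tensor β (c1 α' α ha) (by simp [h]) =
    c2 (h3 (i3 (l2 β.tgt α' (by simp [ha, h]))) (tensor β α h) (by simp [ha]))
      (h3 (tensor β α' (by simp [ha, h])) (i3 (l2 β.src α h)) (by simp [ha]))
      (by ext1 <;> simp [ha, c1_assoc']) := by
  ext1 <;> simp [tensor_c1']

theorem l2_tensor (g : Str G) (β α : Q2 G) (hg : g.src = β.src.tgt) (h : β.src.src = α.src.tgt) :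
    tensor (l2 g β hg) α (by simp [h]) = l3 g (tensor β α h) (by simp [hg]) := by
  ext1 <;> simp [l2_tensor', Str.mul_assoc]

theorem r2_tensor (β : Q2 G) (g : Str G) (α : Q2 G) (hg : β.src.src = g.tgt)
    (h : g.src = α.src.tgt) : tensor (r2 β g hg) α (by simp [h]) =
    tensor β (l2 g α h) (by simp [hg]) := by
  ext1 <;> simp [r2_tensor', Str.mul_assoc]

theorem tensor_r2 (β α : Q2 G) (f : Str G) (h : β.src.src = α.src.tgt) (hf : α.src.src = f.tgt) :
    tensor β (r2 α f hf) (by simp [h]) = r3 (tensor β α h) f (by simp [hf]) := by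
  ext1 <;> simp [tensor_r2', Str.mul_assoc]

end Q1

instance (G : GrayCat.{u}) : (q1Data G).IsGray where
  c0_assoc h g f hg gf := Str.mul_assoc h g f hg gf
  i1_c0 x f h := Str.one_mul x f h
  c0_i1 f x h := Str.mul_one x f h
  c1_assoc γ β α hg hb := by
    refine Q2.ext ?_ rfl rfl
    exact c1_assoc' _ _ _ _ _
  i2_c1 f α h := Q2.ext (i2_c1 _ _ _) rfl h
  c1_i2 α f h := Q2.ext (c1_i2 _ _ _) h.symm rfl
  c2_assoc Θ Δ Γ hg hb := Q3.ext (c2_assoc' _ _ _ _ _) rfl rfl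
  i3_c2 α Γ h := Q3.ext (i3_c2 _ _ _) rfl rfl
  c2_i3 Γ α h := Q3.ext (c2_i3 _ _ _) (congrArg Q2.src h.symm) (congrArg Q2.tgt h.symm)
  h3_assoc Θ Δ Γ hg hb := Q3.ext (h3_assoc' _ _ _ _ _) rfl rfl
  i3_h3 f Γ h := Q3.ext (i3_h3 _ _ _) rfl h
  h3_i3 Γ f h := Q3.ext (h3_i3 _ _ _) h.symm rfl
  i3_c1 β α h := Q3.ext (i3_c1 _ _ _) rfl rfl
  h3_c2 Δ' Δ Γ' Γ hd hg h := Q3.ext (h3_c2 _ _ _ _ (congrArg Q2.cell hd) (congrArg Q2.cell hg)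
    (by rw [Δ.s1_s2, Γ.t1_s2]; exact congrArg Str.val h)) rfl rfl
  l2_i2 g f h := Q1.l2_i2 g f h
  l2_c1 g β α hg h := Q2.ext (l2_c1' _ _ _ _ _) rfl rfl
  l3_i3 g α h := Q3.ext (l3_i3' _ _ _) rfl rfl
  l3_c2 g Δ Γ hg h := Q3.ext (l3_c2' _ _ _ _ _) rfl rfl
  l3_h3 g Δ Γ hg h := Q3.ext (l3_h3' _ _ _ _ _) rfl rfl
  i1_l2 x α h := Q1.i1_l2 x α h
  i1_l3 x Γ h := Q1.i1_l3 x Γ h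
  c0_l2 h g α hh hg := Q1.c0_l2 h g α hh hg
  c0_l3 h g α hh hg := Q1.c0_l3 h g α hh hg
  r2_i2 g f h := Q1.r2_i2 g f h
  r2_c1 β α f h hf := Q2.ext (r2_c1' _ _ _ _ _) rfl rfl
  r3_i3 α f h := Q3.ext (r3_i3' _ _ _) rfl rfl
  r3_c2 Δ Γ f h hf := Q3.ext (r3_c2' _ _ _ _ _) rfl rfl
  r3_h3 Δ Γ f h hf := Q3.ext (r3_h3' _ _ _ _ _) rfl rfl
  r2_i1 α x h := Q1.r2_i1 α x h
  r3_i1 Γ x h := Q1.r3_i1 Γ x h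
  r2_c0 α g f hg hf := Q1.r2_c0 α g f hg hf
  r3_c0 Γ g f hg hf := Q1.r3_c0 Γ g f hg hf
  r2_l2 g α f hg hf := Q1.r2_l2 g α f hg hf
  r3_l3 g Γ f hg hf := Q1.r3_l3 g Γ f hg hf
  tinv_tensor β α h := Q3.ext ((tinv_tensor _ _ _)) rfl rfl
  tensor_tinv β α h := Q3.ext ((tensor_tinv _ _ _)) rfl rfl
  tensor_nat Δ Γ h := Q1.tensor_nat Δ Γ h
  i2_tensor g α h := Q1.i2_tensor g α h
  tensor_i2 β f h := Q1.tensor_i2 β f h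
  c1_tensor β' β α hb h := Q1.c1_tensor β' β α hb h
  tensor_c1 β α' α ha h := Q1.tensor_c1 β α' α ha h
  l2_tensor g β α hg h := Q1.l2_tensor g β α hg h
  r2_tensor β g α hg h := Q1.r2_tensor β g α hg h
  tensor_r2 β α f h hf := Q1.tensor_r2 β α f h hf

end

end GrayCat

namespace GrayCat

/-- The `Gray`-category `Q¹ G`: its 1-cells are freely generated by the reflexive graph of 1-cells of
`G`, and its 2-cells and 3-cells are those of `G` between the values of such strings. -/
def q1 (G : GrayCat.{u}) : GrayCat.{u} where
  toGrayData := q1Data G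
  isGray := inferInstance

section

variable {G H K : GrayCat.{u}}

/-- The action of `Q¹ F` on 2-cells. -/
@[simps] noncomputable def _root_.Q2.map (F : GrayFunctor G H) (α : Q2 G) : Q2 H :=
  ⟨F.map2 α.cell, α.src.map F, α.tgt.map F, by simp, by simp⟩

/-- The action of `Q¹ F` on 3-cells. -/
@[simps] noncomputable def _root_.Q3.map (F : GrayFunctor G H) (Γ : Q3 G) : Q3 H :=
  ⟨F.map3 Γ.cell, Γ.src.map F, Γ.tgt.map F, by simp, by simp⟩

theorem _root_.Q2.map_l2 (F : GrayFunctor G H) (g : Str G) (α : Q2 G) (h) :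
    (Q1.l2 g α h).map F = Q1.l2 (g.map F) (α.map F) (by simp [h]) := by
  ext1 <;> simp

theorem _root_.Q2.map_r2 (F : GrayFunctor G H) (α : Q2 G) (f : Str G) (h) :
    (Q1.r2 α f h).map F = Q1.r2 (α.map F) (f.map F) (by simp [h]) := by
  ext1 <;> simp

theorem _root_.Q3.map_l3 (F : GrayFunctor G H) (g : Str G) (Γ : Q3 G) (h) :
    (Q1.l3 g Γ h).map F = Q1.l3 (g.map F) (Γ.map F) (by simp [h]) := by
  ext1 <;> simp

theorem _root_.Q3.map_r3 (F : GrayFunctor G H) (Γ : Q3 G) (f : Str G) (h) :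
    (Q1.r3 Γ f h).map F = Q1.r3 (Γ.map F) (f.map F) (by simp [h]) := by
  ext1 <;> simp

theorem _root_.Q3.map_tensor (F : GrayFunctor G H) (β α : Q2 G) (h) :
    (Q1.tensor β α h).map F = Q1.tensor (β.map F) (α.map F) (by simp [h]) := by
  ext1 <;> simp

/-- The action of `Q¹` on `Gray`-functors. -/
noncomputable def q1Map (F : GrayFunctor G H) : GrayFunctor (q1 G) (q1 H) where
  map0 x := F.map0 x
  map1 f := Str.map F f
  map2 α := Q2.map F α
  map3 Γ := Q3.map F Γ
  s0_map _ := rfl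
  t0_map _ := rfl
  s1_map _ := rfl
  t1_map _ := rfl
  s2_map _ := Q2.ext (F.s2_map _) rfl rfl
  t2_map _ := Q2.ext (F.t2_map _) rfl rfl
  map_i1 := Str.map_one F
  map_i2 f := Q2.ext ((F.map_i2 _).trans (congrArg H.i2 (Str.val_map F f).symm)) rfl rfl
  map_i3 _ := Q3.ext (F.map_i3 _) rfl rfl
  map_c0 := Str.map_mul F
  map_l2 g α h := Q2.map_l2 F g α h
  map_r2 α f h := Q2.map_r2 F α f h
  map_l3 g Γ h := Q3.map_l3 F g Γ h
  map_r3 Γ f h := Q3.map_r3 F Γ f h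
  map_c1 β α h := Q2.ext (F.map_c1 _ _ _) rfl rfl
  map_h3 Δ Γ h := Q3.ext (F.map_h3 _ _ _) rfl rfl
  map_c2 Δ Γ h := Q3.ext (F.map_c2 _ _ _) rfl rfl
  map_tensor β α h := Q3.map_tensor F β α h

/-- The counit of `Q¹`: it composes the strings. -/
def q1Counit (G : GrayCat.{u}) : GrayFunctor (q1 G) G where
  map0 x := x
  map1 f := Str.val f
  map2 α := Q2.cell α
  map3 Γ := Q3.cell Γ
  s0_map := Str.s0_val
  t0_map := Str.t0_val
  s1_map := Q2.s1_cell
  t1_map := Q2.t1_cell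
  s2_map _ := rfl
  t2_map _ := rfl
  map_i1 _ := rfl
  map_i2 _ := rfl
  map_i3 _ := rfl
  map_c0 := Str.val_mul
  map_l2 _ _ _ := rfl
  map_r2 _ _ _ := rfl
  map_l3 _ _ _ := rfl
  map_r3 _ _ _ := rfl
  map_c1 _ _ _ := rfl
  map_h3 _ _ _ := rfl
  map_c2 _ _ _ := rfl
  map_tensor _ _ _ := rfl

theorem isString_single : ∀ {l : List G.C1} {t s : G.C0}, G.IsString t l s →
    (q1 G).IsString t (l.map (Str.single : G.C1 → Str G)) s
  | [], _, _, h => h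
  | _ :: _, _, _, h => ⟨h.1, isString_single h.2⟩

theorem isUnit_single {f : G.C1} (h : (q1 G).IsUnit (Str.single f : Str G)) : G.IsUnit f := by
  obtain ⟨x, h⟩ := h
  by_contra hf
  have h1 : red [f] = [] := congrArg Str.l h
  rw [red_cons_ne hf] at h1
  cases h1

/-- The string of one-letter strings. -/
@[simps]
noncomputable def Str.dup (f : Str G) : Str (q1 G) where
  src := f.src
  tgt := f.tgt
  l := f.l.map (Str.single : G.C1 → Str G)
  isString := isString_single f.isString
  ne := by
    intro g hg
    obtain ⟨k, hk, rfl⟩ := List.mem_map.1 hg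
    exact fun h => f.ne k hk (isUnit_single h)

theorem Str.ext_l {f g : Str G} (hs : f.src = g.src) (ht : f.tgt = g.tgt) (hl : f.l = g.l) : f = g :=
  Str.ext hs ht hl

theorem ev_single : ∀ {l : List G.C1} {t s : G.C0} (h : G.IsString t l s),
    (∀ f ∈ l, ¬ G.IsUnit f) →
    ((ev (G := q1 G) (l.map (Str.single : G.C1 → Str G)) (isString_single h)).1 : Str G).l = l
  | [], _, _, _, _ => rfl
  | f :: l, _, _, h, hl => by
      have h1 := ev_single h.2 fun g hg => hl g (List.mem_cons_of_mem _ hg)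
      have h2 : red [f] = [f] := red_eq (by simpa using hl f)
      exact congrArg₂ (· ++ ·) h2 h1

theorem Str.val_dup (f : Str G) : (f.dup.val : Str G) = f :=
  Str.ext (Str.s0_val f.dup) (Str.t0_val f.dup) (ev_single f.isString f.ne)

theorem Str.dup_one (x : G.C0) : (Str.one x : Str G).dup = Str.one (G := q1 G) x := by
  ext1 <;> rfl

theorem Str.dup_mul (g f : Str G) (h : g.src = f.tgt) :
    (g.mul f h).dup = Str.mul (G := q1 G) g.dup f.dup h := by
  ext1
  · rfl
  · rfl
  · exact List.map_append

/-- A 2-cell of `Q¹ G` as a 2-cell of `Q¹ (Q¹ G)`. -/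
@[simps] noncomputable def _root_.Q2.dup (α : Q2 G) : Q2 (q1 G) :=
  ⟨α, α.src.dup, α.tgt.dup, α.src.val_dup.symm, α.tgt.val_dup.symm⟩

/-- A 3-cell of `Q¹ G` as a 3-cell of `Q¹ (Q¹ G)`. -/
@[simps] noncomputable def _root_.Q3.dup (Γ : Q3 G) : Q3 (q1 G) :=
  ⟨Γ, Γ.src.dup, Γ.tgt.dup, Γ.src.val_dup.symm, Γ.tgt.val_dup.symm⟩

theorem _root_.Q2.dup_l2 (g : Str G) (α : Q2 G) (h : g.src = α.src.tgt) :
    (Q1.l2 g α h).dup = Q1.l2 (G := q1 G) g.dup α.dup h := by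
  have : ∀ (g' : Str G) (e : g = g'), Q1.l2 g α h = Q1.l2 g' α (e ▸ h) := by rintro _ rfl; rfl
  exact Q2.ext (this _ g.val_dup.symm) (Str.dup_mul _ _ h) (Str.dup_mul g α.tgt (by simp [h]))

theorem _root_.Q2.dup_r2 (α : Q2 G) (f : Str G) (h : α.src.src = f.tgt) :
    (Q1.r2 α f h).dup = Q1.r2 (G := q1 G) α.dup f.dup h := by
  have : ∀ (g' : Str G) (e : f = g'), Q1.r2 α f h = Q1.r2 α g' (e ▸ h) := by rintro _ rfl; rfl
  exact Q2.ext (this _ f.val_dup.symm) (Str.dup_mul _ _ h) (Str.dup_mul α.tgt f (by simp [h]))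

theorem _root_.Q3.dup_l3 (g : Str G) (Γ : Q3 G) (h : g.src = Γ.src.tgt) :
    (Q1.l3 g Γ h).dup = Q1.l3 (G := q1 G) g.dup Γ.dup h := by
  have : ∀ (g' : Str G) (e : g = g'), Q1.l3 g Γ h = Q1.l3 g' Γ (e ▸ h) := by rintro _ rfl; rfl
  exact Q3.ext (this _ g.val_dup.symm) (Str.dup_mul _ _ h) (Str.dup_mul g Γ.tgt (by simp [h]))

theorem _root_.Q3.dup_r3 (Γ : Q3 G) (f : Str G) (h : Γ.src.src = f.tgt) :
    (Q1.r3 Γ f h).dup = Q1.r3 (G := q1 G) Γ.dup f.dup h := by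
  have : ∀ (g' : Str G) (e : f = g'), Q1.r3 Γ f h = Q1.r3 Γ g' (e ▸ h) := by rintro _ rfl; rfl
  exact Q3.ext (this _ f.val_dup.symm) (Str.dup_mul _ _ h) (Str.dup_mul Γ.tgt f (by simp [h]))

theorem _root_.Q3.dup_tensor (β α : Q2 G) (h : β.src.src = α.src.tgt) :
    (Q1.tensor β α h).dup = Q1.tensor (G := q1 G) β.dup α.dup h :=
  Q3.ext rfl (Str.dup_mul _ _ h) (Str.dup_mul β.tgt α.tgt (by simp [h]))

/-- The comultiplication of `Q¹`. -/
noncomputable def q1Comult (G : GrayCat.{u}) : GrayFunctor (q1 G) (q1 (q1 G)) where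
  map0 x := x
  map1 f := Str.dup f
  map2 α := Q2.dup α
  map3 Γ := Q3.dup Γ
  s0_map _ := rfl
  t0_map _ := rfl
  s1_map _ := rfl
  t1_map _ := rfl
  s2_map _ := rfl
  t2_map _ := rfl
  map_i1 _ := rfl
  map_i2 f := Q2.ext (congrArg (GrayData.i2 (q1 G).toGrayData) (Str.val_dup f).symm) rfl rfl
  map_i3 _ := rfl
  map_c0 := Str.dup_mul
  map_l2 := Q2.dup_l2
  map_r2 := Q2.dup_r2
  map_l3 := Q3.dup_l3
  map_r3 := Q3.dup_r3
  map_c1 _ _ _ := rfl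
  map_h3 _ _ _ := rfl
  map_c2 _ _ _ := rfl
  map_tensor := Q3.dup_tensor

end

theorem q1Map_id (G : GrayCat.{u}) : q1Map (GrayFunctor.id G) = GrayFunctor.id (q1 G) :=
  GrayFunctor.ext rfl (funext Str.map_id)
    (funext fun α => Q2.ext rfl (Str.map_id (Q2.src α)) (Str.map_id (Q2.tgt α)))
    (funext fun Γ => Q3.ext rfl (Str.map_id (Q3.src Γ)) (Str.map_id (Q3.tgt Γ)))

theorem q1Map_comp {G H K : GrayCat.{u}} (F : GrayFunctor G H) (L : GrayFunctor H K) :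
    q1Map (F.comp L) = (q1Map F).comp (q1Map L) :=
  GrayFunctor.ext rfl (funext (Str.map_comp F L))
    (funext fun α => Q2.ext rfl (Str.map_comp F L (Q2.src α)) (Str.map_comp F L (Q2.tgt α)))
    (funext fun Γ => Q3.ext rfl (Str.map_comp F L (Q3.src Γ)) (Str.map_comp F L (Q3.tgt Γ)))

theorem q1Counit_nat {G H : GrayCat.{u}} (F : GrayFunctor G H) :
    (q1Map F).comp (q1Counit H) = (q1Counit G).comp F :=
  GrayFunctor.ext rfl (funext (Str.val_map F)) rfl rfl

theorem Str.single_map {G H : GrayCat.{u}} (F : GrayFunctor G H) (f : G.C1) :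
    (Str.single f).map F = Str.single (F.map1 f) :=
  Str.ext (F.s0_map f).symm (F.t0_map f).symm (red_map_red F [f])

theorem IsUnit_val {G : GrayCat.{u}} {f : Str G} (h : (q1 G).IsUnit f) : G.IsUnit f.val := by
  obtain ⟨x, h⟩ := h
  exact ⟨x, congrArg Str.val h⟩

theorem Str.single_ne {G : GrayCat.{u}} {f : G.C1} (h : ¬ G.IsUnit f) :
    ¬ (q1 G).IsUnit (Str.single f : Str G) := fun h' => h (isUnit_single h')

theorem Str.isUnit_single {G : GrayCat.{u}} {f : G.C1} (h : G.IsUnit f) :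
    (q1 G).IsUnit (Str.single f : Str G) := by
  obtain ⟨x, rfl⟩ := h
  refine ⟨x, Str.ext (G.s0_i1 x) (G.t0_i1 x) ?_⟩
  exact red_cons_unit ⟨x, rfl⟩ []

theorem red_single {G : GrayCat.{u}} : ∀ l : List G.C1,
    red (G := q1 G) (l.map (Str.single : G.C1 → Str G)) =
      (red l).map (Str.single : G.C1 → Str G)
  | [] => rfl
  | f :: l => by
      by_cases hf : G.IsUnit f
      · refine (red_cons_unit (G := q1 G) (Str.isUnit_single hf) _).trans ((red_single l).trans ?_)
        rw [red_cons_unit hf]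
      · refine (red_cons_ne (G := q1 G) (Str.single_ne hf) _).trans ?_
        rw [red_cons_ne hf]
        exact congrArg (List.cons _) (red_single l)

theorem Str.dup_map {G H : GrayCat.{u}} (F : GrayFunctor G H) (f : Str G) :
    (f.map F).dup = f.dup.map (q1Map F) := by
  refine Str.ext rfl rfl ?_
  refine (red_single (f.l.map F.map1)).symm.trans (congrArg red ?_)
  refine (List.map_map).trans (Eq.trans ?_ (List.map_map).symm)
  exact List.map_congr_left fun k _ => (Str.single_map F k).symm

theorem q1Comult_nat {G H : GrayCat.{u}} (F : GrayFunctor G H) :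
    (q1Map F).comp (q1Comult H) = (q1Comult G).comp (q1Map (q1Map F)) :=
  GrayFunctor.ext rfl (funext (Str.dup_map F))
    (funext fun α => Q2.ext rfl (Str.dup_map F (Q2.src α)) (Str.dup_map F (Q2.tgt α)))
    (funext fun Γ => Q3.ext rfl (Str.dup_map F (Q3.src Γ)) (Str.dup_map F (Q3.tgt Γ)))

theorem Str.dup_dup {G : GrayCat.{u}} (f : Str G) :
    f.dup.map (q1Comult G) = Str.dup (G := q1 G) f.dup := by
  refine Str.ext rfl rfl ?_
  have e : f.dup.l.map (q1Comult G).map1 =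
      f.dup.l.map (Str.single (G := q1 G)) := by
    refine List.map_congr_left fun k hk => ?_
    obtain ⟨k', hk', rfl⟩ := List.mem_map.1 hk
    refine Str.ext rfl rfl ?_
    have h1 : red [k'] = [k'] := red_eq (by simpa using f.ne k' hk')
    have h2 : red (G := q1 G) [(Str.single k' : Str G)] = [(Str.single k' : Str G)] :=
      red_eq fun g hg => (List.mem_singleton.1 hg) ▸ f.dup.ne _ hk
    exact (congrArg (List.map (Str.single : G.C1 → Str G)) h1).trans h2.symm
  exact (congrArg red e).trans (red_eq (Str.dup (G := q1 G) f.dup).ne)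

theorem Str.dup_counit {G : GrayCat.{u}} (f : Str G) : f.dup.map (q1Counit G) = f := by
  refine Str.ext rfl rfl ?_
  have e : f.dup.l.map (q1Counit G).map1 = f.l := by
    refine (List.map_map).trans ?_
    exact (List.map_congr_left fun k _ => Str.val_single k).trans (List.map_id _)
  exact (congrArg red e).trans (red_eq f.ne)

open CategoryTheory

/-- The comonad `Q¹` on the category of `Gray`-categories. -/
noncomputable def Q1 : Comonad GrayCat.{u} where
  obj G := q1 G
  map F := q1Map F
  map_id G := q1Map_id G
  map_comp F K := q1Map_comp F K
  ε := { app := fun G => q1Counit G, naturality := fun _ _ F => q1Counit_nat F }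
  δ := { app := fun G => q1Comult G, naturality := fun _ _ F => q1Comult_nat F }
  coassoc _ := GrayFunctor.ext rfl (funext Str.dup_dup)
    (funext fun α => Q2.ext rfl (Str.dup_dup (Q2.src α)) (Str.dup_dup (Q2.tgt α)))
    (funext fun Γ => Q3.ext rfl (Str.dup_dup (Q3.src Γ)) (Str.dup_dup (Q3.tgt Γ)))
  left_counit _ := GrayFunctor.ext rfl (funext Str.val_dup) rfl rfl
  right_counit _ := GrayFunctor.ext rfl (funext Str.dup_counit)
    (funext fun α => Q2.ext rfl (Str.dup_counit (Q2.src α)) (Str.dup_counit (Q2.tgt α)))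
    (funext fun Γ => Q3.ext rfl (Str.dup_counit (Q3.src Γ)) (Str.dup_counit (Q3.tgt Γ)))

end GrayCat

/-! ### Horizontal pasting of squares -/

namespace GrayCat

open GrayData GrayData.IsGray

section

variable {H : GrayCat.{u}}

theorem _root_.Path1.s0_bot {g' g : Path1 H} (h : g'.l = g.r) : H.s0 g'.bot = H.t0 g.bot := by
  rw [← g'.t0_l, h, g.t0_r]

theorem _root_.Path1.s0_top {g' g : Path1 H} (h : g'.l = g.r) : H.s0 g'.top = H.t0 g.top := by
  rw [← g'.s0_l, h, g.s0_r]

theorem _root_.Path2.src_l {α' α : Path2 H} (h : α'.a0 = α.a1) : α'.src.l = α.src.r := by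
  rw [← α'.s1_a0, h, α.s1_a1]

theorem _root_.Path2.tgt_l {α' α : Path2 H} (h : α'.a0 = α.a1) : α'.tgt.l = α.tgt.r := by
  rw [← α'.t1_a0, h, α.t1_a1]

theorem _root_.Path3.src_a0 {Γ' Γ : Path3 H} (h : Γ'.G0 = Γ.G1) : Γ'.src.a0 = Γ.src.a1 := by
  rw [← Γ'.s2_G0, h, Γ.s2_G1]

theorem _root_.Path3.tgt_a0 {Γ' Γ : Path3 H} (h : Γ'.G0 = Γ.G1) : Γ'.tgt.a0 = Γ.tgt.a1 := by
  rw [← Γ'.t2_G0, h, Γ.t2_G1]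

/-- Horizontal pasting of the squares `g'` and `g`, where the left side of `g'` is the right side of
`g`. -/
@[simps]
def paste1 (g' g : Path1 H) (h : g'.l = g.r) : Path1 H where
  top := H.c0 g'.top g.top (Path1.s0_top h)
  bot := H.c0 g'.bot g.bot (Path1.s0_bot h)
  l := g.l
  r := g'.r
  sq := H.c1 (H.l2 g'.bot g.sq (by simp [Path1.s0_bot h]))
    (H.r2 g'.sq g.top (by simp [Path1.s0_top h])) (by simp [h, c0_assoc'])
  s0_l := by simp
  t0_l := by simp
  s0_r := by simp
  t0_r := by simp
  s1_sq := by simp [c0_assoc']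
  t1_sq := by simp [c0_assoc']

/-- Horizontal pasting of 2-cells of the path space. -/
@[simps]
def paste2 (α' α : Path2 H) (h : α'.a0 = α.a1) : Path2 H where
  src := paste1 α'.src α.src (Path2.src_l h)
  tgt := paste1 α'.tgt α.tgt (Path2.tgt_l h)
  a0 := α.a0
  a1 := α'.a1
  a3 := H.c2
    (H.h3 (H.i3 (H.l2 α'.src.bot α.tgt.sq (by simp [Path1.s0_bot (Path2.src_l h)])))
      (H.r3 α'.a3 α.src.top (by simp [Path1.s0_top (Path2.src_l h)]))
      (by simp [Path2.tgt_l h, c0_assoc']))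
    (H.h3 (H.l3 α'.src.bot α.a3 (by simp [Path1.s0_bot (Path2.src_l h)]))
      (H.i3 (H.r2 α'.src.sq α.src.top (by simp [Path1.s0_top (Path2.src_l h)])))
      (by simp [Path2.src_l h, c0_assoc']))
    (by simp [h, l2_c1', r2_c1', r2_l2', c1_assoc'])
  top_tgt := by simp
  bot_tgt := by simp
  s1_a0 := by simp
  t1_a0 := by simp
  s1_a1 := by simp
  t1_a1 := by simp
  s2_a3 := by simp [l2_c1', c0_l2', c1_assoc']
  t2_a3 := by simp [r2_c1', r2_c0', c1_assoc']

/-- Horizontal pasting of 3-cells of the path space. -/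
@[simps]
def paste3 (Γ' Γ : Path3 H) (h : Γ'.G0 = Γ.G1) : Path3 H where
  src := paste2 Γ'.src Γ.src (Path3.src_a0 h)
  tgt := paste2 Γ'.tgt Γ.tgt (Path3.tgt_a0 h)
  G0 := Γ.G0
  G1 := Γ'.G1
  src_tgt := by simp
  tgt_tgt := by simp
  s2_G0 := by simp
  t2_G0 := by simp
  s2_G1 := by simp
  t2_G1 := by simp
  cond := by
    have hl := Path2.src_l (Path3.src_a0 h)
    have hr := Path2.tgt_l (Path3.src_a0 h)
    have sb := Path1.s0_bot hl
    have st := Path1.s0_top hl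
    have e1 := c2_h3
      (c2_l3 Γ.cond Γ'.src.src.bot (by simp [sb]) (by simp [sb]) (by simp [sb]))
      (rfl : H.c2 (H.i3 (H.r2 Γ'.src.src.sq Γ.src.src.top (by simp [st])))
        (H.i3 (H.r2 Γ'.src.src.sq Γ.src.src.top (by simp [st]))) (by simp) = _)
      (by simp [hl, c0_assoc']) (by simp [hl, c0_assoc']) (by simp [hl, c0_assoc'])
    have e2 := c2_h3
      (rfl : H.c2 (H.i3 (H.l2 Γ'.src.src.bot Γ.src.tgt.sq (by simp [sb])))
        (H.i3 (H.l2 Γ'.src.src.bot Γ.src.tgt.sq (by simp [sb]))) (by simp) = _)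
      (c2_r3 Γ'.cond Γ.src.src.top (by simp [st]) (by simp [st]) (by simp [st]))
      (by simp [hr, c0_assoc']) (by simp [hl, hr, c0_assoc']) (by simp [hr, c0_assoc'])
    simp [h, h3_assoc', l3_h3', r3_h3', r3_l3', r2_l2', c0_l3', r3_c0'] at e1 e2
    simp [h, h3_assoc', c2_assoc', i3_c1, c0_l3', r3_c0', l3_h3', r3_h3', r3_l3']
    exact (c2_congr rfl e1 _).trans (c2_re e2 _ _ _)

/-- The comparison 2-cell between the two ways of pasting four squares: on the left, the horizontal
pastings are formed first, on the right the vertical ones. -/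
@[simps]
def pasteCocycle (h' h g' g : Path1 H) (hl : h'.l = h.r) (gl : g'.l = g.r) (p' : h'.top = g'.bot)
    (p : h.top = g.bot) : Path2 H where
  src := pathC0 (paste1 h' h hl) (paste1 g' g gl) (by simp [p, p'])
  tgt := paste1 (pathC0 h' g' p') (pathC0 h g p) (by simp [hl, gl])
  a0 := H.i2 (H.c0 h.l g.l (by simp [p]))
  a1 := H.i2 (H.c0 h'.r g'.r (by simp [p']))
  a3 := H.h3
    (H.i3 (H.l2 h'.bot (H.r2 h.sq g.l (by simp [p])) (by simp [Path1.s0_bot hl])))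
    (H.h3 (H.tensor h'.sq g.sq (by simp [p', Path1.s0_bot gl]))
      (H.i3 (H.l2 h'.r (H.r2 g'.sq g.top (by simp [Path1.s0_top gl])) (by simp [p'])))
      (by simp [p', gl, c0_assoc']))
    (by simp [p, hl, gl, c0_assoc'])
  top_tgt := by simp
  bot_tgt := by simp
  s1_a0 := by simp
  t1_a0 := by simp
  s1_a1 := by simp
  t1_a1 := by simp
  s2_a3 := by simp [p, p', gl, l2_c1', r2_c1', r2_c0', c0_l2', r2_l2', c1_assoc']
  t2_a3 := by simp [p, p', hl, gl, l2_c1', r2_c1', r2_c0', c0_l2', r2_l2', c1_assoc']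

end

end GrayCat

/-! ### Pseudo `Gray`-functors -/

namespace GrayCat

/-- A 2-cell of `G`, viewed as a 2-cell of `Q¹ G` between strings of length at most one. -/
noncomputable def cell2 {G : GrayCat.{u}} (α : G.C2) : (q1 G).C2 :=
  (⟨α, Str.single (G.s1 α), Str.single (G.t1 α), by simp, by simp⟩ : Q2 G)

/-- A 3-cell of `G`, viewed as a 3-cell of `Q¹ G`. -/
noncomputable def cell3 {G : GrayCat.{u}} (Γ : G.C3) : (q1 G).C3 :=
  (⟨Γ, Str.single (G.s1 (G.s2 Γ)), Str.single (G.t1 (G.s2 Γ)), by simp, by simp⟩ : Q3 G)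

/-- The identity 2-cell of `g #₀ f`, viewed as a 2-cell `[g, f] ⟶ [g #₀ f]` of `Q¹ G`. -/
noncomputable def kappa {G : GrayCat.{u}} (g f : G.C1) (h : G.s0 g = G.t0 f) : (q1 G).C2 :=
  (⟨G.i2 (G.c0 g f h), (Str.single g).mul (Str.single f) (by simpa using h),
    Str.single (G.c0 g f h), by simp, by simp⟩ : Q2 G)

/-- The pseudo `Gray`-functor `F`, on the pullback of the path space along the projections to the
right and the left side, is horizontal pasting, with the comparison 2-cells `pasteCocycle`. -/
structure IsPasting (H : GrayCat.{u})
    (F : GrayFunctor (q1 (pb (pathD0 H) (pathD1 H))) (path H)) : Prop where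
  map0 : ∀ x : (pb (pathD0 H) (pathD1 H)).C0, F.map0 x = H.c0 x.1.1 x.1.2 x.2
  map1 : ∀ g : (pb (pathD0 H) (pathD1 H)).C1,
    F.map1 (Str.single g) = paste1 g.1.1 g.1.2 g.2
  map2 : ∀ α : (pb (pathD0 H) (pathD1 H)).C2, F.map2 (cell2 α) = paste2 α.1.1 α.1.2 α.2
  map3 : ∀ Γ : (pb (pathD0 H) (pathD1 H)).C3, F.map3 (cell3 Γ) = paste3 Γ.1.1 Γ.1.2 Γ.2
  map_kappa : ∀ (h g : (pb (pathD0 H) (pathD1 H)).C1)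
    (p : (pb (pathD0 H) (pathD1 H)).s0 h = (pb (pathD0 H) (pathD1 H)).t0 g),
    F.map2 (kappa h g p) = pasteCocycle h.1.1 h.1.2 g.1.1 g.1.2 h.2 g.2
      (congrArg (fun x => x.1.1) p) (congrArg (fun x => x.1.2) p)

end GrayCat

/-! ### Internal categories -/

section

open CategoryTheory

/-- An internal category, with object of objects `O`, object of arrows `A`, source `d₀`, target
`d₁`, units `i`, object of composable pairs `P` (a pair `(g, f)` with `d₀ g = d₁ f`), object of
composable triples `T`, and composition `m`. -/
structure IsInternalCategory {C : Type*} [Category* C] {O A P T : C} (d₀ d₁ : A ⟶ O) (i : O ⟶ A)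
    (p₁ p₂ : P ⟶ A) (q₁ q₂ : T ⟶ P) (m : P ⟶ A) : Prop where
  pairs : IsPullback p₁ p₂ d₀ d₁
  triples : IsPullback q₁ q₂ p₂ p₁
  unit_source : i ≫ d₀ = 𝟙 O
  unit_target : i ≫ d₁ = 𝟙 O
  comp_source : m ≫ d₀ = p₂ ≫ d₀
  comp_target : m ≫ d₁ = p₁ ≫ d₁
  unit_comp : pairs.lift (d₁ ≫ i) (𝟙 A) (by simp [unit_source]) ≫ m = 𝟙 A
  comp_unit : pairs.lift (𝟙 A) (d₀ ≫ i) (by simp [unit_target]) ≫ m = 𝟙 A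
  assoc : pairs.lift (q₁ ≫ m) (q₂ ≫ p₂)
      (by rw [Category.assoc, comp_source, ← Category.assoc, triples.w, Category.assoc, pairs.w,
        Category.assoc]) ≫ m =
    pairs.lift (q₁ ≫ p₁) (q₂ ≫ m)
      (by rw [Category.assoc, Category.assoc, comp_target, pairs.w, ← Category.assoc, triples.w,
        Category.assoc]) ≫ m

end

/-- The category of `Gray`-categories and pseudo `Gray`-functors: the co-Kleisli category of the
comonad `Q¹`. -/
abbrev PsGrayCat := CategoryTheory.Cokleisli GrayCat.Q1.{u}

namespace GrayCat

/-- A `Gray`-category as an object of the category of pseudo `Gray`-functors. -/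
abbrev toPs (G : GrayCat.{u}) : PsGrayCat.{u} := .mk Q1 G

/-- A strict `Gray`-functor as a pseudo `Gray`-functor. -/
noncomputable abbrev strict {G K : GrayCat.{u}} (F : GrayFunctor G K) : G.toPs ⟶ K.toPs :=
  .mk ((q1Counit G).comp F)

end GrayCat

/-!
Horizontal pasting of squares is not a strict `Gray`-functor: for four squares, pasting horizontally
first and pasting vertically first differ by an interchanger `h' ⊗ g`. The comparison 2-cells
`pasteCocycle` that arise in this way satisfy the axioms of a pseudo `Gray`-functor: they are
natural for whiskering (`paste2_L2`, `paste2_R2`), normalized (`pasteCocycle_I1_left`,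
`pasteCocycle_I1_right`) and satisfy the cocycle condition (`pasteCocycle_assoc`). Each of these
follows from the naturality and the functoriality of the interchanger, after 3-cells that act on
disjoint parts of a diagram have been exchanged. Moreover the comparison 2-cells are invertible, and
central: since their boundary components are identities, their interchangers with arbitrary 2-cells
have identity components, and a 3-cell of the path space with identity components has equal source
and target (`path3_src_eq_tgt`).

Such data extend to a strict `Gray`-functor on `Q¹` (`PseudoData.Extension.toFunctor`). A string is
sent to the composite of the images of its letters; the comparison 2-cells give an invertible 2-cell
from this composite to the image of the value of the string, and a 2-cell of `Q¹` is sent to the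
conjugate of its image by these. Centrality makes the conjugates compatible with whiskering. In
dimension 3 nothing has to be computed: a 3-cell of the path space is determined by its source, its
target and its two components, and in both components pasting is strict.

Conversely, a strict `Gray`-functor on `Q¹ G` is determined by its values on 0-cells, on the cells
between strings of length at most one, and on the 2-cells `kappa` (`q1_functor_ext`), because every
string is contracted to its value by whiskered `kappa`s. The values of a co-Kleisli composite on
these generators are given by `comp_of_single`, `comp_of_cell2`, `comp_of_cell3` and
`comp_of_kappa`, so that the axioms of an internal category reduce to identities between pasted
cells: the unit and associativity laws of `paste1` and `paste2`, and the corresponding laws of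
`pasteCocycle`, of which associativity is `paste2_pasteCocycle`. Finally, cellwise pullbacks of
strict `Gray`-functors remain pullbacks in the co-Kleisli category, because a pseudo `Gray`-functor
followed by a strict one is the composite of the underlying `Gray`-functors (`comp_strict_of`,
`isPullback_strict`).
-/

/-! ### Functoriality of horizontal pasting -/

namespace GrayCat

open GrayData GrayData.IsGray

variable {H : GrayCat.{u}}

theorem _root_.GrayData.IsGray.h3_c2_h3_i3 {G : GrayData.{u}} [G.IsGray] (Δ Γ : G.C3) (β : G.C2)
    (X : G.C3) (h w p) :
    G.h3 (G.c2 Δ Γ h) (G.h3 (G.i3 β) X w) p =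
      G.h3 (G.c2 (G.h3 Δ (G.i3 β) (by simpa [h] using p)) (G.h3 Γ (G.i3 β) (by simpa using p))
        (by simp [h])) X (by simpa using w) := by
  have e := h3_i3_c2 β Δ Γ h (by simpa using p)
  rw [← h3_assoc' _ _ _ (by simpa using p) (by simpa using w)]
  exact h3_congr e rfl _

theorem paste1_I1 (f' f : H.C1) (h : (pathI1 f').l = (pathI1 f).r) :
    paste1 (pathI1 f') (pathI1 f) h = pathI1 (H.c0 f' f (by simpa using Path1.s0_bot h)) := by
  ext <;> simp

theorem paste2_I2 (g' g : Path1 H) (h : g'.l = g.r) (h' : (pathI2 g').a0 = (pathI2 g).a1) :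
    paste2 (pathI2 g') (pathI2 g) h' = pathI2 (paste1 g' g h) := by
  ext <;> simp [h3_i3_i3]

/-- Horizontal pasting preserves vertical composition of 2-cells, by the interchange law of the hom
2-categories. -/
theorem paste2_C1 (β' β α' α : Path2 H) (hβ : β'.a0 = β.a1) (hα : α'.a0 = α.a1)
    (p' : β'.src = α'.tgt) (p : β.src = α.tgt) (h : (pathC1 β' α' p').a0 = (pathC1 β α p).a1) :
    paste2 (pathC1 β' α' p') (pathC1 β α p) h =
      pathC1 (paste2 β' β hβ) (paste2 α' α hα) (by simp [p, p']) := by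
  have hl := Path2.src_l hα
  have hr := Path2.tgt_l hα
  have hr' := Path2.tgt_l hβ
  have sb := Path1.s0_bot hl
  have st := Path1.s0_top hl
  ext
  all_goals try simp
  -- the 3-cells of `β` and `α'` are whiskered from different sides, so they can be exchanged
  have s1 := swap (H.l3 α'.src.bot β.a3 (by simp [p, sb])) (H.r3 α'.a3 α.src.top (by simp [st]))
    (by simp [p, hr, c0_assoc']) (by simp [p, hr, c0_assoc']) (by simp [p, hr, c0_assoc'])
    (by simp) (by simp [p, hr, c0_assoc', hβ]) (by simp [p, hr, c0_assoc']) (by simp)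
  simp [p, p', sb, st, hl, hr, hα, hβ, c1_assoc', r2_c1', l2_c1', h3_i3_c2, i3_h3_c2, c2_assoc',
      h3_assoc', i3_c1,
    l3_c2', l3_h3', r3_c2', r3_h3', r2_l2', r2_c0', c0_l2', r3_l3', r3_c0', c0_l3'] at s1 ⊢
  exact c2_congr rfl (c2_re s1 _ _ _) _

/-- Naturality of the interchanger of `σ` with the 3-cell `α.a3`, with the interchangers of `σ` with
the boundary components `α.a0` and `α.a1` moved to the other side. -/
theorem tinv_square_nat (σ : H.C2) (α : Path2 H) (p : H.s0 (H.s1 σ) = H.t0 α.src.bot) :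
    H.c2 (H.h3 (H.i3 (H.l2 (H.t1 σ) α.tgt.sq (by simp [p])))
          (H.tinv σ (H.r2 α.a1 α.src.top (by simp)) (by simp [p])) (by simp [p]))
        (H.c2 (H.h3 (H.l3 (H.t1 σ) α.a3 (by simp [p]))
          (H.i3 (H.r2 σ (H.c0 α.src.r α.src.top (by simp)) (by simp [p]))) (by simp [p]))
          (H.h3 (H.i3 (H.l2 (H.t1 σ) (H.l2 α.src.bot α.a0 (by simp)) (by simp [p])))
            (H.tensor σ α.src.sq (by simp [p])) (by simp [p])) (by simp [p,l2_c1', c1_assoc']))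
        (by simp [p, l2_c1', c1_assoc']) =
      H.c2 (H.h3 (H.tensor σ α.tgt.sq (by simp [p]))
          (H.i3 (H.l2 (H.s1 σ) (H.r2 α.a1 α.src.top (by simp)) (by simp [p]))) (by simp [p]))
        (H.c2 (H.h3 (H.i3 (H.r2 σ (H.c0 α.src.bot α.tgt.l (by simp)) (by simp [p])))
            (H.l3 (H.s1 σ) α.a3 (by simp [p])) (by simp [p]))
          (H.h3 (H.tinv σ (H.l2 α.src.bot α.a0 (by simp)) (by simp [p]))
            (H.i3 (H.l2 (H.s1 σ) α.src.sq (by simp [p]))) (by simp [p]))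
              (by simp [p, l2_c1', c1_assoc']))
        (by simp [p, l2_c1', c1_assoc']) := by
  have eA := tensor_nat (H.i3 σ) α.a3 (by simp [p])
  simp only [Path2.t2_a3, Path2.s2_a3, tensor_c1'] at eA
  simp [p, c2_assoc'] at eA
  have e := c2_inv_sq (T' := H.h3 (H.i3 (H.l2 (H.t1 σ) α.tgt.sq (by simp [p])))
          (H.tinv σ (H.r2 α.a1 α.src.top (by simp)) (by simp [p])) (by simp [p]))
      (S' := H.h3 (H.tinv σ (H.l2 α.src.bot α.a0 (by simp)) (by simp [p]))
            (H.i3 (H.l2 (H.s1 σ) α.src.sq (by simp [p]))) (by simp [p]))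
      (a := by simp [p]) (b := by simp [p]) ?_ ?_ ((eA.trans (c2_assoc' _ _ _ ?_ ?_).symm)) ?_ ?_
  · exact e.trans (c2_assoc' _ _ _ _ _)
  · refine (i3_h3_inv (p := by simp) ((tinv_tensor _ _ _).trans (by simp)) _ _ _ _).trans ?_
    simp [p]
  · refine (h3_i3_inv (p := by simp) ((tensor_tinv _ _ _)) _ _ _ _).trans ?_
    simp [p]
  all_goals simp [p, l2_c1', c1_assoc']

/-- The comparison 2-cells are natural with respect to whiskering by squares on the left: this is
the naturality of the interchanger of the square `k'` with the 3-cell of `α`. -/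
theorem paste2_L2 (k' k : Path1 H) (α' α : Path2 H) (hk : k'.l = k.r) (hα : α'.a0 = α.a1)
    (p' : k'.top = α'.src.bot) (p : k.top = α.src.bot)
    (h : (pathL2 k' α' p').a0 = (pathL2 k α p).a1) (q q' q'' r r' r'' r''') :
    pathC1 (paste2 (pathL2 k' α' p') (pathL2 k α p) h)
        (pasteCocycle k' k α'.src α.src hk q p' p) r =
      pathC1 (pasteCocycle k' k α'.tgt α.tgt hk q' r' r'')
        (pathL2 (paste1 k' k hk) (paste2 α' α hα) q'') r''' := by
  have hl := Path2.src_l hα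
  have hr := Path2.tgt_l hα
  have sb := Path1.s0_bot hl
  have st := Path1.s0_top hl
  have kb := Path1.s0_bot hk
  ext
  all_goals try simp [hk, hα, c0_l2', p, p']
  have e1 := h3_congr (rfl : H.i3 (H.l2 k'.bot (H.r2 k.sq α.tgt.l (by simp [p])) (by simp [kb])) =
      _)
    (h3_congr (tinv_square_nat k'.sq α (by simp [p, p', sb]))
      (rfl : H.i3 (H.l2 k'.r (H.r2 α'.src.sq α.src.top (by simp [st])) (by simp [p'])) = _)
        (by simp [p, p', c0_assoc', hl]))
    (by simp [p, kb, c0_assoc', hk, hr])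
  -- two pairs of 3-cells that act on different parts of the diagram are exchanged
  have s1 := h3_congr (swap (H.l3 k'.bot (H.tinv k.sq α.a0 (by simp [p])) (by simp [kb]))
      (H.tensor k'.sq α.src.sq (by simp [p, p', sb]))
    (by simp [p, p', hk, hl, c0_assoc']) (by simp [p, p', hk, hl, c0_assoc'])
      (by simp [p, p', hk, hl, c0_assoc'])
    (by simp) (by simp [p, p', hk, hl, c0_assoc']) (by simp [p, p', hk, hl, c0_assoc']) (by simp))
    (rfl : H.i3 (H.l2 k'.r (H.r2 α'.src.sq α.src.top (by simp [st])) (by simp [p'])) = _)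
      (by simp [p, p', c0_assoc', hl])
  have s2 := h3_congr (rfl : H.i3 (H.l2 k'.bot (H.r2 k.sq α.tgt.l (by simp [p])) (by simp [kb])) =
      _)
    (swap (H.tensor k'.sq α.tgt.sq (by simp [p, p', sb]))
      (H.l3 k'.r (H.r3 α'.a3 α.src.top (by simp [st])) (by simp [p']))
    (by simp [p, p', hk, hr, c0_assoc']) (by simp [p, p', hk, hr, c0_assoc'])
      (by simp [p, p', hk, hr, hα, c0_assoc'])
    (by simp) (by simp [p, p', hk, hr, c0_assoc', hα]) (by simp [p, p', hk, hr, c0_assoc'])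
      (by simp)) (by simp [p, kb, c0_assoc', hk, hr])
  simp [p, p', sb, st, hk, hl, hr, hα, c1_assoc', r2_c1', l2_c1', h3_c2_h3_i3, h3_i3_c2, i3_h3_c2,
      c2_assoc', h3_assoc', i3_c1,
    l3_c2', l3_h3', r3_c2', r3_h3', r2_l2', r2_c0', c0_l2', r3_l3', r3_c0', c0_l3', c1_tinv,
        r2_tinv, l2_tinv, tinv_r2] at e1 s1 s2 ⊢
  exact (c2_congr rfl (c2_congr rfl (c2_congr rfl s1.symm _) _) _).trans
    ((c2_congr rfl (c2_re3 e1 _ _ _ _) _).trans (c2_re s2 _ _ _))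

/-- The comparison 2-cells are natural with respect to whiskering by squares on the right: this is
the naturality of the interchanger of the 3-cell of `β'` with the square `n`. -/
theorem paste2_R2 (β' β : Path2 H) (n' n : Path1 H) (hβ : β'.a0 = β.a1) (hn : n'.l = n.r)
    (p' : β'.src.top = n'.bot) (p : β.src.top = n.bot)
    (h : (pathR2 β' n' p').a0 = (pathR2 β n p).a1) (q q' q'' r r' r'' r''') :
    pathC1 (paste2 (pathR2 β' n' p') (pathR2 β n p) h)
        (pasteCocycle β'.src β.src n' n q hn p' p) r =
      pathC1 (pasteCocycle β'.tgt β.tgt n' n q' hn r' r'')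
        (pathR2 (paste2 β' β hβ) (paste1 n' n hn) q'') r''' := by
  have hl := Path2.src_l hβ
  have hr := Path2.tgt_l hβ
  have sb := Path1.s0_bot hl
  have nb := Path1.s0_bot hn
  have nt := Path1.s0_top hn
  ext
  all_goals try simp [hn, hβ, r2_c0', p, p']
  have eA := tensor_nat β'.a3 (H.i3 n.sq) (by simp [p', nb])
  simp only [Path2.t2_a3, Path2.s2_a3, c1_tensor'] at eA
  have e1 := h3_congr (rfl : H.i3 (H.l2 β'.src.bot (H.r2 β.tgt.sq n.l (by simp [p])) (by simp [sb]))
      = _)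
    (h3_congr eA
      (rfl : H.i3 (H.l2 β'.src.r (H.r2 n'.sq n.top (by simp [nt])) (by simp [p'])) = _)
        (by simp [p, p', c0_assoc', hn, hl]))
    (by simp [p, p', sb, c0_assoc', hn, hr])
  -- two pairs of 3-cells that act on different parts of the diagram are exchanged
  have s1 := h3_congr (swap (H.l3 β'.src.bot (H.r3 β.a3 n.l (by simp [p])) (by simp [sb]))
      (H.tensor β'.src.sq n.sq (by simp [p', nb]))
    (by simp [p, p', hn, hl, c0_assoc']) (by simp [p, p', hn, hl, c0_assoc'])
      (by simp [p, p', hn, hl, c0_assoc'])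
    (by simp) (by simp [p, p', hn, hl, c0_assoc']) (by simp [p, p', hn, hl, c0_assoc']) (by simp))
    (rfl : H.i3 (H.l2 β'.src.r (H.r2 n'.sq n.top (by simp [nt])) (by simp [p'])) = _)
      (by simp [p, p', c0_assoc', hn, hl])
  have s2 := h3_congr (rfl : H.i3 (H.l2 β'.src.bot (H.r2 β.tgt.sq n.l (by simp [p])) (by simp [sb]))
      = _)
    (swap (H.tensor β'.tgt.sq n.sq (by simp [p', nb])) (H.r3 (H.tensor β'.a1 n'.sq (by simp [p']))
      n.top (by simp [nt]))
    (by simp [p, p', hn, hr, c0_assoc']) (by simp [p, p', hn, hr, c0_assoc'])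
      (by simp [p, p', hn, hr, hβ, c0_assoc'])
    (by simp) (by simp [p, p', hn, hr, c0_assoc', hβ]) (by simp [p, p', hn, hr, c0_assoc'])
      (by simp)) (by simp [p, p', sb, c0_assoc', hn, hr])
  simp [p, p', sb, nb, nt, hn, hl, hr, hβ, c1_assoc', r2_c1', l2_c1', h3_c2_h3_i3, h3_i3_c2,
      i3_h3_c2, c2_assoc', h3_assoc', i3_c1,
    l3_c2', l3_h3', r3_c2', r3_h3', r2_l2', r2_c0', c0_l2', r3_l3', r3_c0', c0_l3', tensor_c1',
        r2_tensor', l2_tensor', tensor_r2'] at e1 s1 s2 ⊢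
  exact (c2_congr rfl (c2_congr rfl (c2_congr rfl s1.symm _) _) _).trans
    ((c2_congr rfl (c2_re3 e1.symm _ _ _ _) _).trans (c2_re s2 _ _ _))

theorem paste1_assoc (h g f : Path1 H) (p : h.l = g.r) (a : (paste1 h g p).l = f.r) :
    paste1 (paste1 h g p) f a = paste1 h (paste1 g f (by simpa using a)) (by simpa using p) := by
  have q : g.l = f.r := by simpa using a
  have h1 := Path1.s0_bot p
  have h2 := Path1.s0_bot q
  have h3 := Path1.s0_top p
  have h4 := Path1.s0_top q
  ext <;> simp [p, q, h1, h2, h3, h4, c0_assoc', l2_c1', r2_c1', c1_assoc', r2_c0', c0_l2', r2_l2']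

theorem paste2_assoc (h g f : Path2 H) (p : h.a0 = g.a1) (a : (paste2 h g p).a0 = f.a1) :
    paste2 (paste2 h g p) f a = paste2 h (paste2 g f (by simpa using a)) (by simpa using p) := by
  have q : g.a0 = f.a1 := by simpa using a
  have p1 := Path2.src_l p
  have q1 := Path2.src_l q
  have p2 := Path2.tgt_l p
  have q2 := Path2.tgt_l q
  have h1 := Path1.s0_bot p1
  have h2 := Path1.s0_bot q1
  have h3 := Path1.s0_top p1
  have h4 := Path1.s0_top q1
  refine Path2.ext (by simp [paste1_assoc]) (by simp [paste1_assoc]) rfl rfl ?_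
  simp [p, q, p1, q1, p2, q2, h1, h2, h3, h4, c1_assoc', r2_c1', l2_c1', h3_c2_h3_i3, h3_i3_c2,
      i3_h3_c2, c2_assoc', h3_assoc', i3_c1,
    l3_c2', l3_h3', r3_c2', r3_h3', r2_l2', r2_c0', c0_l2', r3_l3', r3_c0', c0_l3', c0_assoc']

/-- The cocycle condition for three rows of two squares, which follows from the functoriality of the
interchanger. -/
theorem pasteCocycle_assoc (h' h g' g f' f : Path1 H) (hl : h'.l = h.r) (gl : g'.l = g.r)
    (fl : f'.l = f.r) (p' : h'.top = g'.bot) (p : h.top = g.bot) (q' : g'.top = f'.bot)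
    (q : g.top = f.bot) (a1 a2 a3 a4 b1 b2 b3 b4 c1 c2) :
    pathC1 (pasteCocycle (pathC0 h' g' p') (pathC0 h g p) f' f a1 fl a2 a3)
        (pathR2 (pasteCocycle h' h g' g hl gl p' p) (paste1 f' f fl) a4) c1 =
      pathC1 (pasteCocycle h' h (pathC0 g' f' q') (pathC0 g f q) hl b1 b2 b3)
        (pathL2 (paste1 h' h hl) (pasteCocycle g' g f' f gl fl q' q) b4) c2 := by
  have hb := Path1.s0_bot hl
  have gb := Path1.s0_bot gl
  have fb := Path1.s0_bot fl
  have ft := Path1.s0_top fl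
  refine Path2.ext (by simp [pathC0_assoc]) (by simp [pathC0_assoc]) ?_ ?_ ?_
  all_goals try simp [hl, gl, fl, p, p', q, q', c0_assoc', h3_i3_i3]
  -- the interchangers of the first and the last pair of rows act on different squares
  have s1 := h3_congr (rfl : H.i3 (H.l2 h'.bot (H.r2 h.sq (H.c0 g.l f.l (by simp [q]))
      (by simp [p])) (by simp [hb])) = _)
    (h3_congr (swap (H.r3 (H.tensor h'.sq g.sq (by simp [p', gb])) f.l (by simp [q]))
        (H.l3 h'.r (H.tensor g'.sq f.sq (by simp [q', fb])) (by simp [p']))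
      (by simp [p, p', q, q', hl, gl, fl, c0_assoc'])
        (by simp [p, p', q, q', hl, gl, fl, c0_assoc'])
      (by simp [p, p', q, q', hl, gl, fl, c0_assoc']) (by simp)
      (by simp [p, p', q, q', hl, gl, fl, c0_assoc'])
        (by simp [p, p', q, q', hl, gl, fl, c0_assoc']) (by simp))
      (rfl : H.i3 (H.l2 (H.c0 h'.r g'.r (by simp [p'])) (H.r2 f'.sq f.top (by simp [ft]))
        (by simp [q'])) = _)
      (by simp [p, p', q, q', hl, gl, fl, c0_assoc']))
    (by simp [p, p', q, q', hl, gl, fl, hb, c0_assoc'])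
  simp [p, p', q, q', hl, gl, fl, hb, gb, fb, ft, c1_assoc', r2_c1', l2_c1', h3_c2_h3_i3, h3_i3_c2,
      i3_h3_c2, c2_assoc', h3_assoc', i3_c1,
    l3_c2', l3_h3', r3_c2', r3_h3', r2_l2', r2_c0', c0_l2', r3_l3', r3_c0', c0_l3', tensor_c1',
        c1_tensor', r2_tensor', l2_tensor', tensor_r2'] at s1 ⊢
  exact c2_congr rfl s1 _

/-- For two rows of three squares, the comparison 2-cells are compatible with the associativity of
horizontal pasting. -/
theorem paste2_pasteCocycle (h'' h' h g'' g' g : Path1 H) (hl' : h''.l = h'.r) (hl : h'.l = h.r)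
    (gl' : g''.l = g'.r) (gl : g'.l = g.r) (p'' : h''.top = g''.bot) (p' : h'.top = g'.bot)
    (p : h.top = g.bot) (a1 a2 a3 a4 a5 b1 b2 b3 b4 b5 c1 c2) :
    pathC1 (paste2 (pasteCocycle h'' h' g'' g' hl' gl' p'' p') (pathI2 (pathC0 h g p)) a1)
        (pasteCocycle (paste1 h'' h' hl') h (paste1 g'' g' gl') g a2 a3 a4 a5) c1 =
      pathC1 (paste2 (pathI2 (pathC0 h'' g'' p'')) (pasteCocycle h' h g' g hl gl p' p) b1)
        (pasteCocycle h'' (paste1 h' h hl) g'' (paste1 g' g gl) b2 b3 b4 b5) c2 := by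
  have hb := Path1.s0_bot hl
  have gb := Path1.s0_bot gl
  have hb' := Path1.s0_bot hl'
  have gb' := Path1.s0_bot gl'
  have gt := Path1.s0_top gl
  have gt' := Path1.s0_top gl'
  refine Path2.ext (by simp [paste1_assoc]) (by simp [paste1_assoc]) ?_ ?_ ?_
  all_goals try simp [hl, gl, hl', gl', p, p', p'', h3_i3_i3]
  -- the interchangers of the first and the last pair of columns act on different squares
  have s1 := h3_congr (rfl : H.i3 (H.l2 h''.bot (H.l2 h'.bot (H.r2 h.sq g.l (by simp [p]))
      (by simp [hb])) (by simp [hb'])) = _)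
    (h3_congr (swap (H.l3 h''.bot (H.tensor h'.sq g.sq (by simp [p', gb])) (by simp [hb']))
        (H.r3 (H.tensor h''.sq g'.sq (by simp [p'', gb'])) g.top (by simp [gt]))
      (by simp [p, p', p'', hl, gl, hl', gl', c0_assoc'])
        (by simp [p, p', p'', hl, gl, hl', gl', c0_assoc'])
      (by simp [p, p', p'', hl, gl, hl', gl', c0_assoc']) (by simp)
      (by simp [p, p', p'', hl, gl, hl', gl', c0_assoc'])
        (by simp [p, p', p'', hl, gl, hl', gl', c0_assoc']) (by simp))
      (rfl : H.i3 (H.l2 h''.r (H.r2 (H.r2 g''.sq g'.top (by simp [gt'])) g.top (by simp [gt]))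
        (by simp [p''])) = _)
      (by simp [p, p', p'', hl, gl, hl', gl', c0_assoc']))
    (by simp [p, p', p'', hl, gl, hl', gl', hb, hb', c0_assoc'])
  simp [p, p', p'', hl, gl, hl', gl', hb, gb, hb', gb', gt, gt', c1_assoc', r2_c1', l2_c1',
      h3_c2_h3_i3, h3_i3_c2, i3_h3_c2, c2_assoc', h3_assoc', i3_c1,
    l3_c2', l3_h3', r3_c2', r3_h3', r2_l2', r2_c0', c0_l2', r3_l3', r3_c0', c0_l3', tensor_c1',
        c1_tensor', r2_tensor', l2_tensor', tensor_r2'] at s1 ⊢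
  exact c2_re s1 _ _ _

/-- The inverse of `pasteCocycle`: the interchanger is replaced by its inverse. -/
@[simps]
def pasteCocycleInv (h' h g' g : Path1 H) (hl : h'.l = h.r) (gl : g'.l = g.r) (p' : h'.top = g'.bot)
    (p : h.top = g.bot) : Path2 H where
  src := paste1 (pathC0 h' g' p') (pathC0 h g p) (by simp [hl, gl])
  tgt := pathC0 (paste1 h' h hl) (paste1 g' g gl) (by simp [p, p'])
  a0 := H.i2 (H.c0 h.l g.l (by simp [p]))
  a1 := H.i2 (H.c0 h'.r g'.r (by simp [p']))
  a3 := H.h3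
    (H.i3 (H.l2 h'.bot (H.r2 h.sq g.l (by simp [p])) (by simp [Path1.s0_bot hl])))
    (H.h3 (H.tinv h'.sq g.sq (by simp [p', Path1.s0_bot gl]))
      (H.i3 (H.l2 h'.r (H.r2 g'.sq g.top (by simp [Path1.s0_top gl])) (by simp [p'])))
      (by simp [p', gl, c0_assoc']))
    (by simp [p, hl, gl, c0_assoc'])
  top_tgt := by simp
  bot_tgt := by simp
  s1_a0 := by simp
  t1_a0 := by simp
  s1_a1 := by simp
  t1_a1 := by simp
  s2_a3 := by simp [p, p', hl, gl, l2_c1', r2_c1', r2_c0', c0_l2', r2_l2', c1_assoc']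
  t2_a3 := by simp [p, p', hl, gl, l2_c1', r2_c1', r2_c0', c0_l2', r2_l2', c1_assoc']

theorem pasteCocycle_inv (h' h g' g : Path1 H) (hl : h'.l = h.r) (gl : g'.l = g.r)
    (p' : h'.top = g'.bot) (p : h.top = g.bot) (r) :
    pathC1 (pasteCocycle h' h g' g hl gl p' p) (pasteCocycleInv h' h g' g hl gl p' p) r =
      pathI2 (paste1 (pathC0 h' g' p') (pathC0 h g p) (by simp [hl, gl])) := by
  refine Path2.ext rfl rfl (by simp) (by simp) ?_
  have gb := Path1.s0_bot gl
  have hb := Path1.s0_bot hl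
  have e := i3_h3_inv (h3_i3_inv (tensor_tinv h'.sq g.sq (by simp [p', gb]))
    (H.l2 h'.r (H.r2 g'.sq g.top (by simp [Path1.s0_top gl])) (by simp [p']))
    (by simp [p', gl, c0_assoc']) (by simp [p', gl, c0_assoc']) (by simp))
    (H.l2 h'.bot (H.r2 h.sq g.l (by simp [p])) (by simp [hb]))
    (by simp [p, p', hl, gl, c0_assoc']) (by simp [p, p', hl, gl, c0_assoc']) (by simp)
  simp [p, p', hl, gl, gb, hb] at e ⊢
  rw [e]
  simp [p, p', hl, gl, l2_c1', r2_c1', r2_c0', c0_l2', r2_l2', c1_assoc']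

theorem pasteCocycleInv_comp (h' h g' g : Path1 H) (hl : h'.l = h.r) (gl : g'.l = g.r)
    (p' : h'.top = g'.bot) (p : h.top = g.bot) (r) :
    pathC1 (pasteCocycleInv h' h g' g hl gl p' p) (pasteCocycle h' h g' g hl gl p' p) r =
      pathI2 (pathC0 (paste1 h' h hl) (paste1 g' g gl) (by simp [p, p'])) := by
  refine Path2.ext rfl rfl (by simp) (by simp) ?_
  have gb := Path1.s0_bot gl
  have hb := Path1.s0_bot hl
  have e := i3_h3_inv (h3_i3_inv ((tinv_tensor h'.sq g.sq (by simp [p', gb])).trans (by simp))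
    (H.l2 h'.r (H.r2 g'.sq g.top (by simp [Path1.s0_top gl])) (by simp [p']))
    (by simp [p', gl, c0_assoc']) (by simp [p', gl, c0_assoc']) (by simp))
    (H.l2 h'.bot (H.r2 h.sq g.l (by simp [p])) (by simp [hb]))
    (by simp [p, p', hl, gl, c0_assoc']) (by simp [p, p', hl, gl, c0_assoc']) (by simp)
  simp [p, p', hl, gl, gb, hb] at e ⊢
  rw [e]
  simp [p, p', hl, gl, l2_c1', r2_c1', r2_c0', c0_l2', r2_l2', c1_assoc']

theorem pasteCocycle_I1_left (x' x : H.C1) (g' g : Path1 H) (hl) (gl) (p') (p) :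
    pasteCocycle (pathI1 x') (pathI1 x) g' g hl gl p' p = pathI2 (paste1 g' g gl) := by
  simp at hl p' p
  subst p' p
  refine Path2.ext ?_ ?_ ?_ ?_ ?_ <;> simp [h3_i3_i3, pathC0_I1, paste1_I1, pathI1_C0, hl, gl]

theorem pasteCocycle_I1_right (x' x : H.C1) (g' g : Path1 H) (hl) (gl) (p') (p) :
    pasteCocycle g' g (pathI1 x') (pathI1 x) hl gl p' p = pathI2 (paste1 g' g hl) := by
  simp at gl p' p
  subst p' p
  refine Path2.ext ?_ ?_ ?_ ?_ ?_ <;> simp [h3_i3_i3, pathC0_I1, paste1_I1, pathI1_C0, hl, gl]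

theorem pathUnit1_paste1 (f : H.C1) (g : Path1 H) (h : (pathUnit1 f).l = g.r) :
    paste1 (pathUnit1 f) g h = g := by
  simp at h; subst h
  ext <;> simp

theorem paste1_pathUnit1 (f : H.C1) (g : Path1 H) (h : g.l = (pathUnit1 f).r) :
    paste1 g (pathUnit1 f) h = g := by
  simp at h; subst h
  ext <;> simp

theorem pathUnit2_paste2 (f : H.C2) (g : Path2 H) (h : (pathUnit2 f).a0 = g.a1) :
    paste2 (pathUnit2 f) g h = g := by
  simp at h; subst h
  refine Path2.ext ?_ ?_ ?_ ?_ ?_ <;> simp [pathUnit1_paste1, h3_i3_i3]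

theorem paste2_pathUnit2 (f : H.C2) (g : Path2 H) (h : g.a0 = (pathUnit2 f).a1) :
    paste2 g (pathUnit2 f) h = g := by
  simp at h; subst h
  refine Path2.ext ?_ ?_ ?_ ?_ ?_ <;> simp [paste1_pathUnit1, h3_i3_i3]

theorem pasteCocycle_pathUnit1_left (k l : H.C1) (h g : Path1 H) (hl gl p' p) :
    pasteCocycle (pathUnit1 k) h (pathUnit1 l) g hl gl p' p = pathI2 (pathC0 h g p) := by
  simp at hl gl p'; subst hl gl
  refine Path2.ext ?_ ?_ ?_ ?_ ?_ <;> simp [h3_i3_i3, pathUnit1_paste1, p]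
  ext <;> simp [p]

theorem pasteCocycle_pathUnit1_right (k l : H.C1) (h g : Path1 H) (hl gl p' p) :
    pasteCocycle h (pathUnit1 k) g (pathUnit1 l) hl gl p' p = pathI2 (pathC0 h g p') := by
  simp at hl gl p'; subst hl gl
  refine Path2.ext ?_ ?_ ?_ ?_ ?_ <;> simp [h3_i3_i3, paste1_pathUnit1, p']
  ext <;> simp [p']

/-- A 3-cell of the path space whose components are identities can only have equal source and
target. -/
theorem path3_src_eq_tgt (Γ : Path3 H) (h0 : Γ.G0 = H.i3 Γ.src.a0) (h1 : Γ.G1 = H.i3 Γ.src.a1) :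
    Γ.src = Γ.tgt := by
  refine Path2.ext Γ.src_tgt.symm Γ.tgt_tgt.symm ?_ ?_ ?_
  · simpa using (congrArg H.t2 h0).symm
  · simpa using (congrArg H.t2 h1).symm
  · simpa [h0, h1, h3_i3_i3] using Γ.cond.symm

/-- The interchanger of `μ` and `α` has identity components if `μ` has, so that its source and
target agree. -/
theorem path_interchange_left (μ α : Path2 H) (p : μ.src.top = α.src.bot)
    (h0 : μ.a0 = H.i2 μ.src.l) (h1 : μ.a1 = H.i2 μ.src.r) :
    pathC1 (pathR2 μ α.tgt (by simp [p])) (pathL2 μ.src α p) (by simp) =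
      pathC1 (pathL2 μ.tgt α (by simp [p])) (pathR2 μ α.src p) (by simp) :=
  path3_src_eq_tgt (pathTensor μ α p) (by simp [h0, p]) (by simp [h1, p])

theorem path_interchange_right (β μ : Path2 H) (p : β.src.top = μ.src.bot)
    (h0 : μ.a0 = H.i2 μ.src.l) (h1 : μ.a1 = H.i2 μ.src.r) :
    pathC1 (pathR2 β μ.tgt (by simp [p])) (pathL2 β.src μ p) (by simp) =
      pathC1 (pathL2 β.tgt μ (by simp [p])) (pathR2 β μ.src p) (by simp) := by
  have e0 : μ.tgt.l = μ.src.l := by simpa using congrArg H.t1 h0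
  have e1 : μ.tgt.r = μ.src.r := by simpa using congrArg H.t1 h1
  exact path3_src_eq_tgt (pathTensor β μ p) (by simp [h0, e0, p]) (by simp [h1, e1, p])

end GrayCat

/-! ### Central and invertible 2-cells, and comparison 2-cells of strings -/

namespace GrayData

open IsGray

variable {G : GrayData.{u}} [G.IsGray]

theorem IsGray.c1_congr {A B C D : G.C2} (h : A = C) (h' : B = D) (p) :
    G.c1 A B p = G.c1 C D (by rw [← h, ← h', p]) := by subst h; subst h'; rfl

theorem IsGray.l2_congr {A B : G.C2} (h : A = B) (g : G.C1) (p) :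
    G.l2 g A p = G.l2 g B (by rw [← h, p]) := by subst h; rfl

theorem IsGray.r2_congr {A B : G.C2} (h : A = B) (f : G.C1) (p) :
    G.r2 A f p = G.r2 B f (by rw [← h, p]) := by subst h; rfl

/-- An equation between composites of two 2-cells, composed with a further 2-cell on the right. -/
theorem IsGray.c1_re {A B C D : G.C2} {p q} (h : G.c1 A B p = G.c1 C D q) (X : G.C2)
    (hx : G.s1 B = G.t1 X) (p') :
    G.c1 A (G.c1 B X hx) p' = G.c1 C (G.c1 D X
      (by simpa [hx] using (congrArg G.s1 h).symm)) (by simpa using q) := by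
  have h1 := c1_assoc A B X p hx
  have h2 := c1_assoc C D X q (by simpa [hx] using (congrArg G.s1 h).symm)
  rw [← h1, ← h2]
  exact c1_congr h rfl _

/-- A 2-cell `μ` is central if the two composites of `μ` with a 2-cell along a 0-cell, which in
general differ by an interchanger, are equal. -/
structure IsCentral (G : GrayData.{u}) (μ : G.C2) : Prop where
  left : ∀ (α : G.C2) (h : G.s0 (G.s1 μ) = G.t0 (G.s1 α)),
    G.c1 (G.r2 μ (G.t1 α) (by simp [h])) (G.l2 (G.s1 μ) α h) (by simp) =
      G.c1 (G.l2 (G.t1 μ) α (by simp [h])) (G.r2 μ (G.s1 α) h) (by simp)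
  right : ∀ (β : G.C2) (h : G.s0 (G.s1 β) = G.t0 (G.s1 μ)),
    G.c1 (G.r2 β (G.t1 μ) (by simp [h])) (G.l2 (G.s1 β) μ h) (by simp) =
      G.c1 (G.l2 (G.t1 β) μ (by simp [h])) (G.r2 β (G.s1 μ) h) (by simp)

theorem isCentral_i2 (f : G.C1) : G.IsCentral (G.i2 f) := ⟨by simp, by simp⟩

theorem IsCentral.l2 {μ : G.C2} (hμ : G.IsCentral μ) (g : G.C1) (p) : G.IsCentral (G.l2 g μ p) := by
  refine ⟨fun α h => ?_, fun β h => ?_⟩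
  · simp at h
    have e := hμ.left α h
    simp [r2_l2', c0_l2', ← l2_c1', h, p, e]
  · simp at h
    have e := hμ.right (G.r2 β g h) (by simp [p])
    simpa [r2_c0', c0_l2'] using e

theorem IsCentral.r2 {μ : G.C2} (hμ : G.IsCentral μ) (f : G.C1) (p) : G.IsCentral (G.r2 μ f p) := by
  refine ⟨fun α h => ?_, fun β h => ?_⟩
  · simp at h
    have e := hμ.left (G.l2 f α h) (by simp [p])
    simpa [r2_c0', c0_l2'] using e
  · simp at h
    have e := hμ.right β h
    simp [← r2_l2', r2_c0', ← r2_c1', h, p, e]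

theorem IsCentral.c1 {μ ν : G.C2} (hμ : G.IsCentral μ) (hν : G.IsCentral ν) (p) :
    G.IsCentral (G.c1 μ ν p) := by
  refine ⟨fun α h => ?_, fun β h => ?_⟩
  · simp at h
    have e := hμ.left α (by simp [p, h])
    have e' := hν.left α h
    simp [p] at e
    simp [r2_c1', c1_assoc']
    exact (c1_congr rfl e' _).trans (c1_re e _ _ _)
  · simp at h
    have e := hμ.right β (by simp [p, h])
    have e' := hν.right β h
    simp [p] at e
    simp [l2_c1', c1_assoc']
    exact (c1_re e _ _ _).trans (c1_congr rfl e' _)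

/-- The 2-cells `μ` and `ν` are inverse to each other. -/
structure IsInv (G : GrayData.{u}) (μ ν : G.C2) : Prop where
  s1 : G.s1 μ = G.t1 ν
  t1 : G.s1 ν = G.t1 μ
  comp : G.c1 μ ν s1 = G.i2 (G.t1 μ)
  comp' : G.c1 ν μ t1 = G.i2 (G.s1 μ)

theorem isInv_i2 (f : G.C1) : G.IsInv (G.i2 f) (G.i2 f) :=
  ⟨by simp, by simp, by simp, by simp⟩

theorem IsInv.l2 {μ ν : G.C2} (h : G.IsInv μ ν) (g : G.C1) (p q) :
    G.IsInv (G.l2 g μ p) (G.l2 g ν q) :=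
  ⟨by simp [h.s1], by simp [h.t1], (l2_c1 g μ ν q h.s1).symm.trans (by simp [h.comp]),
    (l2_c1 g ν μ p h.t1).symm.trans (by simp [h.comp'])⟩

theorem IsInv.r2 {μ ν : G.C2} (h : G.IsInv μ ν) (f : G.C1) (p q) :
    G.IsInv (G.r2 μ f p) (G.r2 ν f q) :=
  ⟨by simp [h.s1], by simp [h.t1], (r2_c1 μ ν f h.s1 q).symm.trans (by simp [h.comp]),
    (r2_c1 ν μ f h.t1 p).symm.trans (by simp [h.comp'])⟩

theorem IsInv.cancel {μ ν : G.C2} (h : G.IsInv μ ν) (X : G.C2) (p : G.s1 ν = G.t1 X) :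
    G.c1 μ (G.c1 ν X p) (by simpa using h.s1) = X := by
  rw [← c1_assoc _ _ _ h.s1 p]
  exact (c1_congr h.comp rfl _).trans (i2_c1 _ _ _)

theorem IsInv.symm {μ ν : G.C2} (h : G.IsInv μ ν) : G.IsInv ν μ :=
  ⟨h.t1, h.s1, by rw [h.comp', h.s1], by rw [h.comp, h.t1]⟩

theorem IsInv.c1 {μ ν μ' ν' : G.C2} (h : G.IsInv μ ν) (h' : G.IsInv μ' ν') (p q) :
    G.IsInv (G.c1 μ μ' p) (G.c1 ν' ν q) where
  s1 := by simp [h'.s1]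
  t1 := by simp [h.t1]
  comp := by
    simp only [c1_assoc', t1_c1]
    exact (c1_congr rfl (h'.cancel ν q) _).trans h.comp
  comp' := by
    simp only [c1_assoc', s1_c1]
    exact (c1_congr rfl (h.symm.cancel μ' p) _).trans h'.comp'

theorem IsInv.unique {μ ν ν' : G.C2} (h : G.IsInv μ ν) (h' : G.IsInv μ ν') : ν = ν' := by
  have e := h.symm.cancel ν' (by rw [← h'.s1])
  exact ((c1_congr rfl h'.comp _).trans (c1_i2 _ _ _)).symm.trans e

end GrayData

namespace GrayCat

open GrayData GrayData.IsGray

/-- The 0-, 1- and 2-dimensional data of a pseudo `Gray`-functor whose comparison 2-cells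
`mu g f : map1 g #₀ map1 f ⟶ map1 (g #₀ f)` are invertible and central. It is strict on identities
and on vertical composites of 2-cells; `mu` is normalized, natural for whiskering by 1-cells, and
satisfies the cocycle condition. -/
structure PseudoData (G K : GrayCat.{u}) where
  map0 : G.C0 → K.C0
  map1 : G.C1 → K.C1
  map2 : G.C2 → K.C2
  s0_map : ∀ f, K.s0 (map1 f) = map0 (G.s0 f)
  t0_map : ∀ f, K.t0 (map1 f) = map0 (G.t0 f)
  s1_map : ∀ α, K.s1 (map2 α) = map1 (G.s1 α)
  t1_map : ∀ α, K.t1 (map2 α) = map1 (G.t1 α)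
  map_i1 : ∀ x, map1 (G.i1 x) = K.i1 (map0 x)
  map_i2 : ∀ f, map2 (G.i2 f) = K.i2 (map1 f)
  map_c1 : ∀ β α h, map2 (G.c1 β α h) = K.c1 (map2 β) (map2 α) (by rw [s1_map, t1_map, h])
  mu : (g f : G.C1) → G.s0 g = G.t0 f → K.C2
  muInv : (g f : G.C1) → G.s0 g = G.t0 f → K.C2
  isInv : ∀ g f h, K.IsInv (mu g f h) (muInv g f h)
  central : ∀ g f h, K.IsCentral (mu g f h)
  s1_mu : ∀ g f h, K.s1 (mu g f h) = K.c0 (map1 g) (map1 f) (by rw [s0_map, t0_map, h])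
  t1_mu : ∀ g f h, K.t1 (mu g f h) = map1 (G.c0 g f h)
  i1_mu : ∀ x f h, mu (G.i1 x) f h = K.i2 (map1 f)
  mu_i1 : ∀ f x h, mu f (G.i1 x) h = K.i2 (map1 f)
  mu_l2 : ∀ g α h, K.c1 (map2 (G.l2 g α h)) (mu g (G.s1 α) h) (by rw [s1_map, t1_mu, G.s1_l2]) =
    K.c1 (mu g (G.t1 α) (by simp [h]))
        (K.l2 (map1 g) (map2 α) (by simp [s0_map, s1_map, t0_map, h]))
      (by simp [s1_mu, t1_map])
  mu_r2 : ∀ α f h, K.c1 (map2 (G.r2 α f h)) (mu (G.s1 α) f h) (by rw [s1_map, t1_mu, G.s1_r2]) =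
    K.c1 (mu (G.t1 α) f (by simp [h]))
        (K.r2 (map2 α) (map1 f) (by simp [s0_map, s1_map, t0_map, h]))
      (by simp [s1_mu, t1_map])
  mu_assoc : ∀ h g f p q, K.c1 (mu (G.c0 h g p) f (by simp [q])) (K.r2 (mu h g p) (map1 f)
        (by simp [s1_mu, s0_map, t0_map, q])) (by simp [s1_mu, t1_mu]) =
    K.c1 (mu h (G.c0 g f q) (by simp [p])) (K.l2 (map1 h) (mu g f q)
        (by simp [s1_mu, s0_map, t0_map, p])) (by simp [s1_mu, t1_mu])

namespace PseudoData

attribute [simp] s0_map t0_map s1_map t1_map map_i1 map_i2 map_c1 s1_mu t1_mu i1_mu mu_i1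

variable {G K : GrayCat.{u}} (D : PseudoData G K)

/-- A 1-cell of `K` together with an invertible central 2-cell to `D.map1 f`. -/
@[ext]
structure Resolution (f : G.C1) where
  cell : K.C1
  cmp : K.C2
  inv : K.C2
  s1_cmp : K.s1 cmp = cell
  t1_cmp : K.t1 cmp = D.map1 f
  isInv : K.IsInv cmp inv
  central : K.IsCentral cmp

attribute [simp] Resolution.s1_cmp Resolution.t1_cmp

variable {D}

namespace Resolution

@[simp]
theorem s0_cell {f : G.C1} (r : D.Resolution f) : K.s0 r.cell = D.map0 (G.s0 f) := by
  rw [← r.s1_cmp, ← K.s0_t1, r.t1_cmp, D.s0_map]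

@[simp]
theorem t0_cell {f : G.C1} (r : D.Resolution f) : K.t0 r.cell = D.map0 (G.t0 f) := by
  rw [← r.s1_cmp, ← K.t0_t1, r.t1_cmp, D.t0_map]

@[simp] theorem s1_inv {f : G.C1} (r : D.Resolution f) : K.s1 r.inv = D.map1 f := by
  rw [r.isInv.t1, r.t1_cmp]

@[simp] theorem t1_inv {f : G.C1} (r : D.Resolution f) : K.t1 r.inv = r.cell := by
  rw [← r.isInv.s1, r.s1_cmp]

theorem ext' {f : G.C1} {r r' : D.Resolution f} (h : r.cmp = r'.cmp) : r = r' := by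
  have h' := r.isInv
  rw [h] at h'
  exact Resolution.ext (by rw [← r.s1_cmp, h, r'.s1_cmp]) h (h'.unique r'.isInv)

variable (D) in
/-- The trivial resolution of a 1-cell. -/
@[simps]
def refl (f : G.C1) : D.Resolution f where
  cell := D.map1 f
  cmp := K.i2 (D.map1 f)
  inv := K.i2 (D.map1 f)
  s1_cmp := by simp
  t1_cmp := by simp
  isInv := isInv_i2 _
  central := isCentral_i2 _

/-- The composite of two resolutions. -/
@[simps]
def mul {g f : G.C1} (r : D.Resolution g) (r' : D.Resolution f) (h : G.s0 g = G.t0 f) :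
    D.Resolution (G.c0 g f h) where
  cell := K.c0 r.cell r'.cell (by simp [h])
  cmp := K.c1 (D.mu g f h) (K.c1 (K.r2 r.cmp (D.map1 f) (by simp [h]))
    (K.l2 r.cell r'.cmp (by simp [h])) (by simp)) (by simp)
  inv := K.c1 (K.c1 (K.l2 r.cell r'.inv (by simp [h])) (K.r2 r.inv (D.map1 f) (by simp [h]))
    (by simp)) (D.muInv g f h) (by simp [← (D.isInv g f h).s1])
  s1_cmp := by simp
  t1_cmp := by simp
  isInv := (D.isInv g f h).c1 ((r.isInv.r2 _ _ _).c1 (r'.isInv.l2 _ _ _) _ _) _ _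
  central := (D.central g f h).c1 ((r.central.r2 _ _).c1 (r'.central.l2 _ _) _) _

/-- Composition of resolutions is associative, by the cocycle condition and the centrality of the
comparison 2-cells. -/
theorem mul_assoc_cmp {h g f : G.C1} (a : D.Resolution h) (b : D.Resolution g)
    (c : D.Resolution f) (p : G.s0 h = G.t0 g) (q : G.s0 g = G.t0 f) :
    ((a.mul b p).mul c (by simp [q])).cmp = (a.mul (b.mul c q) (by simp [p])).cmp := by
  have e1 := D.mu_assoc h g f p q
  have e2 := a.central.left (D.mu g f q) (by simp [p])
  simp [p, q, r2_c0', r2_c1', l2_c1', c1_assoc', c0_l2', r2_l2'] at e1 e2 ⊢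
  refine (c1_re e1 _ _ _).trans (c1_congr rfl ?_ _)
  exact (c1_re e2.symm _ _ _)

theorem refl_mul_cmp {f : G.C1} (a : D.Resolution f) (x : G.C0) (h : G.s0 (G.i1 x) = G.t0 f) :
    ((refl D (G.i1 x)).mul a h).cmp = a.cmp := by
  simp at h
  subst h
  simp

theorem mul_refl_cmp {f : G.C1} (a : D.Resolution f) (x : G.C0) (h : G.s0 f = G.t0 (G.i1 x)) :
    (a.mul (refl D (G.i1 x)) h).cmp = a.cmp := by
  simp at h
  subst h
  simp

theorem cmp_congr {g g' f f' : G.C1} {a : D.Resolution g} {a' : D.Resolution g'}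
    {b : D.Resolution f} {b' : D.Resolution f'} (hg : g = g') (hf : f = f') (ha : a.cmp = a'.cmp)
    (hb : b.cmp = b'.cmp) (h) (h') : (a.mul b h).cmp = (a'.mul b' h').cmp := by
  subst hg hf
  obtain rfl := ext' ha
  obtain rfl := ext' hb
  rfl

end Resolution

variable (D)

/-- The resolution of the value of a composable string whose 1-cell is the composite of the images
of the letters. -/
def resList : (l : List G.C1) → {t s : G.C0} → (h : G.IsString t l s) → D.Resolution (ev l h).1
  | [], _, s, _ => .refl D (G.i1 s)
  | f :: l, _, _, h => (Resolution.refl D f).mul (resList l h.2) (ev l h.2).2.2.symm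

theorem resList_append : ∀ {l l' : List G.C1} {t s r : G.C0} (h : G.IsString t l s)
    (h' : G.IsString s l' r), (D.resList (l ++ l') (h.append h')).cmp =
      ((D.resList l h).mul (D.resList l' h') ((ev l h).2.1.trans (ev l' h').2.2.symm)).cmp
  | [], l', t, s, r, h, h' => by
      have : t = s := h
      subst this
      exact (Resolution.refl_mul_cmp _ _ _).symm
  | f :: l, l', t, s, r, h, h' => by
      refine Eq.trans ?_ (Resolution.mul_assoc_cmp _ _ _ _
        ((ev l h.2).2.1.trans (ev l' h').2.2.symm)).symm
      exact Resolution.cmp_congr rfl (ev_append h.2 h') rfl (resList_append h.2 h') _ _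

/-- The canonical resolution of a string. -/
def res (f : Str G) : D.Resolution f.val := D.resList f.l f.isString

/-- The composite of the images of the letters of a string. -/
def strMap (f : Str G) : K.C1 := (D.res f).cell

/-- The comparison 2-cell from the composite of the images of the letters of a string to the image
of its value. -/
def strCmp (f : Str G) : K.C2 := (D.res f).cmp

/-- The inverse of the comparison 2-cell of a string. -/
def strInv (f : Str G) : K.C2 := (D.res f).inv

end PseudoData

end GrayCat

namespace GrayCat

open GrayData GrayData.IsGray

namespace PseudoData

variable {G K : GrayCat.{u}} (D : PseudoData G K)

@[simp] theorem s0_strMap (f : Str G) : K.s0 (D.strMap f) = D.map0 f.src := by simp [strMap]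

@[simp] theorem t0_strMap (f : Str G) : K.t0 (D.strMap f) = D.map0 f.tgt := by simp [strMap]

@[simp] theorem s1_strCmp (f : Str G) : K.s1 (D.strCmp f) = D.strMap f := (D.res f).s1_cmp

@[simp] theorem t1_strCmp (f : Str G) : K.t1 (D.strCmp f) = D.map1 f.val := (D.res f).t1_cmp

@[simp] theorem s1_strInv (f : Str G) : K.s1 (D.strInv f) = D.map1 f.val := (D.res f).s1_inv

@[simp] theorem t1_strInv (f : Str G) : K.t1 (D.strInv f) = D.strMap f := (D.res f).t1_inv

theorem strCmp_isInv (f : Str G) : K.IsInv (D.strCmp f) (D.strInv f) := (D.res f).isInv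

theorem strCmp_central (f : Str G) : K.IsCentral (D.strCmp f) := (D.res f).central

theorem res_mul_cmp (g f : Str G) (h : g.src = f.tgt) :
    (D.res (g.mul f h)).cmp = ((D.res g).mul (D.res f) (by simp [h])).cmp := by
  obtain ⟨a, b, l, hl, _⟩ := f
  dsimp at h
  subst h
  exact D.resList_append g.isString hl

theorem strCmp_mul (g f : Str G) (h : g.src = f.tgt) : D.strCmp (g.mul f h) =
    K.c1 (D.mu g.val f.val (by simp [h])) (K.c1 (K.r2 (D.strCmp g) (D.map1 f.val) (by simp [h]))
      (K.l2 (D.strMap g) (D.strCmp f) (by simp [h])) (by simp)) (by simp) :=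
  D.res_mul_cmp g f h

@[simp]
theorem strMap_mul (g f : Str G) (h : g.src = f.tgt) :
    D.strMap (g.mul f h) = K.c0 (D.strMap g) (D.strMap f) (by simp [h]) := by
  rw [← s1_strCmp, strCmp_mul]
  simp

theorem strCmp_one (x : G.C0) : D.strCmp (Str.one x) = K.i2 (K.i1 (D.map0 x)) :=
  congrArg K.i2 (D.map_i1 x)

@[simp]
theorem strMap_one (x : G.C0) : D.strMap (Str.one x) = K.i1 (D.map0 x) := by
  rw [← s1_strCmp, strCmp_one, K.s1_i2]

theorem strCmp_single (f : G.C1) : D.strCmp (Str.single f) = K.i2 (D.map1 f) := by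
  have key : ∀ (l : List G.C1) (h : G.IsString (G.t0 f) l (G.s0 f)), l = red [f] →
      (D.resList l h).cmp = K.i2 (D.map1 f) := by
    intro l h e
    by_cases hf : G.IsUnit f
    · have e' : l = [] := e.trans (red_cons_unit hf [])
      subst e'
      obtain ⟨x, rfl⟩ := hf
      simp [resList]
    · have e' : l = [f] := e.trans (red_cons_ne hf [])
      subst e'
      exact Resolution.mul_refl_cmp (.refl D f) (G.s0 f) (by simp)
  exact key _ _ rfl

@[simp]
theorem strMap_single (f : G.C1) : D.strMap (Str.single f) = D.map1 f := by
  rw [← s1_strCmp, strCmp_single, K.s1_i2]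

/-- The action on 2-cells of the strict `Gray`-functor on `Q¹ G`: conjugation of `D.map2` by the
comparison 2-cells. -/
def conj2 (α : Q2 G) : K.C2 :=
  K.c1 (D.strInv α.tgt) (K.c1 (D.map2 α.cell) (D.strCmp α.src) (by simp)) (by simp)

@[simp] theorem s1_conj2 (α : Q2 G) : K.s1 (D.conj2 α) = D.strMap α.src := by simp [conj2]

@[simp] theorem t1_conj2 (α : Q2 G) : K.t1 (D.conj2 α) = D.strMap α.tgt := by simp [conj2]

theorem cmp_conj2 (α : Q2 G) : K.c1 (D.strCmp α.tgt) (D.conj2 α) (by simp) =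
    K.c1 (D.map2 α.cell) (D.strCmp α.src) (by simp) :=
  (D.strCmp_isInv α.tgt).cancel _ _

theorem conj2_eq (α : Q2 G) (γ : K.C2) (ht : K.t1 γ = D.strMap α.tgt)
    (h : K.c1 (D.strCmp α.tgt) γ (by simp [ht]) =
      K.c1 (D.map2 α.cell) (D.strCmp α.src) (by simp)) :
    D.conj2 α = γ :=
  (c1_congr rfl h.symm _).trans ((D.strCmp_isInv α.tgt).symm.cancel _ (by simp [ht]))

theorem conj2_i2 (f : Str G) : D.conj2 (Q1.i2 f) = K.i2 (D.strMap f) :=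
  D.conj2_eq _ _ (by simp) (by simp)

theorem conj2_c1 (β α : Q2 G) (h : β.src = α.tgt) :
    D.conj2 (Q1.c1 β α h) = K.c1 (D.conj2 β) (D.conj2 α) (by simp [h]) := by
  have e1 := D.cmp_conj2 α
  have e2 := D.cmp_conj2 β
  refine D.conj2_eq _ _ (by simp) ?_
  simp [h, c1_assoc'] at e2 ⊢
  exact (c1_re e2 _ _ _).trans (c1_congr rfl e1 _)

/-- Conjugation by the comparison 2-cells is compatible with whiskering on the left, because the
comparison 2-cell of `g` is central and `mu` is natural. -/
theorem conj2_l2 (g : Str G) (α : Q2 G) (h : g.src = α.src.tgt) :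
    D.conj2 (Q1.l2 g α h) = K.l2 (D.strMap g) (D.conj2 α) (by simp [h]) := by
  have e1 := l2_congr (D.cmp_conj2 α) (D.strMap g) (by simp [h])
  have e2 := (D.strCmp_central g).left (D.map2 α.cell) (by simp [h])
  have e3 := D.mu_l2 g.val α.cell (by simp [h])
  refine D.conj2_eq _ _ (by simp [h]) ?_
  simp [h, c1_assoc', l2_c1', strCmp_mul] at e1 e2 e3 ⊢
  refine (c1_congr rfl (c1_congr rfl e1 _) _).trans ?_
  refine (c1_congr rfl (c1_re e2 _ _ _) _).trans ?_
  exact c1_re e3.symm _ _ _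

theorem conj2_r2 (α : Q2 G) (f : Str G) (h : α.src.src = f.tgt) :
    D.conj2 (Q1.r2 α f h) = K.r2 (D.conj2 α) (D.strMap f) (by simp [h]) := by
  have e1 := r2_congr (D.cmp_conj2 α) (D.map1 f.val) (by simp [h])
  have e2 := (D.strCmp_central f).right (D.conj2 α) (by simp [h])
  have e3 := D.mu_r2 α.cell f.val (by simp [h])
  refine D.conj2_eq _ _ (by simp [h]) ?_
  simp [h, c1_assoc', r2_c1', strCmp_mul] at e1 e2 e3 ⊢
  refine (c1_congr rfl (c1_congr rfl e2.symm _) _).trans ?_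
  refine (c1_congr rfl (c1_re e1 _ _ _) _).trans ?_
  exact c1_re e3.symm _ _ _

theorem conj2_cell2 (α : G.C2) : D.conj2 (cell2 α) = D.map2 α := by
  refine D.conj2_eq _ _ (by simp [cell2]) ?_
  simp [cell2, strCmp_single]

theorem conj2_kappa (g f : G.C1) (h : G.s0 g = G.t0 f) : D.conj2 (kappa g f h) = D.mu g f h := by
  refine D.conj2_eq _ _ (by simp [kappa]) ?_
  simp [kappa, strCmp_single, strCmp_mul]

end PseudoData

end GrayCat

/-! ### The extension to 3-cells -/

namespace GrayCat

open GrayData GrayData.IsGray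

theorem _root_.GrayFunctor.map_isInv {G K : GrayCat.{u}} (F : GrayFunctor G K) {μ ν : G.C2}
    (h : G.IsInv μ ν) : K.IsInv (F.map2 μ) (F.map2 ν) where
  s1 := by simp [h.s1]
  t1 := by simp [h.t1]
  comp := by rw [← F.map_c1 _ _ h.s1, h.comp]; simp
  comp' := by rw [← F.map_c1 _ _ h.t1, h.comp']; simp

namespace PseudoData

variable {G K L : GrayCat.{u}}

/-- The 3-dimensional data that extend `D` to a pseudo `Gray`-functor, in the case in which parallel
3-cells of `K` are detected by a family of `Gray`-functors `P i : K ⟶ L` along which `D` becomes the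
strict `Gray`-functor `E i`. -/
structure Extension (D : PseudoData G K) (L : GrayCat.{u}) (ι : Type) where
  map3 : G.C3 → K.C3
  s2_map : ∀ Γ, K.s2 (map3 Γ) = D.map2 (G.s2 Γ)
  t2_map : ∀ Γ, K.t2 (map3 Γ) = D.map2 (G.t2 Γ)
  E : ι → GrayFunctor G L
  P : ι → GrayFunctor K L
  faithful : ∀ Γ Δ, K.s2 Γ = K.s2 Δ → K.t2 Γ = K.t2 Δ → (∀ i, (P i).map3 Γ = (P i).map3 Δ) → Γ = Δ
  P_map1 : ∀ i f, (P i).map1 (D.map1 f) = (E i).map1 f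
  P_map2 : ∀ i α, (P i).map2 (D.map2 α) = (E i).map2 α
  P_map3 : ∀ i Γ, (P i).map3 (map3 Γ) = (E i).map3 Γ
  P_mu : ∀ i g f h, (P i).map2 (D.mu g f h) = L.i2 ((E i).map1 (G.c0 g f h))

namespace Extension

variable {D : PseudoData G K} {ι : Type} (X : D.Extension L ι)

attribute [simp] s2_map t2_map P_map1 P_map2 P_map3 P_mu

theorem P_cmp (i : ι) : ∀ {l : List G.C1} {t s : G.C0} (h : G.IsString t l s),
    (X.P i).map2 (D.resList l h).cmp = L.i2 ((X.E i).map1 (ev l h).1)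
  | [], _, _, _ => by simp only [resList, Resolution.refl_cmp, GrayFunctor.map_i2, P_map1, ev]
  | f :: l, _, _, h => by
      have e := (D.resList l h.2).t1_cmp
      simp [resList, P_cmp i h.2, ev]

@[simp]
theorem P_strCmp (i : ι) (f : Str G) : (X.P i).map2 (D.strCmp f) = L.i2 ((X.E i).map1 f.val) :=
  X.P_cmp i f.isString

@[simp]
theorem P_strInv (i : ι) (f : Str G) : (X.P i).map2 (D.strInv f) = L.i2 ((X.E i).map1 f.val) := by
  have h := (X.P i).map_isInv (D.strCmp_isInv f)
  rw [P_strCmp] at h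
  exact h.unique (isInv_i2 _)

@[simp]
theorem P_strMap (i : ι) (f : Str G) : (X.P i).map1 (D.strMap f) = (X.E i).map1 f.val := by
  rw [← D.s1_strCmp, ← (X.P i).s1_map, P_strCmp, L.s1_i2]

@[simp]
theorem P_conj2 (i : ι) (α : Q2 G) : (X.P i).map2 (D.conj2 α) = (X.E i).map2 α.cell := by
  simp [conj2]

/-- The action on 3-cells of the strict `Gray`-functor on `Q¹ G`: conjugation by the comparison
2-cells. -/
def conj3 (Γ : Q3 G) : K.C3 :=
  K.h3 (K.i3 (D.strInv Γ.tgt)) (K.h3 (X.map3 Γ.cell) (K.i3 (D.strCmp Γ.src)) (by simp)) (by simp)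

@[simp]
theorem s2_conj3 (Γ : Q3 G) : K.s2 (X.conj3 Γ) = D.conj2 Γ.source := by simp [conj3, conj2]

@[simp]
theorem t2_conj3 (Γ : Q3 G) : K.t2 (X.conj3 Γ) = D.conj2 Γ.target := by simp [conj3, conj2]

@[simp]
theorem P_conj3 (i : ι) (Γ : Q3 G) : (X.P i).map3 (X.conj3 Γ) = (X.E i).map3 Γ.cell := by
  simp [conj3]

/-- Boundary conditions reduce an equation for `conj3` to one that the `Gray`-functors `E i`
satisfy. -/
theorem conj3_eq (Γ : Q3 G) (Δ : K.C3) (hs : D.conj2 Γ.source = K.s2 Δ)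
    (ht : D.conj2 Γ.target = K.t2 Δ) (h : ∀ i, (X.E i).map3 Γ.cell = (X.P i).map3 Δ) :
    X.conj3 Γ = Δ :=
  X.faithful _ _ (by simp [hs]) (by simp [ht]) fun i => by simp [h]

theorem conj3_i3 (α : Q2 G) : X.conj3 (Q1.i3 α) = K.i3 (D.conj2 α) := by
  have e : (Q1.i3 α).source = α := Q2.ext (by simp) rfl rfl
  have e' : (Q1.i3 α).target = α := Q2.ext (by simp) rfl rfl
  exact X.conj3_eq _ _ (by rw [e]; simp) (by rw [e']; simp) fun i => by simp

theorem conj3_l3 (g : Str G) (Γ : Q3 G) (h : g.src = Γ.src.tgt) :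
    X.conj3 (Q1.l3 g Γ h) = K.l3 (D.strMap g) (X.conj3 Γ) (by simp [h]) := by
  have e : (Q1.l3 g Γ h).source =
      Q1.l2 g Γ.source (by simp [h]) := Q2.ext (by simp) rfl rfl
  have e' : (Q1.l3 g Γ h).target =
      Q1.l2 g Γ.target (by simp [h]) := Q2.ext (by simp) rfl rfl
  refine X.conj3_eq _ _ ?_ ?_ fun i => by simp
  · rw [e, conj2_l2]; simp
  · rw [e', conj2_l2]; simp

theorem conj3_r3 (Γ : Q3 G) (f : Str G) (h : Γ.src.src = f.tgt) :
    X.conj3 (Q1.r3 Γ f h) = K.r3 (X.conj3 Γ) (D.strMap f) (by simp [h]) := by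
  have e : (Q1.r3 Γ f h).source =
      Q1.r2 Γ.source f (by simp [h]) := Q2.ext (by simp) rfl rfl
  have e' : (Q1.r3 Γ f h).target =
      Q1.r2 Γ.target f (by simp [h]) := Q2.ext (by simp) rfl rfl
  refine X.conj3_eq _ _ ?_ ?_ fun i => by simp
  · rw [e, conj2_r2]; simp
  · rw [e', conj2_r2]; simp

theorem conj3_h3 (Δ Γ : Q3 G) (h : Δ.src = Γ.tgt) :
    X.conj3 (Q1.h3 Δ Γ h) = K.h3 (X.conj3 Δ) (X.conj3 Γ) (by simp [h]) := by
  have e : (Q1.h3 Δ Γ h).source =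
      Q1.c1 Δ.source Γ.source (by simp [h]) := Q2.ext (by simp) rfl rfl
  have e' : (Q1.h3 Δ Γ h).target =
      Q1.c1 Δ.target Γ.target (by simp [h]) := Q2.ext (by simp) rfl rfl
  refine X.conj3_eq _ _ ?_ ?_ fun i => by simp
  · rw [e, conj2_c1]; simp
  · rw [e', conj2_c1]; simp

theorem conj3_c2 (Δ Γ : Q3 G) (h : Δ.source = Γ.target) :
    X.conj3 (Q1.c2 Δ Γ h) = K.c2 (X.conj3 Δ) (X.conj3 Γ) (by simp [h]) := by
  have e : (Q1.c2 Δ Γ h).source = Γ.source := Q2.ext (by simp) rfl rfl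
  have e' : (Q1.c2 Δ Γ h).target = Δ.target :=
    Q2.ext (by simp) (congrArg Q2.src h.symm :) (congrArg Q2.tgt h.symm :)
  refine X.conj3_eq _ _ ?_ ?_ fun i => by simp
  · rw [e]; simp
  · rw [e']; simp

theorem conj3_tensor (β α : Q2 G) (h : β.src.src = α.src.tgt) :
    X.conj3 (Q1.tensor β α h) = K.tensor (D.conj2 β) (D.conj2 α) (by simp [h]) := by
  have e : (Q1.tensor β α h).source =
      Q1.c1 (Q1.r2 β α.tgt (by simp [h])) (Q1.l2 β.src α h) (by simp) :=
    Q2.ext (by simp) rfl rfl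
  have e' : (Q1.tensor β α h).target =
      Q1.c1 (Q1.l2 β.tgt α (by simp [h])) (Q1.r2 β α.src h) (by simp) :=
    Q2.ext (by simp) rfl rfl
  refine X.conj3_eq _ _ ?_ ?_ fun i => by simp
  · rw [e, conj2_c1]
    refine (c1_congr (D.conj2_r2 _ _ _) (D.conj2_l2 _ _ _) _).trans ?_
    simp
  · rw [e', conj2_c1]
    refine (c1_congr (D.conj2_l2 _ _ _) (D.conj2_r2 _ _ _) _).trans ?_
    simp

/-- The strict `Gray`-functor on `Q¹ G` that corresponds to the pseudo `Gray`-functor data. -/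
noncomputable def toFunctor : GrayFunctor (q1 G) K where
  map0 x := D.map0 x
  map1 f := D.strMap f
  map2 α := D.conj2 α
  map3 Γ := X.conj3 Γ
  s0_map f := D.s0_strMap f
  t0_map f := D.t0_strMap f
  s1_map α := D.s1_conj2 α
  t1_map α := D.t1_conj2 α
  s2_map Γ := X.s2_conj3 Γ
  t2_map Γ := X.t2_conj3 Γ
  map_i1 x := D.strMap_one x
  map_i2 f := D.conj2_i2 f
  map_i3 α := X.conj3_i3 α
  map_c0 g f h := D.strMap_mul g f h
  map_l2 g α h := D.conj2_l2 g α h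
  map_r2 α f h := D.conj2_r2 α f h
  map_l3 g Γ h := X.conj3_l3 g Γ h
  map_r3 Γ f h := X.conj3_r3 Γ f h
  map_c1 β α h := D.conj2_c1 β α h
  map_h3 Δ Γ h := X.conj3_h3 Δ Γ h
  map_c2 Δ Γ h := X.conj3_c2 Δ Γ h
  map_tensor β α h := X.conj3_tensor β α h

theorem toFunctor_single (f : G.C1) : X.toFunctor.map1 (Str.single f) = D.map1 f :=
  D.strMap_single f

theorem toFunctor_cell2 (α : G.C2) : X.toFunctor.map2 (cell2 α) = D.map2 α := D.conj2_cell2 α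

theorem toFunctor_kappa (g f : G.C1) (h : G.s0 g = G.t0 f) :
    X.toFunctor.map2 (kappa g f h) = D.mu g f h := D.conj2_kappa g f h

theorem toFunctor_cell3 (Γ : G.C3) : X.toFunctor.map3 (cell3 Γ) = X.map3 Γ := by
  refine X.conj3_eq _ _ ?_ ?_ fun i => by simp [cell3]
  · refine (D.conj2_eq _ (D.map2 (G.s2 Γ)) (by simp [cell3]) ?_).trans (by simp)
    simp [cell3, strCmp_single]
  · refine (D.conj2_eq _ (D.map2 (G.t2 Γ)) (by simp [cell3]) ?_).trans (by simp)
    simp [cell3, strCmp_single]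

end Extension

end PseudoData

end GrayCat

/-! ### Horizontal pasting as a pseudo `Gray`-functor -/

namespace GrayCat

open GrayData GrayData.IsGray

/-- The `Gray`-category of pairs of horizontally composable cells of the path space. -/
abbrev pathPairs (H : GrayCat.{u}) : GrayCat.{u} := pb (pathD0 H) (pathD1 H)

/-- A 2-cell of the path space is central if both of its boundary components are identities. -/
theorem path_isCentral {H : GrayCat.{u}} (μ : Path2 H) (h0 : μ.a0 = H.i2 μ.src.l)
    (h1 : μ.a1 = H.i2 μ.src.r) : (path H).IsCentral μ where
  left α h := path_interchange_left μ α h h0 h1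
  right β h := path_interchange_right β μ h h0 h1

/-- Horizontal pasting as data of a pseudo `Gray`-functor, in dimensions up to 2. -/
def pastePseudo (H : GrayCat.{u}) : PseudoData (pathPairs H) (path H) where
  map0 x := H.c0 x.1.1 x.1.2 x.2
  map1 g := paste1 g.1.1 g.1.2 g.2
  map2 α := paste2 α.1.1 α.1.2 α.2
  s0_map _ := rfl
  t0_map _ := rfl
  s1_map _ := rfl
  t1_map _ := rfl
  map_i1 x := paste1_I1 x.1.1 x.1.2 (congrArg H.i1 x.2)
  map_i2 g := paste2_I2 g.1.1 g.1.2 g.2 _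
  map_c1 β α h := paste2_C1 β.1.1 β.1.2 α.1.1 α.1.2 β.2 α.2
    (congrArg (fun x => x.1.1) h) (congrArg (fun x => x.1.2) h) _
  mu h g p := pasteCocycle h.1.1 h.1.2 g.1.1 g.1.2 h.2 g.2
    (congrArg (fun x => x.1.1) p) (congrArg (fun x => x.1.2) p)
  muInv h g p := pasteCocycleInv h.1.1 h.1.2 g.1.1 g.1.2 h.2 g.2
    (congrArg (fun x => x.1.1) p) (congrArg (fun x => x.1.2) p)
  isInv h g p := ⟨rfl, rfl, pasteCocycle_inv _ _ _ _ _ _ _ _ rfl,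
    pasteCocycleInv_comp _ _ _ _ _ _ _ _ rfl⟩
  central h g p := path_isCentral _ rfl rfl
  s1_mu _ _ _ := rfl
  t1_mu _ _ _ := rfl
  i1_mu x g h := pasteCocycle_I1_left _ _ _ _ _ _ _ _
  mu_i1 g x h := pasteCocycle_I1_right _ _ _ _ _ _ _ _
  mu_l2 g α h := paste2_L2 _ _ _ _ _ _ _ _ _ _ _ _ rfl _ _ rfl
  mu_r2 α f h := paste2_R2 _ _ _ _ _ _ _ _ _ _ _ _ rfl _ _ rfl
  mu_assoc h g f p q := pasteCocycle_assoc _ _ _ _ _ _ _ _ _ _ _ _ _ _ _ _ _ _ _ _ _ rfl rfl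

/-- Horizontal pasting of 3-cells extends `pastePseudo`: since parallel 3-cells of the path space
are determined by their two components, and the components of a pasting are components of the pasted
cells, no further coherence is needed. -/
def pasteExtension (H : GrayCat.{u}) : (pastePseudo H).Extension H Bool where
  map3 Γ := paste3 Γ.1.1 Γ.1.2 Γ.2
  s2_map _ := rfl
  t2_map _ := rfl
  E i := bif i then (pbFst (pathD0 H) (pathD1 H)).comp (pathD1 H)
    else (pbSnd (pathD0 H) (pathD1 H)).comp (pathD0 H)
  P i := bif i then pathD1 H else pathD0 H
  faithful Γ Δ hs ht h := Path3.ext hs ht (h false) (h true)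
  P_map1 := by rintro (_ | _) _ <;> rfl
  P_map2 := by rintro (_ | _) _ <;> rfl
  P_map3 := by rintro (_ | _) _ <;> rfl
  P_mu := by rintro (_ | _) _ _ _ <;> rfl

/-- Horizontal pasting, as a strict `Gray`-functor on `Q¹`. -/
noncomputable def pasteFunctor (H : GrayCat.{u}) : GrayFunctor (q1 (pathPairs H)) (path H) :=
  (pasteExtension H).toFunctor

theorem isPasting_pasteFunctor (H : GrayCat.{u}) : IsPasting H (pasteFunctor H) where
  map0 _ := rfl
  map1 g := (pasteExtension H).toFunctor_single g
  map2 α := (pasteExtension H).toFunctor_cell2 α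
  map3 Γ := (pasteExtension H).toFunctor_cell3 Γ
  map_kappa h g p := (pasteExtension H).toFunctor_kappa h g p

end GrayCat

/-! ### Generators of `Q¹ G` -/

namespace GrayCat

open GrayData GrayData.IsGray

section

variable {G K : GrayCat.{u}}

theorem Str.induction {motive : Str G → Prop} (one : ∀ x, motive (Str.one x))
    (mul : ∀ a (f : Str G) (h : G.s0 a = f.tgt), motive f →
      motive ((Str.single a).mul f (by simpa using h))) (f : Str G) : motive f := by
  obtain ⟨s, t, l, hl, hn⟩ := f
  induction l generalizing t with
  | nil =>
    have e : t = s := hl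
    subst e
    exact one t
  | cons a l ih =>
    have hn' : ∀ f ∈ l, ¬ G.IsUnit f := fun f hf => hn f (List.mem_cons_of_mem _ hf)
    have e : (⟨s, t, a :: l, hl, hn⟩ : Str G) =
        (Str.single a).mul ⟨s, G.s0 a, l, hl.2, hn'⟩ (by simp) := by
      refine Str.ext rfl hl.1.symm ?_
      exact congrArg (· ++ l) (red_eq (l := [a]) (by simpa using hn a)).symm
    rw [e]
    exact mul a _ rfl (ih _ hl.2 hn')

/-- The comparison 2-cell from a string to the string of length at most one with the same value. -/
@[simps]
noncomputable def contract (f : Str G) : Q2 G :=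
  ⟨G.i2 f.val, f, Str.single f.val, by simp, by simp⟩

/-- The inverse of `contract`. -/
@[simps]
noncomputable def expand (f : Str G) : Q2 G :=
  ⟨G.i2 f.val, Str.single f.val, f, by simp, by simp⟩

theorem contract_isInv (f : Str G) : (q1 G).IsInv (contract f) (expand f) where
  s1 := rfl
  t1 := rfl
  comp := show Q1.c1 (contract f) (expand f) (by simp) = Q1.i2 (Str.single f.val) from
    Q2.ext (by simp) rfl rfl
  comp' := show Q1.c1 (expand f) (contract f) (by simp) = Q1.i2 f from Q2.ext (by simp) rfl rfl

theorem Str.single_i1 (x : G.C0) : Str.single (G.i1 x) = Str.one x := by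
  refine Str.ext (by simp) (by simp) ?_
  exact red_cons_unit ⟨x, rfl⟩ []

theorem contract_one (x : G.C0) : contract (Str.one x) = Q1.i2 (Str.one x) :=
  Q2.ext (by simp) rfl (Str.single_i1 x)

/-- A nonempty string is contracted by contracting its tail and then composing the first letter with
the value of the tail. -/
theorem contract_mul (a : G.C1) (f : Str G) (h : G.s0 a = f.tgt) :
    contract ((Str.single a).mul f (by simpa using h)) =
      Q1.c1 (kappa a f.val (by simpa using h))
        (Q1.l2 (Str.single a) (contract f) (by simpa using h)) rfl := by
  refine Q2.ext ?_ rfl ?_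
  · simp [kappa, h]
  · simp [kappa, h]

theorem eq_expand_contract (α : Q2 G) :
    α = Q1.c1 (expand α.tgt) (Q1.c1 (cell2 α.cell) (contract α.src) (by simp [cell2]))
      (by simp [cell2]) :=
  Q2.ext (by simp [cell2]) rfl rfl

theorem eq_expand_contract3 (Γ : Q3 G) :
    Γ = Q1.h3 (Q1.i3 (expand Γ.tgt))
      (Q1.h3 (cell3 Γ.cell) (Q1.i3 (contract Γ.src)) (by simp [cell3])) (by simp [cell3]) :=
  Q3.ext (by simp [cell3]) rfl rfl

variable (F F' : GrayFunctor (q1 G) K)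

/-- A `Gray`-functor on `Q¹ G` is determined by its values on 0-cells, on the one-letter strings, on
2- and 3-cells between one-letter strings, and on the 2-cells `kappa`. -/
theorem q1_functor_ext (h0 : ∀ x : G.C0, F.map0 x = F'.map0 x)
    (h1 : ∀ f : G.C1, F.map1 (Str.single f) = F'.map1 (Str.single f))
    (h2 : ∀ α : G.C2, F.map2 (cell2 α) = F'.map2 (cell2 α))
    (h3 : ∀ Γ : G.C3, F.map3 (cell3 Γ) = F'.map3 (cell3 Γ))
    (hk : ∀ (g f : G.C1) (h : G.s0 g = G.t0 f), F.map2 (kappa g f h) = F'.map2 (kappa g f h)) :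
    F = F' := by
  have c0c : ∀ {g g' f f' : K.C1} (hg : g = g') (hf : f = f') (p p'),
    K.c0 g f p = K.c0 g' f' p' := by rintro _ _ _ _ rfl rfl _ _; rfl
  have l2c : ∀ {g g' : K.C1} {β β' : K.C2} (hg : g = g') (hβ : β = β') (p p'),
    K.l2 g β p = K.l2 g' β' p' := by rintro _ _ _ _ rfl rfl _ _; rfl
  have e1 : ∀ f : Str G, F.map1 f = F'.map1 f := by
    refine Str.induction (fun x => ?_) fun a f h ih => ?_
    · exact (F.map_i1 x).trans ((congrArg K.i1 (h0 x)).trans (F'.map_i1 x).symm)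
    · exact (F.map_c0 (Str.single a) f h).trans
        ((c0c (h1 a) ih _ _).trans (F'.map_c0 (Str.single a) f h).symm)
  have c1c : ∀ (β α : Q2 G) (h : β.src = α.tgt), F.map2 β = F'.map2 β → F.map2 α = F'.map2 α →
      F.map2 (Q1.c1 β α h) = F'.map2 (Q1.c1 β α h) := fun β α h e e' =>
    (F.map_c1 β α h).trans ((c1_congr e e' _).trans (F'.map_c1 β α h).symm)
  have h3c : ∀ (Δ Γ : Q3 G) (h : Δ.src = Γ.tgt), F.map3 Δ = F'.map3 Δ → F.map3 Γ = F'.map3 Γ →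
      F.map3 (Q1.h3 Δ Γ h) = F'.map3 (Q1.h3 Δ Γ h) := fun Δ Γ h e e' =>
    (F.map_h3 Δ Γ h).trans ((h3_congr e e' _).trans (F'.map_h3 Δ Γ h).symm)
  have i3c : ∀ α : Q2 G, F.map2 α = F'.map2 α → F.map3 (Q1.i3 α) = F'.map3 (Q1.i3 α) :=
    fun α e => (F.map_i3 α).trans ((congrArg K.i3 e).trans (F'.map_i3 α).symm)
  have ec : ∀ f : Str G, F.map2 (contract f) = F'.map2 (contract f) := by
    refine Str.induction (fun x => ?_) fun a f h ih => ?_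
    · rw [contract_one]
      exact (F.map_i2 (Str.one x)).trans ((congrArg K.i2 (e1 _)).trans (F'.map_i2 (Str.one x)).symm)
    · rw [contract_mul a f h]
      exact c1c _ _ _ (hk _ _ _) ((F.map_l2 (Str.single a) (contract f) h).trans
        ((l2c (h1 a) ih _ _).trans (F'.map_l2 (Str.single a) (contract f) h).symm))
  have ee : ∀ f : Str G, F.map2 (expand f) = F'.map2 (expand f) := fun f => by
    have i := F.map_isInv (contract_isInv f)
    rw [ec] at i
    exact i.unique (F'.map_isInv (contract_isInv f))
  have e2 : ∀ α : Q2 G, F.map2 α = F'.map2 α := fun α => by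
    have e := c1c _ _ (by simp [cell2]) (ee α.tgt)
      (c1c (cell2 α.cell) (contract α.src) (by simp [cell2]) (h2 _) (ec _))
    rwa [← eq_expand_contract] at e
  have e3 : ∀ Γ : Q3 G, F.map3 Γ = F'.map3 Γ := fun Γ => by
    have e := h3c _ _ (by simp [cell3]) (i3c _ (ee Γ.tgt))
      (h3c (cell3 Γ.cell) _ (by simp [cell3]) (h3 _) (i3c _ (ec Γ.src)))
    rwa [← eq_expand_contract3] at e
  exact GrayFunctor.ext (funext h0) (funext e1) (funext e2) (funext e3)

end

end GrayCat

/-! ### Composition with strict `Gray`-functors, and pullbacks -/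

namespace GrayCat

open GrayData GrayData.IsGray CategoryTheory

section

variable {A B C X : GrayCat.{u}}

theorem comp_strict_of (f : A.toPs ⟶ B.toPs) (F : GrayFunctor B C) :
    (f ≫ strict F).of = GrayFunctor.comp f.of F :=
  GrayFunctor.ext rfl
    (funext fun x => congrArg F.map1 ((Str.val_map f.of (Str.dup x)).trans
      (congrArg f.of.map1 (Str.val_dup x)))) rfl rfl

theorem strict_comp_of (F : GrayFunctor A B) (g : B.toPs ⟶ C.toPs) :
    (strict F ≫ g).of = GrayFunctor.comp (q1Map F) g.of := by
  have e : ∀ x : Str A, x.dup.map ((q1Counit A).comp F) = x.map F := fun x =>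
    (Str.map_comp (q1Counit A) F x.dup).trans (congrArg (Str.map F) (Str.dup_counit x))
  exact GrayFunctor.ext rfl (funext fun x => congrArg g.of.map1 (e x))
    (funext fun α => congrArg g.of.map2 (Q2.ext rfl (e α.src) (e α.tgt)))
    (funext fun Γ => congrArg g.of.map3 (Q3.ext rfl (e Γ.src) (e Γ.tgt)))

theorem strict_comp_strict (F : GrayFunctor A B) (K : GrayFunctor B C) :
    strict F ≫ strict K = strict (F.comp K) :=
  Cokleisli.hom_ext _ (comp_strict_of _ _)

/-- The `Gray`-functor into a pullback determined by its components. -/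
def pbLift {F : GrayFunctor A C} {K : GrayFunctor B C} (a : GrayFunctor X A) (b : GrayFunctor X B)
    (h : a.comp F = b.comp K) : GrayFunctor X (pb F K) where
  map0 x := ⟨(a.map0 x, b.map0 x), congrArg (fun L => L.map0 x) h⟩
  map1 x := ⟨(a.map1 x, b.map1 x), congrArg (fun L => L.map1 x) h⟩
  map2 x := ⟨(a.map2 x, b.map2 x), congrArg (fun L => L.map2 x) h⟩
  map3 x := ⟨(a.map3 x, b.map3 x), congrArg (fun L => L.map3 x) h⟩
  s0_map _ := Subtype.ext (Prod.ext (a.s0_map _) (b.s0_map _))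
  t0_map _ := Subtype.ext (Prod.ext (a.t0_map _) (b.t0_map _))
  s1_map _ := Subtype.ext (Prod.ext (a.s1_map _) (b.s1_map _))
  t1_map _ := Subtype.ext (Prod.ext (a.t1_map _) (b.t1_map _))
  s2_map _ := Subtype.ext (Prod.ext (a.s2_map _) (b.s2_map _))
  t2_map _ := Subtype.ext (Prod.ext (a.t2_map _) (b.t2_map _))
  map_i1 _ := Subtype.ext (Prod.ext (a.map_i1 _) (b.map_i1 _))
  map_i2 _ := Subtype.ext (Prod.ext (a.map_i2 _) (b.map_i2 _))
  map_i3 _ := Subtype.ext (Prod.ext (a.map_i3 _) (b.map_i3 _))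
  map_c0 _ _ _ := Subtype.ext (Prod.ext (a.map_c0 _ _ _) (b.map_c0 _ _ _))
  map_l2 _ _ _ := Subtype.ext (Prod.ext (a.map_l2 _ _ _) (b.map_l2 _ _ _))
  map_r2 _ _ _ := Subtype.ext (Prod.ext (a.map_r2 _ _ _) (b.map_r2 _ _ _))
  map_l3 _ _ _ := Subtype.ext (Prod.ext (a.map_l3 _ _ _) (b.map_l3 _ _ _))
  map_r3 _ _ _ := Subtype.ext (Prod.ext (a.map_r3 _ _ _) (b.map_r3 _ _ _))
  map_c1 _ _ _ := Subtype.ext (Prod.ext (a.map_c1 _ _ _) (b.map_c1 _ _ _))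
  map_h3 _ _ _ := Subtype.ext (Prod.ext (a.map_h3 _ _ _) (b.map_h3 _ _ _))
  map_c2 _ _ _ := Subtype.ext (Prod.ext (a.map_c2 _ _ _) (b.map_c2 _ _ _))
  map_tensor _ _ _ := Subtype.ext (Prod.ext (a.map_tensor _ _ _) (b.map_tensor _ _ _))

theorem pb_hom_ext {F : GrayFunctor A C} {K : GrayFunctor B C} {L L' : GrayFunctor X (pb F K)}
    (h : L.comp (pbFst F K) = L'.comp (pbFst F K)) (h' : L.comp (pbSnd F K) = L'.comp (pbSnd F K)) :
    L = L' :=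
  GrayFunctor.ext
    (funext fun x => Subtype.ext
      (Prod.ext (congrArg (fun L => L.map0 x) h) (congrArg (fun L => L.map0 x) h')))
    (funext fun x => Subtype.ext
      (Prod.ext (congrArg (fun L => L.map1 x) h) (congrArg (fun L => L.map1 x) h')))
    (funext fun x => Subtype.ext
      (Prod.ext (congrArg (fun L => L.map2 x) h) (congrArg (fun L => L.map2 x) h')))
    (funext fun x => Subtype.ext
      (Prod.ext (congrArg (fun L => L.map3 x) h) (congrArg (fun L => L.map3 x) h')))

theorem pb_condition (F : GrayFunctor A C) (K : GrayFunctor B C) :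
    (pbFst F K).comp F = (pbSnd F K).comp K :=
  GrayFunctor.ext (funext fun x => x.2) (funext fun x => x.2) (funext fun x => x.2)
    (funext fun x => x.2)

/-- The cellwise pullback of strict `Gray`-functors is a pullback for pseudo `Gray`-functors: a
pseudo `Gray`-functor composed with a strict one is composed in the naive way. -/
theorem isPullback_strict (F : GrayFunctor A C) (K : GrayFunctor B C) :
    IsPullback (strict (pbFst F K)) (strict (pbSnd F K)) (strict F) (strict K) := by
  refine ⟨⟨by rw [strict_comp_strict, strict_comp_strict, pb_condition]⟩,
    ⟨Limits.PullbackCone.IsLimit.mk _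
      (fun s => .mk (pbLift s.fst.of s.snd.of ?_)) (fun s => ?_) (fun s => ?_)
      (fun s l h h' => ?_)⟩⟩
  · have e := congrArg Cokleisli.Hom.of s.condition
    rwa [comp_strict_of, comp_strict_of] at e
  · exact Cokleisli.hom_ext _ ((comp_strict_of _ _).trans rfl)
  · exact Cokleisli.hom_ext _ ((comp_strict_of _ _).trans rfl)
  · refine Cokleisli.hom_ext _ (pb_hom_ext ?_ ?_)
    · exact (comp_strict_of l _).symm.trans (congrArg Cokleisli.Hom.of h)
    · exact (comp_strict_of l _).symm.trans (congrArg Cokleisli.Hom.of h')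

/-! ### Values of composites on generators -/

theorem Str.dup_single (f : A.C1) :
    (Str.single f).dup = Str.single (G := q1 A) (Str.single f) :=
  Str.ext rfl rfl (red_single [f]).symm

theorem Str.dup_single_map (L : GrayFunctor (q1 A) B) (f : A.C1) :
    (Str.single f).dup.map L = Str.single (L.map1 (Str.single f)) := by
  rw [Str.dup_single]
  exact Str.single_map L (Str.single f : Str A)

variable (l : A.toPs ⟶ B.toPs) (m : B.toPs ⟶ C.toPs)

theorem comp_of_single (f : A.C1) :
    (l ≫ m).of.map1 (Str.single f) = m.of.map1 (Str.single (l.of.map1 (Str.single f))) :=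
  congrArg m.of.map1 (Str.dup_single_map l.of f)

theorem comp_of_cell2 (α : A.C2) :
    (l ≫ m).of.map2 (cell2 α) = m.of.map2 (cell2 (l.of.map2 (cell2 α))) := by
  refine congrArg m.of.map2 (Q2.ext rfl ?_ ?_)
  · exact (Str.dup_single_map l.of _).trans (congrArg Str.single (l.of.s1_map (cell2 α)).symm)
  · exact (Str.dup_single_map l.of _).trans (congrArg Str.single (l.of.t1_map (cell2 α)).symm)

theorem comp_of_cell3 (Γ : A.C3) :
    (l ≫ m).of.map3 (cell3 Γ) = m.of.map3 (cell3 (l.of.map3 (cell3 Γ))) := by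
  refine congrArg m.of.map3 (Q3.ext rfl ?_ ?_)
  · refine (Str.dup_single_map l.of _).trans (congrArg Str.single ?_)
    exact ((congrArg B.s1 (l.of.s2_map (cell3 Γ))).trans (l.of.s1_map _)).symm
  · refine (Str.dup_single_map l.of _).trans (congrArg Str.single ?_)
    exact ((congrArg B.t1 (l.of.s2_map (cell3 Γ))).trans (l.of.t1_map _)).symm

/-- The images of the letters of the string `[h, g]` are composable. -/
theorem comp_single_aux (L : GrayFunctor (q1 A) B) {h g : A.C1} (p : A.s0 h = A.t0 g) :
    B.s0 (L.map1 (Str.single h)) = B.t0 (L.map1 (Str.single g)) :=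
  (L.s0_map (Str.single h)).trans
    ((congrArg L.map0 p).trans (L.t0_map (Str.single g)).symm)

theorem map_kappa_s1 (L : GrayFunctor (q1 A) B) {h g : A.C1} (p : A.s0 h = A.t0 g) :
    B.s1 (L.map2 (kappa h g p)) =
      B.c0 (L.map1 (Str.single h)) (L.map1 (Str.single g)) (comp_single_aux L p) :=
  (L.s1_map _).trans (L.map_c0 (Str.single h) (Str.single g) p)

/-- A composite pseudo `Gray`-functor has as its comparison 2-cell the comparison 2-cell of `m`,
followed by the image of the comparison 2-cell of `l`. -/
theorem comp_of_kappa (h g : A.C1) (p : A.s0 h = A.t0 g) :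
    (l ≫ m).of.map2 (kappa h g p) =
      C.c1 (m.of.map2 (cell2 (l.of.map2 (kappa h g p))))
        (m.of.map2 (kappa (l.of.map1 (Str.single h)) (l.of.map1 (Str.single g))
          (comp_single_aux l.of p)))
        (by
          refine (m.of.s1_map _).trans (Eq.trans ?_ (m.of.t1_map _).symm)
          exact congrArg (fun x => m.of.map1 (Str.single x)) (map_kappa_s1 l.of p)) := by
  have e : ((kappa h g p : Q2 A).dup.map l.of : Q2 B) =
      Q1.c1 (cell2 (l.of.map2 (kappa h g p)))
        (kappa (l.of.map1 (Str.single h)) (l.of.map1 (Str.single g)) (comp_single_aux l.of p))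
        (congrArg Str.single (map_kappa_s1 l.of p)) := by
    refine Q2.ext ?_ ?_ ?_
    · exact (c1_i2 (l.of.map2 (kappa h g p)) _ ((map_kappa_s1 l.of p).trans (B.t1_i2 _).symm)).symm
    · refine (congrArg (Str.map l.of) (Str.dup_mul _ _ p)).trans ?_
      have mulc : ∀ {a a' b b' : Str B} (e : a = a') (e' : b = b') (q q'),
        a.mul b q = a'.mul b' q' := by rintro _ _ _ _ rfl rfl _ _; rfl
      exact (Str.map_mul l.of (Str.dup (Str.single h)) (Str.dup (Str.single g)) p).trans
        (mulc (Str.dup_single_map l.of h) (Str.dup_single_map l.of g) _ (comp_single_aux l.of p))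
    · exact (Str.dup_single_map l.of _).trans
        (congrArg Str.single (l.of.t1_map (kappa h g p)).symm)
  exact (congrArg m.of.map2 e).trans (m.of.map_c1 (cell2 (l.of.map2 (kappa h g p)))
    (kappa (l.of.map1 (Str.single h)) (l.of.map1 (Str.single g)) (comp_single_aux l.of p))
    (congrArg Str.single (map_kappa_s1 l.of p)))

end

end GrayCat

namespace GrayCat

open GrayData GrayData.IsGray CategoryTheory

/-! ### The axioms of an internal category -/

section

variable {H T : GrayCat.{u}}

theorem q1Map_cell2 {K : GrayCat.{u}} (Q : GrayFunctor T K) (α : T.C2) :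
    (q1Map Q).map2 (cell2 α) = cell2 (Q.map2 α) :=
  Q2.ext rfl ((Str.single_map Q _).trans (congrArg Str.single (Q.s1_map α).symm))
    ((Str.single_map Q _).trans (congrArg Str.single (Q.t1_map α).symm))

theorem q1Map_cell3 {K : GrayCat.{u}} (Q : GrayFunctor T K) (Γ : T.C3) :
    (q1Map Q).map3 (cell3 Γ) = cell3 (Q.map3 Γ) :=
  Q3.ext rfl ((Str.single_map Q _).trans (congrArg Str.single (by simp)))
    ((Str.single_map Q _).trans (congrArg Str.single (by simp)))

theorem q1Map_kappa {K : GrayCat.{u}} (Q : GrayFunctor T K) (h g : T.C1) (p : T.s0 h = T.t0 g) :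
    (q1Map Q).map2 (kappa h g p) = kappa (Q.map1 h) (Q.map1 g) (by simp [p]) := by
  have mulc : ∀ {a a' b b' : Str K} (e : a = a') (e' : b = b') (q q'),
    a.mul b q = a'.mul b' q' := by rintro _ _ _ _ rfl rfl _ _; rfl
  exact Q2.ext ((Q.map_i2 _).trans (congrArg K.i2 (Q.map_c0 _ _ _)))
    ((Str.map_mul Q (Str.single h) (Str.single g) p).trans
      (mulc (Str.single_map Q h) (Str.single_map Q g) _ (by simp [p])))
    ((Str.single_map Q _).trans (congrArg Str.single (Q.map_c0 _ _ _)))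

theorem pathC1_congr {a a' b b' : Path2 H} (ha : a = a') (hb : b = b') (p p') :
    pathC1 a b p = pathC1 a' b' p' := by subst ha hb; rfl

theorem pasteCocycle_of_left_units {a b c d h g : Path1 H} {k l : H.C1} (ha : a = pathUnit1 k)
    (hb : b = h) (hc : c = pathUnit1 l) (hd : d = g) (p q r s t) :
    pasteCocycle a b c d p q r s = pathI2 (pathC0 h g t) := by
  subst ha hb hc hd
  exact pasteCocycle_pathUnit1_left _ _ _ _ _ _ _ _

theorem pasteCocycle_of_right_units {a b c d h g : Path1 H} {k l : H.C1} (ha : a = h)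
    (hb : b = pathUnit1 k) (hc : c = g) (hd : d = pathUnit1 l) (p q r s t) :
    pasteCocycle a b c d p q r s = pathI2 (pathC0 h g t) := by
  subst ha hb hc hd
  exact pasteCocycle_pathUnit1_right _ _ _ _ _ _ _ _

theorem c0_assoc_of_eq {a b a' b' h g g' f : H.C1} {p p'} (ha : a = H.c0 h g p)
    (hb : b = f) (ha' : a' = h) (hb' : b' = H.c0 g' f p') (e : g = g') (q q') :
    H.c0 a b q = H.c0 a' b' q' := by
  subst ha hb ha' hb' e
  exact c0_assoc _ _ _ _ _

theorem paste1_assoc_of_eq {a b a' b' h g g' f : Path1 H} {p p'} (ha : a = paste1 h g p)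
    (hb : b = f) (ha' : a' = h) (hb' : b' = paste1 g' f p') (e : g = g') (q q') :
    paste1 a b q = paste1 a' b' q' := by
  subst ha hb ha' hb' e
  exact paste1_assoc _ _ _ _ _

theorem paste2_assoc_of_eq {a b a' b' h g g' f : Path2 H} {p p'} (ha : a = paste2 h g p)
    (hb : b = f) (ha' : a' = h) (hb' : b' = paste2 g' f p') (e : g = g') (q q') :
    paste2 a b q = paste2 a' b' q' := by
  subst ha hb ha' hb' e
  exact paste2_assoc _ _ _ _ _

theorem paste3_assoc_of_eq {a b a' b' h g g' f : Path3 H} {p p'} (ha : a = paste3 h g p)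
    (hb : b = f) (ha' : a' = h) (hb' : b' = paste3 g' f p') (e : g = g') (q q') :
    paste3 a b q = paste3 a' b' q' := by
  subst ha hb ha' hb' e
  exact Path3.ext (paste2_assoc _ _ _ (Path3.src_a0 p) (Path3.src_a0 q))
    (paste2_assoc _ _ _ (Path3.tgt_a0 p) (Path3.tgt_a0 q)) rfl rfl

/-- `paste2_pasteCocycle`, with all composites replaced by variables. -/
theorem paste2_pasteCocycle_of_eq {m n m' n' : Path2 H}
    {a b c d a' b' c' d' h₂ h₁ h₀ g₂ g₁ g₀ k₁ l₁ : Path1 H}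
    {x₁ x₂ x₃ x₄ x₅ x₆ y₁ y₂ y₃ y₄ z₁ z₂ z₃ z₄}
    (hm : m = pasteCocycle h₂ h₁ g₂ g₁ x₁ x₂ x₃ x₄) (hn : n = pathI2 (pathC0 h₀ g₀ x₅))
    (hm' : m' = pathI2 (pathC0 h₂ g₂ x₆)) (hn' : n' = pasteCocycle k₁ h₀ l₁ g₀ y₁ y₂ y₃ y₄)
    (ha : a = paste1 h₂ h₁ z₁) (hb : b = h₀) (hc : c = paste1 g₂ g₁ z₂) (hd : d = g₀)
    (ha' : a' = h₂) (hb' : b' = paste1 k₁ h₀ z₃) (hc' : c' = g₂) (hd' : d' = paste1 l₁ g₀ z₄)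
    (hk : h₁ = k₁) (hl : g₁ = l₁) (p₁ p₂ p₃ p₄ p₅ p₆ r₁ r₂ r₃ r₄ r₅ r₆) :
    pathC1 (paste2 m n p₁) (pasteCocycle a b c d p₂ p₃ p₄ p₅) p₆ =
      pathC1 (paste2 m' n' r₁) (pasteCocycle a' b' c' d' r₂ r₃ r₄ r₅) r₆ := by
  subst hk hl hm hn hm' hn' ha hb hc hd ha' hb' hc' hd'
  exact paste2_pasteCocycle _ _ _ _ _ _ x₁ y₁ x₂ y₂ x₃ y₃ y₄ _ _ _ _ _ _ _ _ _ _ _ _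

theorem pathUnit_comp_pathD0 (H : GrayCat.{u}) :
    (pathUnit H).comp (pathD0 H) = GrayFunctor.id H :=
  GrayFunctor.ext (funext H.s0_i1) rfl rfl rfl

theorem pathUnit_comp_pathD1 (H : GrayCat.{u}) :
    (pathUnit H).comp (pathD1 H) = GrayFunctor.id H :=
  GrayFunctor.ext (funext H.t0_i1) rfl rfl rfl

/-- A pseudo `Gray`-functor followed by a strict one is strict if it agrees with a strict one in
each dimension and its comparison 2-cells go to identities. -/
theorem comp_eq_strict {X Y : GrayCat.{u}} (m : T.toPs ⟶ X.toPs) (d : GrayFunctor X Y)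
    (E : GrayFunctor T Y) (h0 : ∀ x : T.C0, d.map0 (m.of.map0 x) = E.map0 x)
    (h1 : ∀ f : T.C1, d.map1 (m.of.map1 (Str.single f)) = E.map1 f)
    (h2 : ∀ α : T.C2, d.map2 (m.of.map2 (cell2 α)) = E.map2 α)
    (h3 : ∀ Γ : T.C3, d.map3 (m.of.map3 (cell3 Γ)) = E.map3 Γ)
    (hk : ∀ (g f : T.C1) (h : T.s0 g = T.t0 f),
      d.map2 (m.of.map2 (kappa g f h)) = Y.i2 (E.map1 (T.c0 g f h))) :
    m ≫ strict d = strict E :=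
  Cokleisli.hom_ext _ ((comp_strict_of m d).trans (q1_functor_ext _ _ h0
    (fun f => (h1 f).trans (congrArg E.map1 (Str.val_single f)).symm) h2 h3
    (fun g f h => (hk g f h).trans (E.map_i2 _).symm)))

section

variable {m : (pathPairs H).toPs ⟶ (path H).toPs}

theorem IsPasting.comp_source (hm : IsPasting H m.of) :
    m ≫ strict (pathD0 H) = strict (pbSnd (pathD0 H) (pathD1 H)) ≫ strict (pathD0 H) := by
  rw [strict_comp_strict]
  exact comp_eq_strict m _ _ (fun x => (congrArg H.s0 (hm.map0 x)).trans (H.s0_c0 _ _ _))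
    (fun f => (congrArg Path1.l (hm.map1 f) :)) (fun α => (congrArg Path2.a0 (hm.map2 α) :))
    (fun Γ => (congrArg Path3.G0 (hm.map3 Γ) :))
    fun g f h => congrArg Path2.a0 (hm.map_kappa g f h)

theorem IsPasting.comp_target (hm : IsPasting H m.of) :
    m ≫ strict (pathD1 H) = strict (pbFst (pathD0 H) (pathD1 H)) ≫ strict (pathD1 H) := by
  rw [strict_comp_strict]
  exact comp_eq_strict m _ _ (fun x => (congrArg H.t0 (hm.map0 x)).trans (H.t0_c0 _ _ _))
    (fun f => (congrArg Path1.r (hm.map1 f) :)) (fun α => (congrArg Path2.a1 (hm.map2 α) :))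
    (fun Γ => (congrArg Path3.G1 (hm.map3 Γ) :))
    fun g f h => congrArg Path2.a1 (hm.map_kappa g f h)

variable {l : T.toPs ⟶ (pathPairs H).toPs} {a b : T.toPs ⟶ (path H).toPs}

/-- The values of `l ≫ m` on generators, in terms of the components `a` and `b` of `l`. The pasting
exists because `a` and `b` have matching sides, which is the existential part of the statement. -/
theorem IsPasting.comp_map0 (hm : IsPasting H m.of)
    (ha : l ≫ strict (pbFst (pathD0 H) (pathD1 H)) = a)
    (hb : l ≫ strict (pbSnd (pathD0 H) (pathD1 H)) = b) (x : T.C0) :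
    ∃ p, (l ≫ m).of.map0 x = H.c0 (a.of.map0 x) (b.of.map0 x) p := by
  subst ha hb
  exact ⟨_, hm.map0 _⟩

theorem IsPasting.comp_single (hm : IsPasting H m.of)
    (ha : l ≫ strict (pbFst (pathD0 H) (pathD1 H)) = a)
    (hb : l ≫ strict (pbSnd (pathD0 H) (pathD1 H)) = b) (f : T.C1) :
    ∃ p, (l ≫ m).of.map1 (Str.single f) =
      paste1 (a.of.map1 (Str.single f)) (b.of.map1 (Str.single f)) p := by
  subst ha hb
  rw [comp_strict_of, comp_strict_of]
  exact ⟨_, (comp_of_single l m f).trans (hm.map1 _)⟩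

theorem IsPasting.comp_cell2 (hm : IsPasting H m.of)
    (ha : l ≫ strict (pbFst (pathD0 H) (pathD1 H)) = a)
    (hb : l ≫ strict (pbSnd (pathD0 H) (pathD1 H)) = b) (α : T.C2) :
    ∃ p, (l ≫ m).of.map2 (cell2 α) = paste2 (a.of.map2 (cell2 α)) (b.of.map2 (cell2 α)) p := by
  subst ha hb
  rw [comp_strict_of, comp_strict_of]
  exact ⟨_, (comp_of_cell2 l m α).trans (hm.map2 _)⟩

theorem IsPasting.comp_cell3 (hm : IsPasting H m.of)
    (ha : l ≫ strict (pbFst (pathD0 H) (pathD1 H)) = a)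
    (hb : l ≫ strict (pbSnd (pathD0 H) (pathD1 H)) = b) (Γ : T.C3) :
    ∃ p, (l ≫ m).of.map3 (cell3 Γ) = paste3 (a.of.map3 (cell3 Γ)) (b.of.map3 (cell3 Γ)) p := by
  subst ha hb
  rw [comp_strict_of, comp_strict_of]
  exact ⟨_, (comp_of_cell3 l m Γ).trans (hm.map3 _)⟩

theorem IsPasting.comp_kappa (hm : IsPasting H m.of)
    (ha : l ≫ strict (pbFst (pathD0 H) (pathD1 H)) = a)
    (hb : l ≫ strict (pbSnd (pathD0 H) (pathD1 H)) = b) (h g : T.C1) (p : T.s0 h = T.t0 g) :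
    ∃ p₁ p₂ p₃ p₄ p₅ p₆, (l ≫ m).of.map2 (kappa h g p) =
      pathC1 (paste2 (a.of.map2 (kappa h g p)) (b.of.map2 (kappa h g p)) p₁)
        (pasteCocycle (a.of.map1 (Str.single h)) (b.of.map1 (Str.single h))
          (a.of.map1 (Str.single g)) (b.of.map1 (Str.single g)) p₂ p₃ p₄ p₅) p₆ := by
  subst ha hb
  rw [comp_strict_of, comp_strict_of]
  have e1 := hm.map2 (l.of.map2 (kappa h g p))
  have e2 := hm.map_kappa (l.of.map1 (Str.single h)) (l.of.map1 (Str.single g))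
    (comp_single_aux l.of p)
  obtain ⟨q, e⟩ : ∃ q, (l ≫ m).of.map2 (kappa h g p) = (path H).c1 _ _ q :=
    ⟨_, comp_of_kappa l m h g p⟩
  exact ⟨_, _, _, _, _, (congrArg (path H).s1 e1).symm.trans (q.trans (congrArg (path H).t1 e2)),
    e.trans (c1_congr (G := (path H).toGrayData) e1 e2 _)⟩

theorem IsPasting.unit_comp (hm : IsPasting H m.of) {l : (path H).toPs ⟶ (pathPairs H).toPs}
    (ha : l ≫ strict (pbFst (pathD0 H) (pathD1 H)) = strict (pathD1 H) ≫ strict (pathUnit H))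
    (hb : l ≫ strict (pbSnd (pathD0 H) (pathD1 H)) = 𝟙 (path H).toPs) :
    l ≫ m = 𝟙 (path H).toPs := by
  rw [strict_comp_strict] at ha
  refine Cokleisli.hom_ext _ (q1_functor_ext _ _ ?_ ?_ ?_ ?_ ?_)
  · intro x
    obtain ⟨p, e⟩ := hm.comp_map0 ha hb x
    exact e.trans (i1_c0 _ _ _)
  · intro f
    obtain ⟨p, e⟩ := hm.comp_single ha hb f
    exact e.trans (pathUnit1_paste1 _ _ _)
  · intro α
    obtain ⟨p, e⟩ := hm.comp_cell2 ha hb α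
    exact e.trans (pathUnit2_paste2 _ _ _)
  · intro Γ
    obtain ⟨p, e⟩ := hm.comp_cell3 ha hb Γ
    exact e.trans (Path3.ext (pathUnit2_paste2 _ _ (Path3.src_a0 p))
      (pathUnit2_paste2 _ _ (Path3.tgt_a0 p)) rfl p)
  · intro h g q
    obtain ⟨p₁, p₂, p₃, p₄, p₅, p₆, e⟩ := hm.comp_kappa ha hb h g q
    have v : ∀ f : (path H).C1, Str.val (Str.single f) = f := Str.val_single
    exact e.trans ((pathC1_congr (pathUnit2_paste2 _ _ p₁)
      (pasteCocycle_of_left_units (congrArg (fun f : Path1 H => pathUnit1 f.r) (v h)) (v h)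
        (congrArg (fun f : Path1 H => pathUnit1 f.r) (v g)) (v g) p₂ p₃ p₄ p₅ q) p₆ rfl).trans
      (i2_c1 (G := (path H).toGrayData) _ _ rfl))

theorem IsPasting.comp_unit (hm : IsPasting H m.of) {l : (path H).toPs ⟶ (pathPairs H).toPs}
    (ha : l ≫ strict (pbFst (pathD0 H) (pathD1 H)) = 𝟙 (path H).toPs)
    (hb : l ≫ strict (pbSnd (pathD0 H) (pathD1 H)) = strict (pathD0 H) ≫ strict (pathUnit H)) :
    l ≫ m = 𝟙 (path H).toPs := by
  rw [strict_comp_strict] at hb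
  refine Cokleisli.hom_ext _ (q1_functor_ext _ _ ?_ ?_ ?_ ?_ ?_)
  · intro x
    obtain ⟨p, e⟩ := hm.comp_map0 ha hb x
    exact e.trans (c0_i1 _ _ _)
  · intro f
    obtain ⟨p, e⟩ := hm.comp_single ha hb f
    exact e.trans (paste1_pathUnit1 _ _ _)
  · intro α
    obtain ⟨p, e⟩ := hm.comp_cell2 ha hb α
    exact e.trans (paste2_pathUnit2 _ _ _)
  · intro Γ
    obtain ⟨p, e⟩ := hm.comp_cell3 ha hb Γ
    exact e.trans (Path3.ext (paste2_pathUnit2 _ _ (Path3.src_a0 p))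
      (paste2_pathUnit2 _ _ (Path3.tgt_a0 p)) p.symm rfl)
  · intro h g q
    obtain ⟨p₁, p₂, p₃, p₄, p₅, p₆, e⟩ := hm.comp_kappa ha hb h g q
    have v : ∀ f : (path H).C1, Str.val (Str.single f) = f := Str.val_single
    exact e.trans ((pathC1_congr (paste2_pathUnit2 _ _ p₁)
      (pasteCocycle_of_right_units (v h) (congrArg (fun f : Path1 H => pathUnit1 f.l) (v h))
        (v g) (congrArg (fun f : Path1 H => pathUnit1 f.l) (v g)) p₂ p₃ p₄ p₅ q) p₆ rfl).trans
      (i2_c1 (G := (path H).toGrayData) _ _ rfl))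

theorem IsPasting.strict_comp_single (hm : IsPasting H m.of) (Q : GrayFunctor T (pathPairs H))
    (f : T.C1) : (strict Q ≫ m).of.map1 (Str.single f) =
      paste1 (Q.map1 f).1.1 (Q.map1 f).1.2 (Q.map1 f).2 := by
  rw [strict_comp_of]
  exact (congrArg m.of.map1 (Str.single_map Q f)).trans (hm.map1 _)

theorem IsPasting.strict_comp_cell2 (hm : IsPasting H m.of) (Q : GrayFunctor T (pathPairs H))
    (α : T.C2) : (strict Q ≫ m).of.map2 (cell2 α) =
      paste2 (Q.map2 α).1.1 (Q.map2 α).1.2 (Q.map2 α).2 := by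
  rw [strict_comp_of]
  exact (congrArg m.of.map2 (q1Map_cell2 Q α)).trans (hm.map2 (Q.map2 α))

theorem IsPasting.strict_comp_cell3 (hm : IsPasting H m.of) (Q : GrayFunctor T (pathPairs H))
    (Γ : T.C3) : (strict Q ≫ m).of.map3 (cell3 Γ) =
      paste3 (Q.map3 Γ).1.1 (Q.map3 Γ).1.2 (Q.map3 Γ).2 := by
  rw [strict_comp_of]
  exact (congrArg m.of.map3 (q1Map_cell3 Q Γ)).trans (hm.map3 (Q.map3 Γ))

theorem IsPasting.strict_comp_kappa (hm : IsPasting H m.of) (Q : GrayFunctor T (pathPairs H))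
    (h g : T.C1) (p : T.s0 h = T.t0 g) : ∃ p₁ p₂, (strict Q ≫ m).of.map2 (kappa h g p) =
      pasteCocycle (Q.map1 h).1.1 (Q.map1 h).1.2 (Q.map1 g).1.1 (Q.map1 g).1.2 (Q.map1 h).2
        (Q.map1 g).2 p₁ p₂ := by
  have q : (pathPairs H).s0 (Q.map1 h) = (pathPairs H).t0 (Q.map1 g) := by simp [p]
  rw [strict_comp_of]
  exact ⟨_, _, (congrArg m.of.map2 (q1Map_kappa Q h g p)).trans (hm.map_kappa _ _ q)⟩

theorem IsPasting.comp_assoc (hm : IsPasting H m.of) (Q Q' : GrayFunctor T (pathPairs H))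
    (w : Q.comp (pbSnd (pathD0 H) (pathD1 H)) = Q'.comp (pbFst (pathD0 H) (pathD1 H)))
    {l l' : T.toPs ⟶ (pathPairs H).toPs}
    (ha : l ≫ strict (pbFst (pathD0 H) (pathD1 H)) = strict Q ≫ m)
    (hb : l ≫ strict (pbSnd (pathD0 H) (pathD1 H)) =
      strict Q' ≫ strict (pbSnd (pathD0 H) (pathD1 H)))
    (ha' : l' ≫ strict (pbFst (pathD0 H) (pathD1 H)) =
      strict Q ≫ strict (pbFst (pathD0 H) (pathD1 H)))
    (hb' : l' ≫ strict (pbSnd (pathD0 H) (pathD1 H)) = strict Q' ≫ m) :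
    l ≫ m = l' ≫ m := by
  rw [strict_comp_strict] at hb ha'
  have w0 : ∀ x : T.C0, (Q.map0 x).1.2 = (Q'.map0 x).1.1 :=
    fun x => congrArg (fun L => L.map0 x) w
  have w1 : ∀ f : T.C1, (Q.map1 f).1.2 = (Q'.map1 f).1.1 :=
    fun f => congrArg (fun L => L.map1 f) w
  have w2 : ∀ f : T.C2, (Q.map2 f).1.2 = (Q'.map2 f).1.1 :=
    fun f => congrArg (fun L => L.map2 f) w
  have w3 : ∀ f : T.C3, (Q.map3 f).1.2 = (Q'.map3 f).1.1 :=
    fun f => congrArg (fun L => L.map3 f) w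
  have v : ∀ f : T.C1, Str.val (Str.single f) = f := Str.val_single
  have v1 := fun f : T.C1 => congrArg (fun x => (Q.map1 x).1.1) (v f)
  have v2 := fun f : T.C1 => congrArg (fun x => (Q'.map1 x).1.2) (v f)
  refine Cokleisli.hom_ext _ (q1_functor_ext _ _ ?_ ?_ ?_ ?_ ?_)
  · intro x
    obtain ⟨p, e⟩ := hm.comp_map0 ha hb x
    obtain ⟨p', e'⟩ := hm.comp_map0 ha' hb' x
    exact e.trans ((c0_assoc_of_eq (hm.map0 (Q.map0 x)) rfl rfl (hm.map0 (Q'.map0 x)) (w0 x)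
      p p').trans e'.symm)
  · intro f
    obtain ⟨p, e⟩ := hm.comp_single ha hb f
    obtain ⟨p', e'⟩ := hm.comp_single ha' hb' f
    exact e.trans ((paste1_assoc_of_eq (hm.strict_comp_single Q f) (v2 f) (v1 f)
      (hm.strict_comp_single Q' f) (w1 f) p p').trans e'.symm)
  · intro α
    obtain ⟨p, e⟩ := hm.comp_cell2 ha hb α
    obtain ⟨p', e'⟩ := hm.comp_cell2 ha' hb' α
    exact e.trans ((paste2_assoc_of_eq (hm.strict_comp_cell2 Q α) rfl rfl
      (hm.strict_comp_cell2 Q' α) (w2 α) p p').trans e'.symm)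
  · intro Γ
    obtain ⟨p, e⟩ := hm.comp_cell3 ha hb Γ
    obtain ⟨p', e'⟩ := hm.comp_cell3 ha' hb' Γ
    exact e.trans ((paste3_assoc_of_eq (hm.strict_comp_cell3 Q Γ) rfl rfl
      (hm.strict_comp_cell3 Q' Γ) (w3 Γ) p p').trans e'.symm)
  · intro h g q
    obtain ⟨p₁, p₂, p₃, p₄, p₅, p₆, e⟩ := hm.comp_kappa ha hb h g q
    obtain ⟨r₁, r₂, r₃, r₄, r₅, r₆, e'⟩ := hm.comp_kappa ha' hb' h g q
    obtain ⟨s₁, s₂, k⟩ := hm.strict_comp_kappa Q h g q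
    obtain ⟨t₁, t₂, k'⟩ := hm.strict_comp_kappa Q' h g q
    let E := Q.comp (pbFst (pathD0 H) (pathD1 H))
    let E' := Q'.comp (pbSnd (pathD0 H) (pathD1 H))
    exact e.trans ((paste2_pasteCocycle_of_eq (x₅ := t₂) (x₆ := s₁) k
      ((E'.map_i2 _).trans (congrArg (path H).i2 (E'.map_c0 h g q)))
      ((E.map_i2 _).trans (congrArg (path H).i2 (E.map_c0 h g q))) k'
      (hm.strict_comp_single Q h) (v2 h) (hm.strict_comp_single Q g) (v2 g)
      (v1 h) (hm.strict_comp_single Q' h) (v1 g) (hm.strict_comp_single Q' g) (w1 h) (w1 g)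
      p₁ p₂ p₃ p₄ p₅ p₆ r₁ r₂ r₃ r₄ r₅ r₆).trans e'.symm)

end

end

end GrayCat

theorem mainTheorem5 (H : GrayCat.{u}) :
    ∃ m : (GrayCat.pb (GrayCat.pathD0 H) (GrayCat.pathD1 H)).toPs ⟶ (GrayCat.path H).toPs,
      GrayCat.IsPasting H m.of ∧
      IsInternalCategory
        (GrayCat.strict (GrayCat.pathD0 H)) (GrayCat.strict (GrayCat.pathD1 H))
        (GrayCat.strict (GrayCat.pathUnit H))
        (GrayCat.strict (GrayCat.pbFst (GrayCat.pathD0 H) (GrayCat.pathD1 H)))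
        (GrayCat.strict (GrayCat.pbSnd (GrayCat.pathD0 H) (GrayCat.pathD1 H)))
        (GrayCat.strict (GrayCat.pbFst (GrayCat.pbSnd (GrayCat.pathD0 H) (GrayCat.pathD1 H))
          (GrayCat.pbFst (GrayCat.pathD0 H) (GrayCat.pathD1 H))))
        (GrayCat.strict (GrayCat.pbSnd (GrayCat.pbSnd (GrayCat.pathD0 H) (GrayCat.pathD1 H))
          (GrayCat.pbFst (GrayCat.pathD0 H) (GrayCat.pathD1 H)))) m := by
  have hm := GrayCat.isPasting_pasteFunctor H
  have hp := GrayCat.isPullback_strict (GrayCat.pathD0 H) (GrayCat.pathD1 H)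
  refine ⟨.mk (GrayCat.pasteFunctor H), hm, ?_⟩
  refine
    { pairs := hp
      triples := GrayCat.isPullback_strict _ _
      unit_source := ?_
      unit_target := ?_
      comp_source := GrayCat.IsPasting.comp_source hm
      comp_target := GrayCat.IsPasting.comp_target hm
      unit_comp := GrayCat.IsPasting.unit_comp hm (hp.lift_fst _ _ _) (hp.lift_snd _ _ _)
      comp_unit := GrayCat.IsPasting.comp_unit hm (hp.lift_fst _ _ _) (hp.lift_snd _ _ _)
      assoc := GrayCat.IsPasting.comp_assoc hm _ _ (GrayCat.pb_condition _ _)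
        (hp.lift_fst _ _ _) (hp.lift_snd _ _ _) (hp.lift_fst _ _ _) (hp.lift_snd _ _ _) }
  · exact (GrayCat.strict_comp_strict _ _).trans
      (congrArg GrayCat.strict (GrayCat.pathUnit_comp_pathD0 H))
  · exact (GrayCat.strict_comp_strict _ _).trans
      (congrArg GrayCat.strict (GrayCat.pathUnit_comp_pathD1 H))
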